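/- **Setting.** Let $\nu$ be a Borel probability measure on $\mathbb R$ with $\int|y|\,\nu(dy)<\infty$, let $Y\sim\nu$, let $b:\mathbb R\to\mathbb R_+$ be Borel with $\mathbb E[b(Y)]<\infty$, let $\psi:\mathbb R\to\mathbb R_+$ be $L$-Lipschitz, let $T>0$, $M\in\mathbb N^*$, $\Delta=T/M$, and let $h$ be a Borel kernel that is integrable on $[0,T]$. Put $$\rho_h=L\,\mathbb E[b(Y)]\int_0^T|h(t)|\,dt,\qquad \rho_{h,\Delta}=L\,\mathbb E[b(Y)]\sum_{k=1}^M|h(k\Delta)|\,\Delta .$$ The continuous and the discrete stability conditions are $\rho_h<1$ and $\rho_{h,\Delta}<1$. With $(y)_\Delta=\lfloor y/\Delta\rfloor\Delta$, set $$C_S(h,\Delta)=\frac1{1-\rho_h}+\frac1{1-\rho_{h,\Delta}},$$ $$C_R(h,\Delta)=\int_0^\Delta|h(y)|\,dy+\sup_{\epsilon\in[0,\Delta]}\int_0^{T-\Delta}|h(y+\epsilon)-h(y)|\,dy+\int_0^{T-\Delta}\bigl|h(y)-h((y)_\Delta+\Delta)\bigr|\,dy .$$ Let $P$ be a Poisson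 random measure on $\mathbb R_+\times\mathbb R_+\times\mathbb R$ with intensity $ds\,d\theta\,\nu(dy)$, with filtration $\mathcal F_t=\sigma(P(A): A\subseteq(0,t]\times\mathbb R_+\times\mathbb R \text{ Borel})$. The continuous-time marked Hawkes risk on $[0,T]$ is $R$, where $R$ is $\mathcal F$-adapted, $\lambda$ is $\mathcal F$-predictable, almost surely $P\{(s,\theta,y): s\le T,\ \theta\le\lambda_s\}<\infty$, and almost surely for all $t\in[0,T]$ $$R_t=\int_{(0,t]\times\mathbb R_+\times\mathbb R}y\,\mathbf 1_{\theta\le\lambda_s}\,P(ds,d\theta,dy),\qquad \lambda_t=\psi\Bigl(\int_{[0,t)\times\mathbb R_+\times\mathbb R}h(t-s)\,\mathbf 1_{\theta\le\lambda_s}\,b(y)\,P(ds,d\theta,dy)\Bigr).$$ Its discretisation, thinned from the same $P$, is defined recursively by $l_n=\psi\bigl(\sum_{k=1}^{n-1}h((n-k)\Delta)X_k\bigr)$, $X_n=\int_{((n-1)\Delta,n\Delta]\times\mathbb R_+\times\mathbb R}b(y)\mathbf 1_{\theta\le l_n}\,dP$ and $$R^\Delta_t=\sum_{k=1}^{\lfloor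 t/\Delta\rfloor}\int_{((k-1)\Delta,k\Delta]\times\mathbb R_+\times\mathbb R}y\,\mathbf 1_{\theta\le l_k}\,P(ds,d\theta,dy).$$ For $\eta\in(0,1)$ write $$\|u\|_{W^{\eta,1}_T}=\int_0^T|u(t)|\,dt+\int_0^T\!\!\int_0^T\frac{|u(t)-u(s)|}{|t-s|^{1+\eta}}\,dt\,ds .$$ **Theorem.** Let $\eta\in(0,1)$, $L\ge 0$, $c\in\mathbb R$, $\nu$ and $b$ be as above, and let $r<1$, $T_0>0$ and $\Delta_0>0$. There is a constant $K>0$, depending only on these data, such that for all $\psi$ ($L$-Lipschitz, non-negative, $\psi(0)\le c$), all $T\ge T_0$, all $M\ge1$ with $\Delta=T/M\le\Delta_0$, all $h$ (Borel, integrable on $[0,T]$) with $\rho_h\le r$ and $\rho_{h,\Delta}<1$, and all $P$, $R$, $R^\Delta$ as above, $$\mathbb E\,\|R-R^\Delta\|_{W^{\eta,1}_T}\le K\,C_S(h,\Delta)\,\bigl[T^2\,C_R(h,\Delta)+T\,\Delta^{1-\eta}\bigr].$$ In particular $K$ does not depend on $T$ or $\Delta$. -/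

import Mathlib

open MeasureTheory ProbabilityTheory
open scoped NNReal ENNReal

namespace HawkesRisk

/-- Points `(s, θ, y)`: time, height, mark. -/
abbrev Point : Type := ℝ≥0 × ℝ≥0 × ℝ

/-- Lebesgue measure on `ℝ₊`. -/
noncomputable def lebesgueNN : Measure ℝ≥0 :=
  Measure.comap (fun t : ℝ≥0 => (t : ℝ)) volume

/-- The intensity measure `ds × dθ × ν(dy)` on `ℝ₊ × ℝ₊ × ℝ`. -/
noncomputable def intensityMeasure (ν : Measure ℝ) : Measure Point :=
  lebesgueNN.prod (lebesgueNN.prod ν)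

/-- `P` is a Poisson random measure with intensity `μ` under the probability `Q`: a random measure
whose values on measurable sets of finite intensity are Poisson distributed, and whose values on
finitely many pairwise disjoint measurable sets are independent. -/
structure IsPoissonRandomMeasure {Ω E : Type*} [MeasurableSpace Ω] [MeasurableSpace E]
    (P : Ω → Measure E) (μ : Measure E) (Q : Measure Ω) : Prop where
  measurable : Measurable P
  law : ∀ A : Set E, MeasurableSet A → μ A < ∞ →
    Q.map (fun ω => P ω A) =
      (poissonMeasure (μ A).toNNReal).map (fun n : ℕ => (n : ℝ≥0∞))
  indep : ∀ (n : ℕ) (A : Fin n → Set E), (∀ i, MeasurableSet (A i)) →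
    Pairwise (fun i j => Disjoint (A i) (A j)) →
    iIndepFun (fun (i : Fin n) (ω : Ω) => P ω (A i)) Q

/-- The filtration of the random measure `P`: at time `t` it is generated by the variables `P(A)`,
for measurable `A ⊆ (0,t] × ℝ₊ × ℝ`. -/
def pointFiltration {Ω : Type*} [mΩ : MeasurableSpace Ω] (P : Ω → Measure Point)
    (hP : Measurable P) : Filtration ℝ≥0 mΩ where
  seq t := ⨆ (A : Set Point) (_ : MeasurableSet A ∧ A ⊆ {x | 0 < x.1 ∧ x.1 ≤ t}),
    MeasurableSpace.comap (fun ω => P ω A) inferInstance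
  mono' s t hst := by
    refine iSup₂_le fun A hA => ?_
    exact le_iSup₂_of_le A ⟨hA.1, fun x hx => ⟨(hA.2 hx).1, (hA.2 hx).2.trans hst⟩⟩ le_rfl
  le' t := by
    refine iSup₂_le fun A hA => ?_
    exact ((Measure.measurable_coe hA.1).comp hP).comap_le

/-- `(R, lam)` solves on `[0,T]` the thinning equations of the marked Hawkes risk driven by `P`:
`R` is adapted, `lam` is predictable, and almost surely, for all `t ∈ [0,T]`,
`R_t = ∫_{(0,t] × ℝ₊ × ℝ} y 1_{θ ≤ lam_s} P(ds,dθ,dy)` and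
`lam_t = ψ (∫_{[0,t) × ℝ₊ × ℝ} h(t-s) 1_{θ ≤ lam_s} b(y) P(ds,dθ,dy))`.
The field `finite` says that the associated counting process `N` is finite on `[0,T]`, so that
these integrals are (finite) sums. -/
structure IsHawkesRisk {Ω : Type*} [MeasurableSpace Ω] (Q : Measure Ω)
    (P : Ω → Measure Point) (hP : Measurable P) (ψ h b : ℝ → ℝ) (T : ℝ≥0)
    (R lam : ℝ≥0 → Ω → ℝ) : Prop where
  adapted : Adapted (pointFiltration P hP) R
  predictable : IsStronglyPredictable (pointFiltration P hP) lam
  finite : ∀ᵐ ω ∂Q, P ω {x | x.1 ≤ T ∧ (x.2.1 : ℝ) ≤ lam x.1 ω} < ∞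
  risk_eq : ∀ᵐ ω ∂Q, ∀ t ≤ T, R t ω =
    ∫ x in {x : Point | 0 < x.1 ∧ x.1 ≤ t ∧ (x.2.1 : ℝ) ≤ lam x.1 ω}, x.2.2 ∂(P ω)
  intensity_eq : ∀ᵐ ω ∂Q, ∀ t ≤ T, lam t ω =
    ψ (∫ x in {x : Point | x.1 < t ∧ (x.2.1 : ℝ) ≤ lam x.1 ω},
      h ((t : ℝ) - (x.1 : ℝ)) * b x.2.2 ∂(P ω))

/-- The points in the `k`-th time bin `((k-1)Δ, kΔ]` (for `k ≥ 1`) below the level `l`. -/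
def binBelow (Δ : ℝ≥0) (k : ℕ) (l : ℝ) : Set Point :=
  {x | ((k - 1 : ℕ) : ℝ≥0) * Δ < x.1 ∧ x.1 ≤ (k : ℝ≥0) * Δ ∧ (x.2.1 : ℝ) ≤ l}

/-- The discrete intensity `l_n = ψ (∑_{k=1}^{n-1} h((n-k)Δ) X_k)`, where
`X_k = ∫_{((k-1)Δ,kΔ] × ℝ₊ × ℝ} b(y) 1_{θ ≤ l_k} p(ds,dθ,dy)`, for a realisation `p` of the
random measure. -/
noncomputable def discreteIntensity (ψ h b : ℝ → ℝ) (Δ : ℝ≥0) (p : Measure Point) (n : ℕ) : ℝ :=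
  ψ (∑ k ∈ (Finset.Ico 1 n).attach, h (((n : ℝ) - (k.1 : ℝ)) * (Δ : ℝ)) *
    ∫ x in binBelow Δ k.1 (discreteIntensity ψ h b Δ p k.1), b x.2.2 ∂p)
termination_by n
decreasing_by exact (Finset.mem_Ico.mp k.2).2

theorem discreteIntensity_eq (ψ h b : ℝ → ℝ) (Δ : ℝ≥0) (p : Measure Point) (n : ℕ) :
    discreteIntensity ψ h b Δ p n =
      ψ (∑ k ∈ Finset.Ico 1 n, h (((n : ℝ) - (k : ℝ)) * (Δ : ℝ)) *
        ∫ x in binBelow Δ k (discreteIntensity ψ h b Δ p k), b x.2.2 ∂p) := by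
  rw [discreteIntensity]
  congr 1
  exact Finset.sum_attach (Finset.Ico 1 n) (fun k => h (((n : ℝ) - (k : ℝ)) * (Δ : ℝ)) *
    ∫ x in binBelow Δ k (discreteIntensity ψ h b Δ p k), b x.2.2 ∂p)

/-- The discrete-time Hawkes risk `R^Δ_t = ∑_{k=1}^{⌊t/Δ⌋} ∫_{((k-1)Δ,kΔ] × ℝ₊ × ℝ} y 1_{θ ≤ l_k} dP`,
thinned from the random measure `P`. -/
noncomputable def discreteRisk {Ω : Type*} (P : Ω → Measure Point) (ψ h b : ℝ → ℝ) (Δ : ℝ≥0)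
    (t : ℝ≥0) (ω : Ω) : ℝ :=
  ∑ k ∈ Finset.Icc 1 ⌊t / Δ⌋₊,
    ∫ x in binBelow Δ k (discreteIntensity ψ h b Δ (P ω) k), x.2.2 ∂(P ω)

/-- `ρ_h = L ‖h‖_{L¹([0,T])} E[b(Y)]`, with `Y` of law `ν`. -/
noncomputable def rho (L : ℝ≥0) (ν : Measure ℝ) (b h : ℝ → ℝ) (T : ℝ≥0) : ℝ :=
  (L : ℝ) * (∫ t in (0 : ℝ)..(T : ℝ), |h t|) * ∫ y, b y ∂ν

/-- `ρ_{h,Δ} = L ∑_{k=1}^M |h(kΔ)| Δ E[b(Y)]`, with `Y` of law `ν` and `Δ = T/M`. -/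
noncomputable def rhoDiscrete (L : ℝ≥0) (ν : Measure ℝ) (b h : ℝ → ℝ) (T : ℝ≥0) (M : ℕ) : ℝ :=
  (L : ℝ) * (∑ k ∈ Finset.Icc 1 M, |h ((k : ℝ) * ((T : ℝ) / M))| * ((T : ℝ) / M)) * ∫ y, b y ∂ν

/-- `C_S(h,Δ) = 1/(1-ρ_h) + 1/(1-ρ_{h,Δ})`. -/
noncomputable def stabilityConst (L : ℝ≥0) (ν : Measure ℝ) (b h : ℝ → ℝ) (T : ℝ≥0) (M : ℕ) : ℝ :=
  1 / (1 - rho L ν b h T) + 1 / (1 - rhoDiscrete L ν b h T M)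

/-- `C_R(h,Δ) = ∫_0^Δ |h(y)| dy + sup_{ε ∈ [0,Δ]} ∫_0^{T-Δ} |h(y+ε) - h(y)| dy
  + ∫_0^{T-Δ} |h(y) - h(⌊y/Δ⌋Δ + Δ)| dy`. -/
noncomputable def regularityConst (h : ℝ → ℝ) (T Δ : ℝ) : ℝ :=
  (∫ y in (0 : ℝ)..Δ, |h y|)
    + (⨆ ε : Set.Icc (0 : ℝ) Δ, ∫ y in (0 : ℝ)..(T - Δ), |h (y + (ε : ℝ)) - h y|)
    + ∫ y in (0 : ℝ)..(T - Δ), |h y - h ((⌊y / Δ⌋ : ℝ) * Δ + Δ)|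

/-- The norm of the fractional Sobolev space `W^{η,1}` on `[0,T]`, with values in `[0,∞]`:
`∫_0^T |u(t)| dt + ∫_0^T ∫_0^T |u(t) - u(s)| / |t - s|^{1+η} dt ds`. -/
noncomputable def sobolevNorm (η T : ℝ) (u : ℝ → ℝ) : ℝ≥0∞ :=
  (∫⁻ t in Set.Icc 0 T, ‖u t‖ₑ) +
    ∫⁻ s in Set.Icc 0 T, ∫⁻ t in Set.Icc 0 T,
      ‖u t - u s‖ₑ / ENNReal.ofReal (|t - s| ^ (1 + η))

end HawkesRisk

/-!
The discretisation is thinned from the same Poisson random measure as the Hawkes process, so the two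
risks differ for two reasons only. A point at time `s` that the Hawkes process accepts is counted by
`R` from time `s` on, but by `R^Δ` only from the end of its time bin on; and a point whose height
lies between the two intensities is accepted by exactly one of the processes. Along a path,
`R - R^Δ` is therefore a superposition of indicators of intervals: intervals of length at most `Δ`
for the accepted points, and intervals that last until `T` for the points between the intensities.
The indicator of an interval of length `l` has a fractional Sobolev norm of order `l + l^(1-η)`
(`sobolevNorm_indicator_Ico_le`), so Minkowski's inequality bounds the norm of `R - R^Δ` by two
thinned sums of the `|y|` (`ae_sobolevNorm_risk_sub_le`). Both intensities are predictable, hence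
Campbell's formula (`IsPoissonRandomMeasure.campbell`) turns the expectations of these sums into
`E|Y|` times `X = ∫_0^T E[lam_s] ds` and `A = ∫_0^T E|lam_s - l_s| ds`, and it remains to show that
`X ≤ c⁺ T / (1 - ρ_h)`, where `c⁺ = max c 0`, and `A ≤ L E[b(Y)] C_R X / (1 - ρ_{h,Δ})`.

The bound on `X` (`lintegral_intensity_le`) follows from the equation of the intensity, which gives
`X ≤ c⁺ T + ρ_h X`. To divide, `X` has to be finite, and this is not assumed. The integrated
intensity is almost surely finite, because a Poisson random measure has finitely many points in a
set of finite mass; so the inequality is solved for the process stopped when the integrated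
intensity exceeds `n`, and `n` tends to infinity.

For `A` (`lintegral_intensity_sub_le`) the difference of the two equations is split into the points
accepted by exactly one process, weighted by the kernel of the discretisation, which contributes at
most `ρ_{h,Δ} A`; and the points accepted by the Hawkes process, weighted by the difference of the
kernels. The integral of the latter over time is at most `C_R` (`lintegral_kernelError_le`): until
the end of the bin of `s` the discretisation ignores the point, then the kernel is first shifted by
less than `Δ` and then sampled at the multiples of `Δ`.

Campbell's formula is proved on rectangles by the independence of the past and the future, and
extended by a π-λ argument on the predictable σ-algebra. Two technical points are dealt with on the
way. A Poisson random measure need not be an s-finite kernel, and the filtration is not complete;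
both difficulties disappear after replacing `P ω` by `tame Δ (P ω)`, which is almost surely the same
measure and is a countable sum of finite kernels, each of them measurable with respect to the past
at the end of a time bin. And the predictable σ-algebra lives on a type `Pred` of its own, so that
it does not compete with the product σ-algebra on `ℝ₊ × Ω`.
-/

namespace HawkesRisk

open Set Filter Topology

/-! ### Lebesgue measure on the half-line -/

theorem measurableEmbedding_coe_nnreal : MeasurableEmbedding (fun t : ℝ≥0 => (t : ℝ)) :=
  MeasurableEmbedding.subtype_coe measurableSet_Ici

theorem range_coe_nnreal : range (fun t : ℝ≥0 => (t : ℝ)) = Ici 0 := by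
  ext x; exact ⟨fun ⟨t, ht⟩ => ht ▸ t.2, fun hx => ⟨⟨x, hx⟩, rfl⟩⟩

theorem map_lebesgueNN : lebesgueNN.map (fun t : ℝ≥0 => (t : ℝ)) = volume.restrict (Ici 0) := by
  rw [lebesgueNN, measurableEmbedding_coe_nnreal.map_comap, range_coe_nnreal]

theorem lintegral_lebesgueNN (f : ℝ → ℝ≥0∞) :
    ∫⁻ t, f t ∂lebesgueNN = ∫⁻ t in Ici 0, f t := by
  rw [← map_lebesgueNN, measurableEmbedding_coe_nnreal.lintegral_map]

theorem lebesgueNN_preimage (s : Set ℝ) (hs : MeasurableSet s) :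
    lebesgueNN ((fun t : ℝ≥0 => (t : ℝ)) ⁻¹' s) = volume (s ∩ Ici 0) := by
  rw [← Measure.map_apply measurableEmbedding_coe_nnreal.measurable hs, map_lebesgueNN,
    Measure.restrict_apply hs]

theorem lebesgueNN_coe_le (a : ℝ) : lebesgueNN {θ : ℝ≥0 | (θ : ℝ) ≤ a} = ENNReal.ofReal a := by
  have := lebesgueNN_preimage (Iic a) measurableSet_Iic
  rw [show Iic a ∩ Ici 0 = Icc 0 a by ext; simp [and_comm], Real.volume_Icc, sub_zero] at this
  exact this

theorem lebesgueNN_Iic (a : ℝ≥0) : lebesgueNN (Iic a) = a := by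
  rw [← ENNReal.ofReal_coe_nnreal, ← lebesgueNN_coe_le]
  rfl

instance : SigmaFinite lebesgueNN := by
  refine ⟨⟨⟨fun n => Iic (n : ℝ≥0), fun _ => trivial, fun n => ?_, ?_⟩⟩⟩
  · rw [lebesgueNN_Iic]; exact ENNReal.coe_lt_top
  · ext x; simpa using exists_nat_ge x

instance : NullSingletonClass lebesgueNN := by
  refine ⟨fun x => le_antisymm ?_ (zero_le)⟩
  have := lebesgueNN_preimage {(x : ℝ)} (measurableSet_singleton _)
  calc lebesgueNN {x} ≤ lebesgueNN ((fun t : ℝ≥0 => (t : ℝ)) ⁻¹' {(x : ℝ)}) :=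
        measure_mono (by rintro y rfl; rfl)
    _ = _ := this
    _ ≤ volume {(x : ℝ)} := measure_mono inter_subset_left
    _ = 0 := by simp

theorem lebesgueNN_xor_le (a b : ℝ) :
    lebesgueNN {θ : ℝ≥0 | Xor ((θ : ℝ) ≤ a) ((θ : ℝ) ≤ b)} ≤ ENNReal.ofReal |a - b| := by
  have := lebesgueNN_preimage (Ioc (min a b) (max a b)) measurableSet_Ioc
  calc _ ≤ lebesgueNN ((fun t : ℝ≥0 => (t : ℝ)) ⁻¹' (Ioc (min a b) (max a b))) := by
        refine measure_mono fun θ hθ => ?_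
        rcases hθ with ⟨h1, h2⟩ | ⟨h1, h2⟩
        · exact ⟨(min_le_right _ _).trans_lt (not_le.1 h2), h1.trans (le_max_left _ _)⟩
        · exact ⟨(min_le_left _ _).trans_lt (not_le.1 h2), h1.trans (le_max_right _ _)⟩
    _ ≤ volume (Ioc (min a b) (max a b)) := this.le.trans (measure_mono inter_subset_left)
    _ = _ := by rw [Real.volume_Ioc, max_sub_min_eq_abs']

/-! ### Consequences of the Poisson property -/

instance (ν : Measure ℝ) [IsProbabilityMeasure ν] : SigmaFinite (intensityMeasure ν) := by
  unfold intensityMeasure; infer_instance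

theorem lintegral_natCast_poissonMeasure (r : ℝ≥0) :
    ∫⁻ n, (n : ℝ≥0∞) ∂(poissonMeasure r) = r := by
  have h1 : Integrable (fun n : ℕ => (n : ℝ)) (poissonMeasure r) := by
    rw [integrable_poissonMeasure_iff]
    have := (Real.summable_pow_div_factorial (r : ℝ)).mul_left (Real.exp (-r) * r)
    rw [← summable_nat_add_iff 1]
    refine this.congr fun n => ?_
    rw [Nat.factorial_succ]
    simp only [Real.norm_natCast]
    push_cast
    field_simp
    ring
  have h2 : ∫ n, (n : ℝ) ∂(poissonMeasure r) = r := by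
    have hs := hasSum_integral_poissonMeasure h1
    have h3 : HasSum (fun n : ℕ => Real.exp (-r) * r ^ n / (Nat.factorial n) *
        (n : ℝ)) (r : ℝ) := by
      rw [← hasSum_nat_add_iff' 1]
      have := (hasSum_one_poissonMeasure r).mul_left (r : ℝ)
      simp only [Finset.sum_range_one, Nat.cast_zero, mul_zero, sub_zero]
      rw [mul_one] at this
      refine this.congr_fun fun n => ?_
      rw [Nat.factorial_succ]
      push_cast
      field_simp
      ring
    exact hs.unique (by simpa using h3)
  have h3 := ofReal_integral_eq_lintegral_ofReal h1 (ae_of_all _ fun n => Nat.cast_nonneg n)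
  rw [h2] at h3
  simpa [ENNReal.ofReal_coe_nnreal] using h3.symm

section Poisson

variable {Ω E : Type*} [mΩ : MeasurableSpace Ω] [MeasurableSpace E]
  {P : Ω → Measure E} {μ : Measure E} {Q : Measure Ω}

theorem IsPoissonRandomMeasure.measurable_apply (hP : IsPoissonRandomMeasure P μ Q) {A : Set E}
    (hA : MeasurableSet A) : Measurable fun ω => P ω A :=
  (Measure.measurable_coe hA).comp hP.measurable

theorem IsPoissonRandomMeasure.lintegral_apply (hP : IsPoissonRandomMeasure P μ Q) {A : Set E}
    (hA : MeasurableSet A) (hμ : μ A < ∞) : ∫⁻ ω, P ω A ∂Q = μ A := by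
  have := lintegral_map (μ := Q) (f := fun x : ℝ≥0∞ => x) measurable_id (hP.measurable_apply hA)
  rw [← this, hP.law A hA hμ, lintegral_map (f := fun x : ℝ≥0∞ => x) measurable_id (by fun_prop),
    lintegral_natCast_poissonMeasure, ENNReal.coe_toNNReal hμ.ne]

theorem IsPoissonRandomMeasure.ae_exists_nat (hP : IsPoissonRandomMeasure P μ Q) {A : Set E}
    (hA : MeasurableSet A) (hμ : μ A < ∞) : ∀ᵐ ω ∂Q, ∃ n : ℕ, P ω A = n := by
  have hr : MeasurableSet (range (fun n : ℕ => (n : ℝ≥0∞))) := (countable_range _).measurableSet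
  have h1 : ∀ᵐ x ∂(Q.map fun ω => P ω A), x ∈ range (fun n : ℕ => (n : ℝ≥0∞)) := by
    rw [hP.law A hA hμ]
    exact (ae_map_iff (by fun_prop) hr).2 (ae_of_all _ fun n => mem_range_self n)
  filter_upwards [(ae_map_iff (hP.measurable_apply hA).aemeasurable hr).1 h1] with ω ⟨n, hn⟩
  exact ⟨n, hn.symm⟩

theorem IsPoissonRandomMeasure.ae_apply_eq_zero (hP : IsPoissonRandomMeasure P μ Q) {A : Set E}
    (hA : MeasurableSet A) (hμ : μ A = 0) : ∀ᵐ ω ∂Q, P ω A = 0 := by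
  have h := hP.lintegral_apply hA (by simp [hμ])
  rw [hμ, lintegral_eq_zero_iff (hP.measurable_apply hA)] at h
  exact h

/-- The sets of the finite family `S` need not be disjoint, but they are unions of atoms, which are;
this reduces the claim to the independence of the values on disjoint sets. -/
theorem IsPoissonRandomMeasure.indep_of_finset (hP : IsPoissonRandomMeasure P μ Q)
    (W B : Set E) (hB : MeasurableSet B) (hW : MeasurableSet W) (hWB : Disjoint W B)
    (S : Finset (Set E)) (hS : ∀ A ∈ S, MeasurableSet A ∧ A ⊆ W) :
    Indep (⨆ A ∈ S, MeasurableSpace.comap (fun ω => P ω A) inferInstance)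
      (MeasurableSpace.comap (fun ω => P ω B) inferInstance) Q := by
  classical
  -- the atoms are indexed by the sets of members that contain them; `none` stands for `B`
  set I := Option (Set S) with hI
  let atom : I → Set E := fun o => o.elim B fun c => {x | x ∈ W ∧ ∀ A : S, x ∈ A.1 ↔ A ∈ c}
  have hatom_meas : ∀ i, MeasurableSet (atom i) := by
    rintro (_ | c)
    · exact hB
    · have : atom (some c) = W ∩ ⋂ A : S, {x | x ∈ A.1 ↔ A ∈ c} := by
        ext x; simp [atom]
      rw [this]
      refine hW.inter (MeasurableSet.iInter fun A => ?_)
      by_cases h : A ∈ c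
      · simpa [h] using (hS A.1 A.2).1
      · simp only [h, iff_false]
        exact (hS A.1 A.2).1.compl
  have hatom_disj : Pairwise fun i j => Disjoint (atom i) (atom j) := by
    rintro (_ | c) (_ | d) hne
    · exact absurd rfl hne
    · exact (hWB.mono_left fun x hx => hx.1).symm
    · exact hWB.mono_left fun x hx => hx.1
    · refine Set.disjoint_left.2 fun x hx hy => hne ?_
      congr 1
      ext A
      exact (hx.2 A).symm.trans (hy.2 A)
  have : Fintype I := Fintype.ofFinite _
  let e := Fintype.equivFin I
  have hind : iIndepFun (fun (i : I) ω => P ω (atom i)) Q := by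
    have h := hP.indep (Fintype.card I) (fun k => atom (e.symm k)) (fun k => hatom_meas _)
      fun i j hij => hatom_disj (e.symm.injective.ne hij)
    have h2 := h.precomp e.injective
    simpa using h2
  have hind2 := hind.indepFun_finset (Finset.univ.erase none) {none} (by simp)
    fun i => hP.measurable_apply (hatom_meas i)
  refine indep_of_indep_of_le hind2 (iSup₂_le fun A hA => ?_) ?_
  · have hAeq : (fun ω => P ω A) =
        (fun v : (↥(Finset.univ.erase (none : I)) → ℝ≥0∞) =>
          ∑ c : Set S, if (⟨A, hA⟩ : S) ∈ c then v ⟨some c, by simp⟩ else 0) ∘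
        fun ω (i : ↥(Finset.univ.erase (none : I))) => P ω (atom i) := by
      funext ω
      have hU : A = ⋃ c ∈ (Finset.univ.filter fun c : Set S => (⟨A, hA⟩ : S) ∈ c),
          atom (some c) := by
        ext x
        simp only [Finset.mem_filter, Finset.mem_univ, true_and, mem_iUnion, exists_prop]
        constructor
        · intro hx
          exact ⟨{A | x ∈ A.1}, hx, (hS A hA).2 hx, fun A => Iff.rfl⟩
        · rintro ⟨c, hc, -, h⟩
          exact (h ⟨A, hA⟩).2 hc
      simp only [Function.comp]
      conv_lhs => rw [hU]
      rw [measure_biUnion_finset, Finset.sum_filter]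
      · intro c _ d _ hcd
        exact hatom_disj (fun h => hcd (Option.some.inj h))
      · exact fun c _ => hatom_meas _
    rw [hAeq, ← MeasurableSpace.comap_comp]
    apply MeasurableSpace.comap_mono
    rw [← measurable_iff_comap_le]
    refine Finset.measurable_sum _ fun c _ => ?_
    split_ifs
    · exact measurable_pi_apply _
    · exact measurable_const
  · have hBeq : (fun ω => P ω B) = (fun v : (↥({none} : Finset I) → ℝ≥0∞) => v ⟨none, by simp⟩) ∘
        fun ω (i : ↥({none} : Finset I)) => P ω (atom i) := rfl
    rw [hBeq, ← MeasurableSpace.comap_comp]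
    apply MeasurableSpace.comap_mono
    rw [← measurable_iff_comap_le]
    exact measurable_pi_apply _

/-- The values on all subsets of `W` together are independent of the value on a set disjoint from
`W`. In the application `W` is the past and `B` lies in the future. -/
theorem IsPoissonRandomMeasure.indep_of_disjoint [IsProbabilityMeasure Q]
    (hP : IsPoissonRandomMeasure P μ Q)
    (W B : Set E) (hB : MeasurableSet B) (hW : MeasurableSet W) (hWB : Disjoint W B) :
    Indep (⨆ (A : Set E) (_ : MeasurableSet A ∧ A ⊆ W),
        MeasurableSpace.comap (fun ω => P ω A) inferInstance)
      (MeasurableSpace.comap (fun ω => P ω B) inferInstance) Q := by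
  classical
  let m : Finset {A : Set E // MeasurableSet A ∧ A ⊆ W} → MeasurableSpace Ω := fun S =>
    ⨆ A ∈ S, MeasurableSpace.comap (fun ω => P ω A.1) inferInstance
  have hm : Monotone m := fun S T hST => iSup₂_le fun A hA => le_iSup₂_of_le A (hST hA) le_rfl
  have hle : ∀ A, MeasurableSet A →
      MeasurableSpace.comap (fun ω => P ω A) inferInstance ≤ mΩ := fun A hA =>
    (hP.measurable_apply hA).comap_le
  have key : Indep (⨆ S, m S) (MeasurableSpace.comap (fun ω => P ω B) inferInstance) Q := by
    refine indep_iSup_of_directed_le (fun S => ?_)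
      (fun S => iSup₂_le fun A _ => hle A.1 A.2.1) (hle B hB) hm.directed_le
    refine indep_of_indep_of_le_left (hP.indep_of_finset W B hB hW hWB (S.image Subtype.val) ?_) ?_
    · intro A hA
      obtain ⟨A', -, rfl⟩ := Finset.mem_image.1 hA
      exact A'.2
    · exact iSup₂_le fun A hA => le_iSup₂_of_le A.1 (Finset.mem_image_of_mem _ hA) le_rfl
  refine indep_of_indep_of_le_left key (iSup₂_le fun A hA => ?_)
  exact le_iSup_of_le {⟨A, hA⟩} (le_iSup₂_of_le (⟨A, hA⟩ : {A : Set E // MeasurableSet A ∧ A ⊆ W})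
    (by simp) le_rfl)

end Poisson

/-! ### A version of the random measure that is an s-finite kernel -/

/-- The cell `(kΔ, (k+1)Δ] × [i, i+1) × ℝ`. -/
def cell (Δ : ℝ≥0) (k i : ℕ) : Set Point :=
  {x | ((k : ℕ) : ℝ≥0) * Δ < x.1 ∧ x.1 ≤ ((k + 1 : ℕ) : ℝ≥0) * Δ ∧
    (i : ℝ≥0) ≤ x.2.1 ∧ x.2.1 < (i : ℝ≥0) + 1}

theorem measurableSet_cell (Δ : ℝ≥0) (k i : ℕ) : MeasurableSet (cell Δ k i) := by
  refine (measurableSet_lt measurable_const measurable_fst).inter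
    ((measurableSet_le measurable_fst measurable_const).inter
    ((measurableSet_le measurable_const (by fun_prop)).inter
      (measurableSet_lt (by fun_prop) measurable_const)))

theorem mem_cell_iff {Δ : ℝ≥0} (hΔ : 0 < Δ) {k i : ℕ} {x : Point} :
    x ∈ cell Δ k i ↔ ⌈x.1 / Δ⌉₊ = k + 1 ∧ ⌊x.2.1⌋₊ = i := by
  rw [Nat.ceil_eq_iff (by omega), Nat.floor_eq_iff zero_le]
  simp only [cell, mem_ofPred_eq, lt_div_iff₀ hΔ, div_le_iff₀ hΔ, Nat.add_sub_cancel]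
  tauto

/-- The part of `p` in the cell `c.1, c.2.1`, provided that its mass is `c.2.2`. -/
noncomputable def piece (Δ : ℝ≥0) (p : Measure Point) (c : ℕ × ℕ × ℕ) : Measure Point :=
  open Classical in
  if p (cell Δ c.1 c.2.1) = (c.2.2 : ℝ≥0∞) then p.restrict (cell Δ c.1 c.2.1) else 0

/-- The sum of the parts of `p` in those cells where the mass of `p` is a natural number. For a
Poisson random measure, `tame Δ (P ω) = P ω` almost surely. Unlike `P`, the map `ω ↦ tame Δ (P ω)`
is an s-finite kernel, and so are its restrictions to the past, for the σ-algebras of the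
filtration; no null set has to be added to these σ-algebras. -/
noncomputable def tame (Δ : ℝ≥0) (p : Measure Point) : Measure Point :=
  Measure.sum (piece Δ p)

theorem piece_univ_le (Δ : ℝ≥0) (p : Measure Point) (c : ℕ × ℕ × ℕ) :
    piece Δ p c univ ≤ c.2.2 := by
  rw [piece]
  split_ifs with h
  · simp [h]
  · simp

instance (Δ : ℝ≥0) (p : Measure Point) (c : ℕ × ℕ × ℕ) : IsFiniteMeasure (piece Δ p c) :=
  ⟨(piece_univ_le Δ p c).trans_lt (ENNReal.natCast_lt_top _)⟩

instance (Δ : ℝ≥0) (p : Measure Point) : SFinite (tame Δ p) := by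
  unfold tame; infer_instance

theorem tame_eq_self {Δ : ℝ≥0} (hΔ : 0 < Δ) {p : Measure Point}
    (h : ∀ k i, ∃ n : ℕ, p (cell Δ k i) = n) (h0 : p {x | x.1 = 0} = 0) : tame Δ p = p := by
  have hU : {x : Point | x.1 = 0}ᶜ = ⋃ c : ℕ × ℕ, cell Δ c.1 c.2 := by
    ext x
    simp only [mem_compl_iff, mem_ofPred_eq, mem_iUnion, mem_cell_iff hΔ, Prod.exists]
    constructor
    · intro hx
      have : 0 < ⌈x.1 / Δ⌉₊ := Nat.ceil_pos.2 (div_pos (pos_iff_ne_zero.2 hx) hΔ)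
      exact ⟨⌈x.1 / Δ⌉₊ - 1, ⌊x.2.1⌋₊, by omega, rfl⟩
    · rintro ⟨k, i, hk, -⟩ hx
      simp [hx] at hk
  have hd : Pairwise (Function.onFun Disjoint fun c : ℕ × ℕ => cell Δ c.1 c.2) := by
    intro c d hcd
    refine Set.disjoint_left.2 fun x hx hy => hcd ?_
    rw [mem_cell_iff hΔ] at hx hy
    exact Prod.ext (by omega) (by omega)
  have h1 : p.restrict {x : Point | x.1 = 0}ᶜ = p :=
    Measure.restrict_eq_self_of_ae_mem (by rw [ae_iff]; simpa using h0)
  conv_rhs => rw [← h1, hU, Measure.restrict_iUnion hd fun c => measurableSet_cell _ _ _]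
  refine Measure.ext fun A hA => ?_
  rw [tame, Measure.sum_apply _ hA, Measure.sum_apply _ hA, ENNReal.tsum_prod', ENNReal.tsum_prod']
  refine tsum_congr fun k => ?_
  rw [ENNReal.tsum_prod']
  refine tsum_congr fun i => ?_
  obtain ⟨n, hn⟩ := h k i
  rw [tsum_eq_single n]
  · simp [piece, hn]
  · intro j hj
    have : (n : ℝ≥0∞) ≠ j := fun h => hj (by exact_mod_cast h.symm)
    simp [piece, hn, this]

theorem restrict_tame {Δ : ℝ≥0} (p : Measure Point) (n : ℕ) :
    (tame Δ p).restrict {x | x.1 ≤ (n : ℝ≥0) * Δ} =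
      Measure.sum fun c => if c.1 < n then piece Δ p c else 0 := by
  have hm : MeasurableSet {x : Point | x.1 ≤ (n : ℝ≥0) * Δ} :=
    measurableSet_le measurable_fst measurable_const
  rw [tame, Measure.restrict_sum _ hm]
  congr 1
  funext c
  rw [piece]
  split_ifs with h1 h2 h2
  · rw [Measure.restrict_restrict hm]
    congr 1
    refine inter_eq_self_of_subset_right fun x hx => hx.2.1.trans ?_
    gcongr
    exact h2
  · rw [Measure.restrict_restrict hm]
    rw [show {x : Point | x.1 ≤ (n : ℝ≥0) * Δ} ∩ cell Δ c.1 c.2.1 = ∅ from ?_]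
    · simp
    · refine Set.disjoint_iff_inter_eq_empty.1 (Set.disjoint_left.2 fun x hx hy => ?_)
      refine absurd (hy.1.trans_le hx) (not_lt.2 ?_)
      gcongr
      omega
  · simp
  · simp

/-- The σ-algebra `m` is explicit, since it will also be one of the filtration. -/
theorem exists_sfinite_kernel {Ω E ι : Type*} (m : MeasurableSpace Ω) [MeasurableSpace E]
    [Countable ι] (c : ι → Ω → Measure E)
    (hm : ∀ i A, MeasurableSet A → Measurable fun ω => c i ω A)
    (hb : ∀ i, ∃ C : ℝ≥0∞, C < ∞ ∧ ∀ ω, c i ω univ ≤ C) :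
    ∃ κ : Kernel Ω E, IsSFiniteKernel κ ∧ ∀ ω, κ ω = Measure.sum fun i => c i ω := by
  let κ : ι → Kernel Ω E := fun i => ⟨c i, Measure.measurable_of_measurable_coe _ (hm i)⟩
  have : ∀ i, IsFiniteKernel (κ i) := fun i => ⟨hb i⟩
  exact ⟨Kernel.sum κ, inferInstance, fun ω => Kernel.sum_apply κ ω⟩

/-! ### The predictable σ-algebra -/

/-- The space `ℝ₊ × Ω`, to be endowed with the predictable σ-algebra. It is a structure of its own,
so that it does not carry the product σ-algebra. -/
@[ext]
structure Pred {Ω : Type*} {mΩ : MeasurableSpace Ω} (𝓕 : Filtration ℝ≥0 mΩ) where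
  /-- The time. -/
  time : ℝ≥0
  /-- The outcome. -/
  outcome : Ω

section Pred

variable {Ω : Type*} {mΩ : MeasurableSpace Ω} {𝓕 : Filtration ℝ≥0 mΩ}

instance instMeasurableSpacePred : MeasurableSpace (Pred 𝓕) :=
  𝓕.predictable.comap fun z => (z.time, z.outcome)

variable (𝓕) in
/-- The generators of the predictable σ-algebra, as subsets of `Pred 𝓕`. -/
def predGenerators : Set (Set (Pred 𝓕)) :=
  {s | ∃ A, MeasurableSet[𝓕 ⊥] A ∧ s = {z | z.time = 0 ∧ z.outcome ∈ A}} ∪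
    {s | ∃ i A, MeasurableSet[𝓕 i] A ∧ s = {z | i < z.time ∧ z.outcome ∈ A}}

theorem generateFrom_predGenerators :
    (instMeasurableSpacePred : MeasurableSpace (Pred 𝓕)) =
      MeasurableSpace.generateFrom (predGenerators 𝓕) := by
  change 𝓕.predictable.comap (fun z : Pred 𝓕 => (z.time, z.outcome)) = _
  rw [Filtration.predictable, MeasurableSpace.comap_generateFrom]
  congr 1
  ext s
  constructor
  · rintro ⟨_, ⟨A, hA, rfl⟩ | ⟨i, A, hA, rfl⟩, rfl⟩
    · exact Or.inl ⟨A, hA, rfl⟩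
    · exact Or.inr ⟨i, A, hA, rfl⟩
  · rintro (⟨A, hA, rfl⟩ | ⟨i, A, hA, rfl⟩)
    · exact ⟨_, Or.inl ⟨A, hA, rfl⟩, rfl⟩
    · exact ⟨_, Or.inr ⟨i, A, hA, rfl⟩, rfl⟩

theorem measurableSet_of_mem_predGenerators {s : Set (Pred 𝓕)} (hs : s ∈ predGenerators 𝓕) :
    MeasurableSet s := by
  have := MeasurableSpace.measurableSet_generateFrom hs
  rwa [← generateFrom_predGenerators] at this

theorem measurableSet_pred_Ioi {i : ℝ≥0} {A : Set Ω} (hA : MeasurableSet[𝓕 i] A) :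
    MeasurableSet {z : Pred 𝓕 | i < z.time ∧ z.outcome ∈ A} :=
  measurableSet_of_mem_predGenerators (Or.inr ⟨i, A, hA, rfl⟩)

theorem Pred.measurable_mk : Measurable fun z : ℝ≥0 × Ω => (⟨z.1, z.2⟩ : Pred 𝓕) := by
  rw [generateFrom_predGenerators]
  refine measurable_generateFrom ?_
  rintro _ (⟨A, hA, rfl⟩ | ⟨i, A, hA, rfl⟩)
  · exact (measurableSet_singleton (0 : ℝ≥0)).prod (𝓕.le _ _ hA)
  · exact (measurableSet_Ioi (a := i)).prod (𝓕.le _ _ hA)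

theorem Pred.measurable_time : Measurable fun z : Pred 𝓕 => z.time := by
  refine measurable_of_Ioi fun q => ?_
  convert measurableSet_pred_Ioi (𝓕 := 𝓕) (i := q) (A := univ) MeasurableSet.univ using 1
  ext; simp

theorem IsStronglyPredictable.measurable_pred {u : ℝ≥0 → Ω → ℝ}
    (hu : IsStronglyPredictable 𝓕 u) : Measurable fun z : Pred 𝓕 => u z.time z.outcome :=
  Measurable.comp (g := Function.uncurry u) (f := fun z : Pred 𝓕 => (z.time, z.outcome))
    (β := ℝ≥0 × Ω) hu.measurable (Measurable.of_comap_le le_rfl)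

/-- A variable of the past at time `q` may be used at all times after `q`. -/
theorem Pred.measurable_of_past {Z : Type*} [MeasurableSpace Z] (q : ℝ≥0)
    {f : Ω → Z} (hf : Measurable[𝓕 q] f) (d : Z) :
    Measurable fun z : Pred 𝓕 => if q < z.time then f z.outcome else d := by
  intro s hs
  by_cases hd : d ∈ s
  · have h1 := (measurableSet_pred_Ioi (hf hs.compl)).compl
    convert h1 using 1
    ext z
    simp only [mem_preimage, mem_compl_iff, mem_ofPred_eq]
    split_ifs <;> simp [*]
  · have h1 := measurableSet_pred_Ioi (hf hs)
    convert h1 using 1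
    ext z
    simp only [mem_preimage, mem_ofPred_eq]
    split_ifs <;> simp [*]

/-- The history of a predictable set, up to but excluding the present, is predictable: its sections
at the time `z.1.time` belong to the strict past. -/
theorem Pred.measurableSet_history {D : Set (Pred 𝓕)} (hD : MeasurableSet D) :
    MeasurableSet {z : Pred 𝓕 × ℝ≥0 | z.2 < z.1.time ∧ (⟨z.2, z.1.outcome⟩ : Pred 𝓕) ∈ D} := by
  have hlt : MeasurableSet {z : Pred 𝓕 × ℝ≥0 | z.2 < z.1.time} :=
    measurableSet_lt measurable_snd (Pred.measurable_time.comp measurable_fst)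
  rw [generateFrom_predGenerators] at hD
  induction D, hD using MeasurableSpace.generateFrom_induction with
  | hC s hs _ =>
    rcases hs with ⟨A, hA, rfl⟩ | ⟨q, A, hA, rfl⟩
    · convert (measurableSet_pred_Ioi (i := 0) hA).prod (measurableSet_singleton (0 : ℝ≥0)) using 1
      ext z
      simp only [mem_ofPred_eq, mem_prod, mem_singleton_iff]
      constructor
      · rintro ⟨h, h2, h3⟩
        exact ⟨⟨h2 ▸ h, h3⟩, h2⟩
      · rintro ⟨⟨h, h3⟩, h2⟩
        exact ⟨h2 ▸ h, h2, h3⟩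
    · convert ((measurableSet_pred_Ioi hA).prod (measurableSet_Ioi (a := q))).inter hlt using 1
      ext z
      simp only [mem_ofPred_eq, mem_prod, mem_inter_iff, mem_Ioi]
      constructor
      · rintro ⟨h, h2, h3⟩
        exact ⟨⟨⟨h2.trans h, h3⟩, h2⟩, h⟩
      · rintro ⟨⟨⟨h, h3⟩, h2⟩, h4⟩
        exact ⟨h4, h2, h3⟩
  | empty => simp
  | compl s _ ih =>
    convert hlt.diff ih using 1
    ext z
    simp only [mem_ofPred_eq, mem_compl_iff, Set.mem_sdiff]
    tauto
  | iUnion s _ ih =>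
    convert MeasurableSet.iUnion ih using 1
    ext z
    simp

theorem isPiSystem_predGenerators : IsPiSystem (predGenerators 𝓕) := by
  rintro _ (⟨A, hA, rfl⟩ | ⟨i, A, hA, rfl⟩) _ (⟨B, hB, rfl⟩ | ⟨j, B, hB, rfl⟩) ⟨z, hz1, hz2⟩
  · exact Or.inl ⟨A ∩ B, hA.inter hB, by ext; simp; tauto⟩
  · simp [hz1.1] at hz2
  · simp [hz2.1] at hz1
  · refine Or.inr ⟨i ⊔ j, A ∩ B, ?_, by ext; simp; tauto⟩
    exact (𝓕.mono le_sup_left _ hA).inter (𝓕.mono le_sup_right _ hB)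

theorem isCountablySpanning_predGenerators : IsCountablySpanning (predGenerators 𝓕) := by
  refine ⟨fun n => {z | if n = 0 then z.time = 0 else 0 < z.time}, fun n => ?_, ?_⟩
  · by_cases hn : n = 0
    · exact Or.inl ⟨univ, MeasurableSet.univ, by simp [hn]⟩
    · exact Or.inr ⟨0, univ, MeasurableSet.univ, by simp [hn]⟩
  · refine eq_univ_of_forall fun z => ?_
    rw [mem_iUnion]
    rcases eq_zero_or_pos z.time with h | h
    · exact ⟨0, by simpa using h⟩
    · exact ⟨1, by simpa using h⟩

end Pred

/-! ### Campbell's formula for predictable integrands -/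

/-- An event of the past at time `q` is independent of the points after `q`. -/
theorem IsPoissonRandomMeasure.lintegral_indicator_mul {Ω : Type*} [MeasurableSpace Ω]
    {P : Ω → Measure Point} {ν : Measure ℝ} {Q : Measure Ω} [IsProbabilityMeasure Q]
    (hP : IsPoissonRandomMeasure P (intensityMeasure ν) Q) {q : ℝ≥0} {A : Set Ω}
    (hA : MeasurableSet[pointFiltration P hP.measurable q] A) {B : Set Point}
    (hB : MeasurableSet B) (hBq : B ⊆ {x | q < x.1}) (hBμ : intensityMeasure ν B < ∞) :
    ∫⁻ ω, A.indicator 1 ω * P ω B ∂Q = Q A * intensityMeasure ν B := by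
  have hW : MeasurableSet {x : Point | 0 < x.1 ∧ x.1 ≤ q} :=
    measurable_fst (measurableSet_Ioc (a := (0 : ℝ≥0)) (b := q))
  have hi := hP.indep_of_disjoint {x : Point | 0 < x.1 ∧ x.1 ≤ q} B hB hW
    (Set.disjoint_left.2 fun x hx hy => absurd (hBq hy) (not_lt.2 hx.2))
  have hle := (pointFiltration P hP.measurable).le q
  have h := lintegral_mul_eq_lintegral_mul_lintegral_of_independent_measurableSpace
    (μ := Q) (f := A.indicator 1) (g := fun ω => P ω B) hle (hP.measurable_apply hB).comap_le hi
    (Measurable.indicator (m := _) (@measurable_const _ _ _ _ _) hA) (comap_measurable _)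
  rw [h, hP.lintegral_apply hB hBμ, lintegral_indicator_one (hle A hA)]

section Campbell

variable {Ω : Type*} [mΩ : MeasurableSpace Ω] {P : Ω → Measure Point} {ν : Measure ℝ}
  [IsProbabilityMeasure ν] {Q : Measure Ω}

theorem lintegral_intensityMeasure {f : Point → ℝ≥0∞} (hf : Measurable f) :
    ∫⁻ x, f x ∂(intensityMeasure ν) =
      ∫⁻ s, ∫⁻ θ, ∫⁻ y, f (s, θ, y) ∂ν ∂lebesgueNN ∂lebesgueNN := by
  rw [intensityMeasure, lintegral_prod _ hf.aemeasurable]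
  refine lintegral_congr fun s => ?_
  rw [lintegral_prod _ (by fun_prop)]

theorem intensityMeasure_cell_lt_top (Δ : ℝ≥0) (k i : ℕ) :
    intensityMeasure ν (cell Δ k i) < ∞ := by
  calc intensityMeasure ν (cell Δ k i)
      ≤ intensityMeasure ν (Iic (((k + 1 : ℕ) : ℝ≥0) * Δ) ×ˢ (Iic ((i : ℝ≥0) + 1) ×ˢ univ)) :=
        measure_mono fun x hx => ⟨hx.2.1, hx.2.2.2.le, trivial⟩
    _ < ∞ := by
        rw [intensityMeasure, Measure.prod_prod, Measure.prod_prod, lebesgueNN_Iic, lebesgueNN_Iic,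
          measure_univ, mul_one]
        exact ENNReal.mul_lt_top ENNReal.coe_lt_top ENNReal.coe_lt_top

theorem intensityMeasure_time_zero : intensityMeasure ν {x | x.1 = 0} = 0 := by
  have : {x : Point | x.1 = 0} = {(0 : ℝ≥0)} ×ˢ univ := by ext; simp
  rw [this, intensityMeasure, Measure.prod_prod, measure_singleton, zero_mul]

theorem IsPoissonRandomMeasure.ae_time_zero
    (hP : IsPoissonRandomMeasure P (intensityMeasure ν) Q) :
    ∀ᵐ ω ∂Q, P ω {x | x.1 = 0} = 0 :=
  hP.ae_apply_eq_zero (measurableSet_eq_fun measurable_fst measurable_const)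
    intensityMeasure_time_zero

theorem IsPoissonRandomMeasure.ae_cell
    (hP : IsPoissonRandomMeasure P (intensityMeasure ν) Q) (Δ : ℝ≥0) :
    ∀ᵐ ω ∂Q, ∀ k i, ∃ n : ℕ, P ω (cell Δ k i) = n := by
  rw [ae_all_iff]; intro k
  rw [ae_all_iff]; intro i
  exact hP.ae_exists_nat (measurableSet_cell Δ k i) (intensityMeasure_cell_lt_top Δ k i)

theorem IsPoissonRandomMeasure.ae_tame
    (hP : IsPoissonRandomMeasure P (intensityMeasure ν) Q) {Δ : ℝ≥0} (hΔ : 0 < Δ) :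
    ∀ᵐ ω ∂Q, tame Δ (P ω) = P ω := by
  filter_upwards [hP.ae_cell Δ, hP.ae_time_zero] with ω h1 h2
  exact tame_eq_self hΔ h1 h2

theorem IsPoissonRandomMeasure.ae_sfinite
    (hP : IsPoissonRandomMeasure P (intensityMeasure ν) Q) : ∀ᵐ ω ∂Q, SFinite (P ω) := by
  filter_upwards [hP.ae_tame (Δ := 1) one_pos] with ω h
  rw [← h]; infer_instance

theorem IsPoissonRandomMeasure.exists_kernel
    (hP : IsPoissonRandomMeasure P (intensityMeasure ν) Q) :
    ∃ κ : Kernel Ω Point, IsSFiniteKernel κ ∧ ∀ᵐ ω ∂Q, κ ω = P ω := by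
  have hm : ∀ (c : ℕ × ℕ × ℕ) A, MeasurableSet A → Measurable fun ω => piece 1 (P ω) c A := by
    intro c A hA
    have hc := measurableSet_cell 1 c.1 c.2.1
    have : (fun ω => piece 1 (P ω) c A) = fun ω =>
        {ω | P ω (cell 1 c.1 c.2.1) = c.2.2}.indicator (fun ω => P ω (A ∩ cell 1 c.1 c.2.1)) ω := by
      funext ω
      by_cases h : P ω (cell 1 c.1 c.2.1) = c.2.2
      · simp [piece, h, Measure.restrict_apply hA]
      · simp [piece, h]
    rw [this]
    exact (hP.measurable_apply (hA.inter hc)).indicator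
      (hP.measurable_apply hc (measurableSet_singleton _))
  obtain ⟨κ, h1, h2⟩ := exists_sfinite_kernel mΩ
    (fun (c : ℕ × ℕ × ℕ) ω => piece 1 (P ω) c) hm
    (fun c => ⟨c.2.2, ENNReal.natCast_lt_top _, fun ω => piece_univ_le _ _ _⟩)
  refine ⟨κ, h1, ?_⟩
  filter_upwards [hP.ae_tame (Δ := 1) one_pos] with ω h
  exact (h2 ω).trans h

variable [IsProbabilityMeasure Q]

/-- **Campbell's formula** for predictable integrands: the intensity compensates the random
measure. The points of time `0` do not matter, and on each cell the two sides are finite measures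
on the predictable σ-algebra (times the marks) that agree on its generators, by independence. -/
theorem IsPoissonRandomMeasure.campbell
    (hP : IsPoissonRandomMeasure P (intensityMeasure ν) Q)
    {H : Pred (pointFiltration P hP.measurable) × (ℝ≥0 × ℝ) → ℝ≥0∞} (hH : Measurable H) :
    ∫⁻ ω, ∫⁻ x, H (⟨x.1, ω⟩, x.2) ∂(P ω) ∂Q =
      ∫⁻ ω, ∫⁻ x, H (⟨x.1, ω⟩, x.2) ∂(intensityMeasure ν) ∂Q := by
  obtain ⟨κ, hκs, hκ⟩ := hP.exists_kernel
  let 𝓕 := pointFiltration P hP.measurable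
  let φ : Ω × Point → Pred 𝓕 × (ℝ≥0 × ℝ) := fun z => (⟨z.2.1, z.1⟩, z.2.2)
  have hφ : Measurable φ :=
    (Pred.measurable_mk.comp (by fun_prop : Measurable fun z : Ω × Point => (z.2.1, z.1))).prodMk
      (by fun_prop)
  let η : Kernel Ω Point := Kernel.const Ω (intensityMeasure ν)
  have happ : ∀ (ξ : Kernel Ω Point) [IsSFiniteKernel ξ] (S : Set Point) (hS : MeasurableSet S)
      (D : Set (Pred 𝓕 × (ℝ≥0 × ℝ))), MeasurableSet D →
      ((Q ⊗ₘ ξ.restrict hS).map φ) D = ∫⁻ ω, ξ ω ({x | (⟨x.1, ω⟩, x.2) ∈ D} ∩ S) ∂Q := by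
    intro ξ _ S hS D hD
    rw [Measure.map_apply hφ hD, Measure.compProd_apply (hφ hD)]
    refine lintegral_congr fun ω => ?_
    rw [Kernel.restrict_apply' _ _ _ (measurable_prodMk_left (hφ hD))]
    rfl
  have hcell : ∀ k i, (Q ⊗ₘ κ.restrict (measurableSet_cell 1 k i)).map φ =
      (Q ⊗ₘ η.restrict (measurableSet_cell 1 k i)).map φ := by
    intro k i
    set S := cell 1 k i
    have hS : MeasurableSet S := measurableSet_cell 1 k i
    have hSμ : intensityMeasure ν S < ∞ := intensityMeasure_cell_lt_top 1 k i
    -- both sides agree on the sets that are rectangles within the cell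
    have huniv : ∀ D : Set (Pred 𝓕 × (ℝ≥0 × ℝ)), MeasurableSet D →
        ∀ q A B, MeasurableSet[𝓕 q] A → MeasurableSet B →
        (∀ ω (x : Point), x ∈ S → ((⟨x.1, ω⟩, x.2) ∈ D ↔ (q < x.1 ∧ ω ∈ A) ∧ x.2 ∈ B)) →
        ((Q ⊗ₘ κ.restrict hS).map φ) D = ((Q ⊗ₘ η.restrict hS).map φ) D := by
      intro D hD q A B hA hB hDS
      rw [happ κ S hS D hD, happ η S hS D hD]
      set B' : Set Point := {x | q < x.1 ∧ x.2 ∈ B} ∩ S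
      have hB' : MeasurableSet B' :=
        ((measurableSet_lt measurable_const measurable_fst).inter (measurable_snd hB)).inter hS
      have hsec : ∀ (m : Measure Point) ω, m ({x : Point | (⟨x.1, ω⟩, x.2) ∈ D} ∩ S) =
          A.indicator 1 ω * m B' := by
        intro m ω
        by_cases hω : ω ∈ A
        · have : {x : Point | (⟨x.1, ω⟩, x.2) ∈ D} ∩ S = B' := by
            ext x
            constructor
            · rintro ⟨h1, h2⟩
              have := (hDS ω x h2).1 h1
              exact ⟨⟨this.1.1, this.2⟩, h2⟩
            · rintro ⟨h1, h2⟩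
              exact ⟨(hDS ω x h2).2 ⟨⟨h1.1, hω⟩, h1.2⟩, h2⟩
          simp [this, hω]
        · have : {x : Point | (⟨x.1, ω⟩, x.2) ∈ D} ∩ S = ∅ := by
            ext x
            simp only [mem_inter_iff, mem_ofPred_eq, mem_empty_iff_false, iff_false]
            rintro ⟨h1, h2⟩
            exact hω ((hDS ω x h2).1 h1).1.2
          simp [this, hω]
      have hB'μ : intensityMeasure ν B' < ∞ := (measure_mono inter_subset_right).trans_lt hSμ
      have h1 := hP.lintegral_indicator_mul hA hB' (fun x hx => hx.1.1) hB'μ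
      have h2 : ∫⁻ ω, A.indicator 1 ω * intensityMeasure ν B' ∂Q = Q A * intensityMeasure ν B' := by
        rw [lintegral_mul_const _ (measurable_one.indicator (𝓕.le q A hA)),
          lintegral_indicator_one (𝓕.le q A hA)]
      simp only [hsec]
      change _ = ∫⁻ ω, A.indicator 1 ω * intensityMeasure ν B' ∂Q
      rw [h2, ← h1]
      refine lintegral_congr_ae ?_
      filter_upwards [hκ] with ω hω
      rw [hω]
    have hfull : ((Q ⊗ₘ κ.restrict hS).map φ) univ = ((Q ⊗ₘ η.restrict hS).map φ) univ :=
      huniv univ MeasurableSet.univ 0 univ univ (@MeasurableSet.univ _ (𝓕 0)) MeasurableSet.univ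
        fun ω x hx => by
          simp only [mem_univ, and_true, true_iff]
          exact zero_le.trans_lt hx.1
    have hfin : ((Q ⊗ₘ κ.restrict hS).map φ) univ < ∞ := by
      rw [hfull, happ η S hS univ MeasurableSet.univ]
      have : ∀ ω, η ω ({x : Point | ((⟨x.1, ω⟩, x.2) : Pred 𝓕 × (ℝ≥0 × ℝ)) ∈ univ} ∩ S) =
        intensityMeasure ν S := fun ω => by simp [η]
      simp only [this, lintegral_const, measure_univ, mul_one, hSμ]
    have : IsFiniteMeasure ((Q ⊗ₘ κ.restrict hS).map φ) := ⟨hfin⟩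
    refine ext_of_generate_finite
      (image2 (· ×ˢ ·) (predGenerators 𝓕) {B : Set (ℝ≥0 × ℝ) | MeasurableSet B}) ?_
      (isPiSystem_predGenerators.prod MeasurableSpace.isPiSystem_measurableSet) ?_ hfull
    · exact (generateFrom_eq_prod generateFrom_predGenerators.symm
        MeasurableSpace.generateFrom_measurableSet isCountablySpanning_predGenerators
        isCountablySpanning_measurableSet).symm
    · rintro _ ⟨c, hc, B, hB, rfl⟩
      have hB : MeasurableSet B := hB
      have hD := (measurableSet_of_mem_predGenerators hc).prod hB
      rcases hc with ⟨A, hA, rfl⟩ | ⟨q, A, hA, rfl⟩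
      · refine huniv _ hD 0 ∅ B (@MeasurableSet.empty _ (𝓕 0)) hB fun ω x hx => ?_
        have : x.1 ≠ 0 := (zero_le.trans_lt hx.1).ne'
        simp [this]
      · exact huniv _ hD q A B hA hB fun ω x hx => Iff.rfl
  have hd : Pairwise (Function.onFun Disjoint fun c : ℕ × ℕ => cell 1 c.1 c.2) := by
    intro c d hcd
    refine Set.disjoint_left.2 fun x hx hy => hcd ?_
    rw [mem_cell_iff one_pos] at hx hy
    exact Prod.ext (by omega) (by omega)
  have hcov : ∀ x : Point, x.1 ≠ 0 → x ∈ ⋃ c : ℕ × ℕ, cell 1 c.1 c.2 := by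
    intro x hx
    simp only [mem_iUnion, mem_cell_iff one_pos, Prod.exists]
    have : 0 < ⌈x.1 / 1⌉₊ := Nat.ceil_pos.2 (div_pos (pos_iff_ne_zero.2 hx) one_pos)
    exact ⟨⌈x.1 / 1⌉₊ - 1, ⌊x.2.1⌋₊, by omega, rfl⟩
  -- the points of time `0` are negligible, so that the integral is a sum over the cells
  have hsum : ∀ (ξ : Kernel Ω Point) [IsSFiniteKernel ξ], (∀ᵐ ω ∂Q, ξ ω {x | x.1 = 0} = 0) →
      ∫⁻ ω, ∫⁻ x, H (⟨x.1, ω⟩, x.2) ∂(ξ ω) ∂Q =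
        ∑' c : ℕ × ℕ, ∫⁻ z, H z ∂((Q ⊗ₘ ξ.restrict (measurableSet_cell 1 c.1 c.2)).map φ) := by
    intro ξ _ h0
    have h1 : ∀ c : ℕ × ℕ, ∫⁻ z, H z ∂((Q ⊗ₘ ξ.restrict (measurableSet_cell 1 c.1 c.2)).map φ) =
        ∫⁻ ω, ∫⁻ x in cell 1 c.1 c.2, H (⟨x.1, ω⟩, x.2) ∂(ξ ω) ∂Q := by
      intro c
      rw [lintegral_map hH hφ, Measure.lintegral_compProd (f := fun z => H (φ z)) (hH.comp hφ)]
      refine lintegral_congr fun ω => ?_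
      rw [Kernel.restrict_apply]
    simp only [h1]
    rw [← lintegral_tsum]
    · refine lintegral_congr_ae ?_
      filter_upwards [h0] with ω hω
      rw [← lintegral_iUnion (fun c => measurableSet_cell _ _ _) hd]
      rw [Measure.restrict_eq_self_of_ae_mem]
      rw [ae_iff]
      refine measure_mono_null (fun x hx => ?_) hω
      by_contra hx0
      exact hx (hcov x hx0)
    · intro c
      have : Measurable fun ω =>
          ∫⁻ x, H (φ (ω, x)) ∂(ξ.restrict (measurableSet_cell 1 c.1 c.2) ω) :=
        Measurable.lintegral_kernel_prod_right' (f := fun z => H (φ z)) (hH.comp hφ)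
      simpa only [Kernel.restrict_apply] using this.aemeasurable
  have hL := hsum κ (by filter_upwards [hκ, hP.ae_time_zero] with ω h1 h2; rw [h1, h2])
  have hR := hsum η (ae_of_all _ fun ω => intensityMeasure_time_zero)
  calc _ = ∫⁻ ω, ∫⁻ x, H (⟨x.1, ω⟩, x.2) ∂(κ ω) ∂Q := by
        refine lintegral_congr_ae ?_
        filter_upwards [hκ] with ω hω
        rw [hω]
    _ = _ := by rw [hL]; simp only [hcell]; rw [← hR]; rfl

/-- Campbell's formula for a product of a function of time, the indicator of a predictable set of
heights, and a function of the mark. -/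
theorem IsPoissonRandomMeasure.campbell_prod
    (hP : IsPoissonRandomMeasure P (intensityMeasure ν) Q)
    {D : Set (Pred (pointFiltration P hP.measurable) × ℝ≥0)} (hD : MeasurableSet D)
    {w : ℝ≥0 → ℝ≥0∞} (hw : Measurable w) {β : ℝ → ℝ≥0∞} (hβ : Measurable β) :
    ∫⁻ ω, ∫⁻ x, w x.1 * (D.indicator 1 (⟨x.1, ω⟩, x.2.1) * β x.2.2) ∂(P ω) ∂Q =
      (∫⁻ y, β y ∂ν) *
        ∫⁻ s, w s * ∫⁻ ω, lebesgueNN {θ | (⟨s, ω⟩, θ) ∈ D} ∂Q ∂lebesgueNN := by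
  have hind : Measurable (D.indicator
      (1 : Pred (pointFiltration P hP.measurable) × ℝ≥0 → ℝ≥0∞)) := measurable_one.indicator hD
  have hmk : Measurable fun z : (Ω × ℝ≥0) × ℝ≥0 =>
      ((⟨z.1.2, z.1.1⟩, z.2) : Pred (pointFiltration P hP.measurable) × ℝ≥0) :=
    (Pred.measurable_mk.comp (by fun_prop : Measurable fun z : (Ω × ℝ≥0) × ℝ≥0 =>
      (z.1.2, z.1.1))).prodMk measurable_snd
  have hmeas : Measurable fun z : Ω × ℝ≥0 => lebesgueNN {θ | (⟨z.2, z.1⟩, θ) ∈ D} :=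
    measurable_measure_prodMk_left (hmk hD)
  have hH : Measurable fun z : Pred (pointFiltration P hP.measurable) × (ℝ≥0 × ℝ) =>
      w z.1.time * (D.indicator 1 (z.1, z.2.1) * β z.2.2) := by
    refine (hw.comp (Pred.measurable_time.comp measurable_fst)).mul
      ((hind.comp (by fun_prop)).mul (by fun_prop))
  rw [hP.campbell hH]
  have : ∀ ω, ∫⁻ x, w x.1 * (D.indicator 1 (⟨x.1, ω⟩, x.2.1) * β x.2.2) ∂(intensityMeasure ν) =
      (∫⁻ y, β y ∂ν) * ∫⁻ s, w s * lebesgueNN {θ | (⟨s, ω⟩, θ) ∈ D} ∂lebesgueNN := by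
    intro ω
    have hm : Measurable fun x : Point => w x.1 * (D.indicator 1 (⟨x.1, ω⟩, x.2.1) * β x.2.2) := by
      refine (hw.comp measurable_fst).mul ((hind.comp ?_).mul (by fun_prop))
      exact hmk.comp (by fun_prop : Measurable fun x : Point => ((ω, x.1), x.2.1))
    have hm2 : ∀ s, Measurable fun θ : ℝ≥0 =>
        D.indicator 1 ((⟨s, ω⟩, θ) : Pred (pointFiltration P hP.measurable) × ℝ≥0) :=
      fun s => hind.comp (hmk.comp (by fun_prop : Measurable fun θ : ℝ≥0 => ((ω, s), θ)))
    rw [lintegral_intensityMeasure hm, ← lintegral_const_mul]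
    · refine lintegral_congr fun s => ?_
      have h1 : ∀ θ, ∫⁻ y, w s * (D.indicator 1
          ((⟨s, ω⟩, θ) : Pred (pointFiltration P hP.measurable) × ℝ≥0) * β y) ∂ν =
          (w s * ∫⁻ y, β y ∂ν) * D.indicator 1
            ((⟨s, ω⟩, θ) : Pred (pointFiltration P hP.measurable) × ℝ≥0) := by
        intro θ
        rw [lintegral_const_mul _ (by fun_prop), lintegral_const_mul _ hβ]
        ring
      simp only [h1]
      rw [lintegral_const_mul _ (hm2 s)]
      have h2 : ∫⁻ θ, D.indicator 1
          ((⟨s, ω⟩, θ) : Pred (pointFiltration P hP.measurable) × ℝ≥0) ∂lebesgueNN =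
          lebesgueNN {θ | (⟨s, ω⟩, θ) ∈ D} := by
        have hDs : MeasurableSet
            {θ | ((⟨s, ω⟩, θ) : Pred (pointFiltration P hP.measurable) × ℝ≥0) ∈ D} :=
          (hmk.comp (by fun_prop : Measurable fun θ : ℝ≥0 => ((ω, s), θ))) hD
        exact lintegral_indicator_one hDs
      rw [h2]
      ring
    · exact hw.mul (hmeas.comp (by fun_prop : Measurable fun s : ℝ≥0 => (ω, s)))
  simp only [this]
  have hm3 : Measurable fun z : Ω × ℝ≥0 => w z.2 * lebesgueNN {θ | (⟨z.2, z.1⟩, θ) ∈ D} :=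
    (hw.comp measurable_snd).mul hmeas
  rw [lintegral_const_mul _ hm3.lintegral_prod_right', lintegral_lintegral_swap hm3.aemeasurable]
  congr 1
  refine lintegral_congr fun s => ?_
  exact lintegral_const_mul (f := fun ω => lebesgueNN {θ | (⟨s, ω⟩, θ) ∈ D}) (w s)
    (hmeas.comp (by fun_prop : Measurable fun ω : Ω => (ω, s)))

end Campbell

/-! ### Integrality of the random measure -/

section Integrality

/-- A finite measure with natural numbers as values on a generating π-system (and on the whole
space) has natural numbers as values on all measurable sets. -/
theorem exists_nat_of_generateFrom {E : Type*} [mE : MeasurableSpace E] {m : Measure E}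
    {C : Set (Set E)} (hC : mE = MeasurableSpace.generateFrom C) (hpi : IsPiSystem C)
    (hm : ∀ A ∈ C, ∃ n : ℕ, m A = n) (hu : ∃ n : ℕ, m univ = n) {A : Set E}
    (hA : MeasurableSet A) : ∃ n : ℕ, m A = n := by
  obtain ⟨N, hN⟩ := hu
  have : IsFiniteMeasure m := ⟨by rw [hN]; exact ENNReal.natCast_lt_top N⟩
  induction A, hA using MeasurableSpace.induction_on_inter hC hpi with
  | empty => exact ⟨0, by simp⟩
  | basic t ht => exact hm t ht
  | compl t ht ih =>
    obtain ⟨n, hn⟩ := ih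
    exact ⟨N - n, by rw [measure_compl ht (measure_ne_top _ _), hN, hn, ENNReal.natCast_sub]⟩
  | iUnion f hd hf ih =>
    choose n hn using ih
    have hsum : ∑' i, (n i : ℝ≥0∞) = m (⋃ i, f i) := by
      rw [measure_iUnion hd hf]; exact tsum_congr fun i => (hn i).symm
    have hne : ∑' i, (n i : ℝ≥0∞) ≠ ∞ := by rw [hsum]; exact measure_ne_top _ _
    -- a convergent series of natural numbers has finitely many nonzero terms
    have hfin : (Function.support n).Finite := by
      have h1 := ENNReal.finite_const_le_of_tsum_ne_top hne one_ne_zero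
      refine h1.subset fun i hi => ?_
      have : 1 ≤ n i := Nat.one_le_iff_ne_zero.2 hi
      change (1 : ℝ≥0∞) ≤ n i
      exact_mod_cast this
    refine ⟨∑ i ∈ hfin.toFinset, n i, ?_⟩
    rw [← hsum, tsum_eq_sum (s := hfin.toFinset)]
    · push_cast; rfl
    · intro i hi
      simpa using hi

variable {Ω : Type*} [mΩ : MeasurableSpace Ω] {P : Ω → Measure Point} {ν : Measure ℝ}
  [IsProbabilityMeasure ν] {Q : Measure Ω}

/-- Almost surely, the random measure has no positive values below `1`, simultaneously on all
(also random) measurable sets. -/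
theorem IsPoissonRandomMeasure.ae_eq_zero_of_lt_one
    (hP : IsPoissonRandomMeasure P (intensityMeasure ν) Q) :
    ∀ᵐ ω ∂Q, ∀ A, MeasurableSet A → P ω A < 1 → P ω A = 0 := by
  let g : Finset ℕ → Set Point := fun F => ⋂ i ∈ F, MeasurableSpace.natGeneratingSequence Point i
  have hg : ∀ F, MeasurableSet (g F) := fun F =>
    Finset.measurableSet_biInter _ fun i _ => MeasurableSpace.measurableSet_natGeneratingSequence i
  have hgen : (inferInstance : MeasurableSpace Point) = MeasurableSpace.generateFrom (range g) := by
    refine le_antisymm ?_ (MeasurableSpace.generateFrom_le ?_)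
    · conv_lhs => rw [← MeasurableSpace.generateFrom_natGeneratingSequence Point]
      refine MeasurableSpace.generateFrom_mono ?_
      rintro _ ⟨i, rfl⟩
      exact ⟨{i}, by simp [g]⟩
    · rintro _ ⟨F, rfl⟩
      exact hg F
  have hpi : IsPiSystem (range g) := by
    classical
    rintro _ ⟨F, rfl⟩ _ ⟨G, rfl⟩ -
    exact ⟨F ∪ G, by ext x; simp only [g, Finset.mem_union, mem_iInter, mem_inter_iff]; grind⟩
  have h1 : ∀ᵐ ω ∂Q, ∀ k i F, ∃ n : ℕ, P ω (g F ∩ cell 1 k i) = n := by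
    rw [ae_all_iff]; intro k
    rw [ae_all_iff]; intro i
    rw [ae_all_iff]; intro F
    exact hP.ae_exists_nat ((hg F).inter (measurableSet_cell 1 k i))
      ((measure_mono inter_subset_right).trans_lt (intensityMeasure_cell_lt_top 1 k i))
  filter_upwards [h1, hP.ae_cell 1, hP.ae_tame (Δ := 1) one_pos] with ω h1 h2 h3 A hA hlt
  rw [← h3] at hlt ⊢
  rw [tame, Measure.sum_apply _ hA] at hlt ⊢
  rw [ENNReal.tsum_eq_zero]
  intro c
  have hle : piece 1 (P ω) c A < 1 := (ENNReal.le_tsum c).trans_lt hlt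
  rw [piece] at hle ⊢
  split_ifs with hc
  · rw [if_pos hc] at hle
    obtain ⟨n, hn⟩ := exists_nat_of_generateFrom (m := (P ω).restrict (cell 1 c.1 c.2.1)) hgen hpi
      (by
        rintro _ ⟨F, rfl⟩
        rw [Measure.restrict_apply (hg F)]
        exact h1 _ _ F) (by simpa using h2 _ _) hA
    rw [hn] at hle ⊢
    have : n < 1 := by exact_mod_cast hle
    simp [Nat.lt_one_iff.1 this]
  · simp

/-- Almost surely, every finite function is integrable on every set of finite mass: such a set
contains finitely many points. -/
theorem IsPoissonRandomMeasure.ae_lintegral_lt_top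
    (hP : IsPoissonRandomMeasure P (intensityMeasure ν) Q) :
    ∀ᵐ ω ∂Q, ∀ A, MeasurableSet A → P ω A < ∞ → ∀ f : Point → ℝ≥0, Measurable f →
      ∫⁻ x in A, f x ∂(P ω) < ∞ := by
  filter_upwards [hP.ae_eq_zero_of_lt_one] with ω h A hA hfin f hf
  have hm : ∀ n : ℕ, MeasurableSet (A ∩ {x | (n : ℝ≥0) < f x}) := fun n =>
    hA.inter (measurableSet_lt measurable_const hf)
  have hlim := tendsto_measure_iInter_atTop (μ := P ω)
    (s := fun n : ℕ => A ∩ {x | (n : ℝ≥0) < f x}) (fun n => (hm n).nullMeasurableSet)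
    (fun n k hnk x hx => ⟨hx.1,
        lt_of_le_of_lt (Nat.cast_le.2 hnk) (show (k : ℝ≥0) < f x from hx.2)⟩)
    ⟨0, ((measure_mono inter_subset_left).trans_lt hfin).ne⟩
  have hempty : ⋂ n : ℕ, A ∩ {x | (n : ℝ≥0) < f x} = ∅ := by
    ext x
    simp only [mem_iInter, mem_inter_iff, mem_ofPred_eq, mem_empty_iff_false, iff_false, not_forall]
    obtain ⟨n, hn⟩ := exists_nat_ge (f x)
    exact ⟨n, fun h => not_lt.2 hn h.2⟩
  rw [hempty, measure_empty] at hlim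
  obtain ⟨n, hn⟩ := (hlim.eventually (gt_mem_nhds one_pos)).exists
  have h0 := h _ (hm n) hn
  have hae : ∀ᵐ x ∂(P ω).restrict A, (f x : ℝ≥0∞) ≤ n := by
    rw [ae_restrict_iff' hA, ae_iff]
    refine measure_mono_null (fun x hx => ?_) h0
    simp only [mem_ofPred_eq, not_forall, not_le, exists_prop] at hx
    exact ⟨hx.1, by exact_mod_cast hx.2⟩
  calc ∫⁻ x in A, f x ∂(P ω) ≤ ∫⁻ x in A, n ∂(P ω) := lintegral_mono_ae hae
    _ = n * P ω A := by simp
    _ < ∞ := ENNReal.mul_lt_top (ENNReal.natCast_lt_top n) hfin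

end Integrality

/-! ### The discrete intensity is predictable -/

section Discrete

theorem measurableSet_binBelow (Δ : ℝ≥0) (k : ℕ) (l : ℝ) : MeasurableSet (binBelow Δ k l) := by
  refine (measurableSet_lt measurable_const measurable_fst).inter
    ((measurableSet_le measurable_fst measurable_const).inter
    (measurableSet_le (f := fun x : Point => (x.2.1 : ℝ)) (by fun_prop) measurable_const))

theorem measurable_lintegral_binBelow {Ω : Type*} [MeasurableSpace Ω] (κ : Kernel Ω Point)
    [IsSFiniteKernel κ] {l : Ω → ℝ} (hl : Measurable l) {b : ℝ → ℝ} (hb : Measurable b)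
    (Δ : ℝ≥0) (k : ℕ) :
    Measurable fun ω => ∫⁻ x in binBelow Δ k (l ω), ENNReal.ofReal (b x.2.2) ∂(κ ω) := by
  have hS : MeasurableSet {z : Ω × Point | z.2 ∈ binBelow Δ k (l z.1)} := by
    refine (measurableSet_lt (f := fun _ => ((k - 1 : ℕ) : ℝ≥0) * Δ)
        (g := fun z : Ω × Point => z.2.1) measurable_const (by fun_prop)).inter
      ((measurableSet_le (f := fun z : Ω × Point => z.2.1) (g := fun _ => (k : ℝ≥0) * Δ)
        (by fun_prop) measurable_const).inter
      (measurableSet_le (f := fun z : Ω × Point => (z.2.2.1 : ℝ)) (by fun_prop) (by fun_prop)))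
  have hf : Measurable ({z : Ω × Point | z.2 ∈ binBelow Δ k (l z.1)}.indicator
      fun z => ENNReal.ofReal (b z.2.2.2)) := Measurable.indicator (by fun_prop) hS
  have := hf.lintegral_kernel_prod_right' (κ := κ)
  convert this using 2 with ω
  rw [← lintegral_indicator (measurableSet_binBelow Δ k (l ω))]
  rfl

variable {Ω : Type*} [mΩ : MeasurableSpace Ω] {P : Ω → Measure Point}

theorem measurable_pointFiltration (hP : Measurable P) {t : ℝ≥0} {A : Set Point}
    (hA : MeasurableSet A) (hAt : A ⊆ {x | 0 < x.1 ∧ x.1 ≤ t}) :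
    Measurable[pointFiltration P hP t] fun ω => P ω A := by
  have h : MeasurableSpace.comap (fun ω => P ω A) inferInstance ≤ pointFiltration P hP t :=
    le_iSup₂_of_le (f := fun (A : Set Point)
      (_ : MeasurableSet A ∧ A ⊆ {x : Point | 0 < x.1 ∧ x.1 ≤ t}) =>
      MeasurableSpace.comap (fun ω => P ω A) inferInstance) A ⟨hA, hAt⟩ le_rfl
  exact (comap_measurable _).mono h le_rfl

/-- The part of the tamed random measure in the past is a kernel for the σ-algebra of the past. -/
theorem exists_kernel_past (hP : Measurable P) (Δ : ℝ≥0) (n : ℕ) :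
    ∃ κ : @Kernel Ω Point (pointFiltration P hP ((n : ℝ≥0) * Δ)) _,
      @IsSFiniteKernel _ _ (pointFiltration P hP ((n : ℝ≥0) * Δ)) _ κ ∧
      ∀ ω, κ ω = (tame Δ (P ω)).restrict {x | x.1 ≤ (n : ℝ≥0) * Δ} := by
  set m : MeasurableSpace Ω := pointFiltration P hP ((n : ℝ≥0) * Δ) with hm
  have hmeas : ∀ (c : ℕ × ℕ × ℕ) A, MeasurableSet A →
      Measurable[m] fun ω => (if c.1 < n then piece Δ (P ω) c else 0) A := by
    intro c A hA
    by_cases hcn : c.1 < n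
    · have hc := measurableSet_cell Δ c.1 c.2.1
      have hsub : cell Δ c.1 c.2.1 ⊆ {x | 0 < x.1 ∧ x.1 ≤ (n : ℝ≥0) * Δ} := by
        intro x hx
        refine ⟨zero_le.trans_lt hx.1, hx.2.1.trans ?_⟩
        gcongr
        exact hcn
      have : (fun ω => (if c.1 < n then piece Δ (P ω) c else 0) A) = fun ω =>
          {ω | P ω (cell Δ c.1 c.2.1) = c.2.2}.indicator (fun ω =>
              P ω (A ∩ cell Δ c.1 c.2.1)) ω := by
        funext ω
        by_cases h : P ω (cell Δ c.1 c.2.1) = c.2.2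
        · simp [piece, h, Measure.restrict_apply hA, hcn]
        · simp [piece, h]
      rw [this]
      exact Measurable.indicator
        (measurable_pointFiltration (mΩ := mΩ) hP (hA.inter hc) (inter_subset_right.trans hsub))
        (measurable_pointFiltration (mΩ := mΩ) hP hc hsub (measurableSet_singleton _))
    · simp [hcn]
  obtain ⟨κ, h1, h2⟩ := exists_sfinite_kernel m
    (fun (c : ℕ × ℕ × ℕ) ω => if c.1 < n then piece Δ (P ω) c else 0) hmeas
    (fun c => ⟨c.2.2, ENNReal.natCast_lt_top _, fun ω => by
      split_ifs
      · exact piece_univ_le _ _ _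
      · simp⟩)
  exact ⟨κ, h1, fun ω => (h2 ω).trans (restrict_tame (P ω) n).symm⟩

theorem integral_binBelow_eq_toReal {b : ℝ → ℝ} (hb : Measurable b) (hb0 : ∀ y, 0 ≤ b y)
    (p : Measure Point) (A : Set Point) :
    ∫ x in A, b x.2.2 ∂p = (∫⁻ x in A, ENNReal.ofReal (b x.2.2) ∂p).toReal :=
  integral_eq_lintegral_of_nonneg_ae (ae_of_all _ fun x => hb0 _)
    (by fun_prop : Measurable fun x : Point => b x.2.2).aestronglyMeasurable

/-- The intensity of the `n`-th bin is determined by the earlier bins. -/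
theorem measurable_discreteIntensity (hP : Measurable P) {ψ h b : ℝ → ℝ} (hψ : Measurable ψ)
    (hb : Measurable b) (hb0 : ∀ y, 0 ≤ b y) (Δ : ℝ≥0) (n : ℕ) :
    Measurable[pointFiltration P hP (((n - 1 : ℕ) : ℝ≥0) * Δ)]
      fun ω => discreteIntensity ψ h b Δ (tame Δ (P ω)) n := by
  induction n using Nat.strong_induction_on with
  | _ n ih =>
  simp only [discreteIntensity_eq ψ h b Δ _ n]
  refine hψ.comp (Finset.measurable_sum _ fun k hk => Measurable.const_mul ?_ _)
  obtain ⟨hk1, hkn⟩ := Finset.mem_Ico.1 hk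
  have hle : (k : ℝ≥0) * Δ ≤ ((n - 1 : ℕ) : ℝ≥0) * Δ := by
    gcongr
    omega
  refine Measurable.mono ?_ ((pointFiltration P hP).mono hle) le_rfl
  have hlk := ih k hkn
  have hlk' : Measurable[pointFiltration P hP ((k : ℝ≥0) * Δ)]
      fun ω => discreteIntensity ψ h b Δ (tame Δ (P ω)) k := by
    refine hlk.mono ((pointFiltration P hP).mono ?_) le_rfl
    gcongr
    omega
  obtain ⟨κ, hκ, hκe⟩ := exists_kernel_past hP Δ k
  simp only [integral_binBelow_eq_toReal hb hb0]
  refine Measurable.ennreal_toReal ?_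
  have := @measurable_lintegral_binBelow Ω
    (pointFiltration P hP ((k : ℝ≥0) * Δ)) κ hκ _ hlk' b hb Δ k
  convert this using 2 with ω
  rw [hκe, Measure.restrict_restrict (measurableSet_binBelow _ _ _)]
  congr 2
  exact (inter_eq_self_of_subset_left fun (x : Point) (hx : x ∈ binBelow Δ k _) => hx.2.1).symm

/-- The intensity of the discretisation, as a process in continuous time, constant on the bins
`((n-1)Δ, nΔ]`. It is built from the tamed random measure, which makes it predictable. -/
noncomputable def stepIntensity (P : Ω → Measure Point) (ψ h b : ℝ → ℝ) (Δ : ℝ≥0)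
    (s : ℝ≥0) (ω : Ω) : ℝ :=
  discreteIntensity ψ h b Δ (tame Δ (P ω)) ⌈s / Δ⌉₊

theorem measurable_stepIntensity (hP : Measurable P) {ψ h b : ℝ → ℝ} (hψ : Measurable ψ)
    (hb : Measurable b) (hb0 : ∀ y, 0 ≤ b y) {Δ : ℝ≥0} (hΔ : 0 < Δ) :
    Measurable fun z : Pred (pointFiltration P hP) => stepIntensity P ψ h b Δ z.time z.outcome := by
  intro s hs
  have hceil : Measurable fun z : Pred (pointFiltration P hP) => ⌈z.time / Δ⌉₊ :=
    Nat.measurable_ceil.comp (Pred.measurable_time.div_const Δ)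
  have hU : (fun z : Pred (pointFiltration P hP) =>
      stepIntensity P ψ h b Δ z.time z.outcome) ⁻¹' s =
      ⋃ n : ℕ, {z | ⌈z.time / Δ⌉₊ = n} ∩
        {z | discreteIntensity ψ h b Δ (tame Δ (P z.outcome)) n ∈ s} := by
    ext z
    simp [stepIntensity]
  rw [hU]
  refine MeasurableSet.iUnion fun n => ?_
  have hn := hceil (measurableSet_singleton n)
  -- the bin `0` is the time `0`, where the discrete intensity is the constant `ψ 0`
  rcases Nat.eq_zero_or_pos n with rfl | hpos
  · have : ∀ ω, discreteIntensity ψ h b Δ (tame Δ (P ω)) 0 = ψ 0 := fun ω => by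
      rw [discreteIntensity_eq]; simp
    simp only [this]
    exact hn.inter (MeasurableSet.const _)
  · have h1 := Pred.measurable_of_past _
      (measurable_discreteIntensity (h := h) hP hψ hb hb0 Δ n) 0 hs
    convert hn.inter h1 using 1
    ext z
    simp only [mem_inter_iff, mem_preimage, mem_singleton_iff, mem_ofPred_eq]
    refine and_congr_right fun hz => ?_
    have hlt : ((n - 1 : ℕ) : ℝ≥0) * Δ < z.time := by
      rw [Nat.ceil_eq_iff hpos.ne'] at hz
      exact (lt_div_iff₀ hΔ).1 hz.1
    rw [if_pos hlt]

end Discrete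

/-! ### Bounds on the mean intensities -/

theorem setLIntegral_Ici_lebesgueNN (f : ℝ≥0 → ℝ≥0∞) (s : ℝ≥0) :
    ∫⁻ t in Ici s, f t ∂lebesgueNN = ∫⁻ u, f (u + s) ∂lebesgueNN := by
  have h1 : ∫⁻ t in Ici s, f t ∂lebesgueNN =
      ∫⁻ t : ℝ in Ici 0, (Ici (s : ℝ)).indicator (fun t => f t.toNNReal) t := by
    rw [← lintegral_lebesgueNN, ← lintegral_indicator measurableSet_Ici]
    refine lintegral_congr fun t => ?_
    simp [indicator]
  have h2 : ∫⁻ u, f (u + s) ∂lebesgueNN = ∫⁻ u : ℝ in Ici 0, f (u + s).toNNReal := by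
    rw [← lintegral_lebesgueNN (fun u => f (u + s).toNNReal)]
    refine lintegral_congr fun u => ?_
    rw [← NNReal.coe_add, Real.toNNReal_coe]
  rw [h1, h2, ← lintegral_indicator measurableSet_Ici, ← lintegral_indicator measurableSet_Ici,
    ← lintegral_add_right_eq_self _ (s : ℝ)]
  refine lintegral_congr fun u => ?_
  have hs := s.2
  by_cases hu : 0 ≤ u
  · have : 0 ≤ u + s := by positivity
    simp [indicator, hu, this]
  · simp [indicator, hu]

/-- Finiteness of `x` is what allows one to solve the inequality for `x`. -/
theorem le_div_one_sub_of_le_add_mul {x a ρ : ℝ≥0∞} (hx : x ≠ ∞) (hρ : ρ < 1)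
    (h : x ≤ a + ρ * x) : x ≤ a / (1 - ρ) := by
  have h1 : 1 - ρ ≠ 0 := (tsub_pos_of_lt hρ).ne'
  have hρx : ρ * x ≠ ∞ := ENNReal.mul_ne_top hρ.ne_top hx
  rw [ENNReal.le_div_iff_mul_le (Or.inl h1) (Or.inl (by finiteness)), mul_comm,
    ENNReal.sub_mul (fun _ _ => hx), one_mul]
  exact tsub_le_iff_right.2 h

section Density

variable {Ω : Type*} {mΩ : MeasurableSpace Ω} {𝓕 : Filtration ℝ≥0 mΩ}

/-- The mean Lebesgue measure, at time `s`, of the heights in the predictable set `D`. -/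
noncomputable def density (Q : Measure Ω) (D : Set (Pred 𝓕 × ℝ≥0)) (s : ℝ≥0) : ℝ≥0∞ :=
  ∫⁻ ω, lebesgueNN {θ | ((⟨s, ω⟩, θ) : Pred 𝓕 × ℝ≥0) ∈ D} ∂Q

theorem Pred.measurable_mk_prod :
    Measurable fun z : (ℝ≥0 × Ω) × ℝ≥0 => ((⟨z.1.1, z.1.2⟩, z.2) : Pred 𝓕 × ℝ≥0) :=
  (Pred.measurable_mk.comp measurable_fst).prodMk measurable_snd

theorem measurable_height {D : Set (Pred 𝓕 × ℝ≥0)} (hD : MeasurableSet D) :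
    Measurable fun z : ℝ≥0 × Ω => lebesgueNN {θ | ((⟨z.1, z.2⟩, θ) : Pred 𝓕 × ℝ≥0) ∈ D} :=
  measurable_measure_prodMk_left (Pred.measurable_mk_prod hD)

theorem measurable_density (Q : Measure Ω) [SFinite Q] {D : Set (Pred 𝓕 × ℝ≥0)}
    (hD : MeasurableSet D) : Measurable (density Q D) :=
  (measurable_height hD).lintegral_prod_right'

theorem measurable_indicator_section {D : Set (Pred 𝓕 × ℝ≥0)} (hD : MeasurableSet D) (ω : Ω) :
    Measurable fun x : Point => D.indicator (1 : Pred 𝓕 × ℝ≥0 → ℝ≥0∞) (⟨x.1, ω⟩, x.2.1) :=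
  (measurable_one.indicator hD).comp (Pred.measurable_mk_prod.comp
    (by fun_prop : Measurable fun x : Point => ((x.1, ω), x.2.1)))

variable (𝓕) in
/-- The heights below the level `a`. -/
def below (a : ℝ≥0 → Ω → ℝ) : Set (Pred 𝓕 × ℝ≥0) :=
  {z | (z.2 : ℝ) ≤ a z.1.time z.1.outcome}

variable (𝓕) in
/-- The heights between the levels `a` and `b`, which are below exactly one of them. -/
def between (a b : ℝ≥0 → Ω → ℝ) : Set (Pred 𝓕 × ℝ≥0) :=
  {z | Xor ((z.2 : ℝ) ≤ a z.1.time z.1.outcome) ((z.2 : ℝ) ≤ b z.1.time z.1.outcome)}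

theorem measurableSet_below {a : ℝ≥0 → Ω → ℝ}
    (ha : Measurable fun z : Pred 𝓕 => a z.time z.outcome) : MeasurableSet (below 𝓕 a) :=
  measurableSet_le (f := fun z : Pred 𝓕 × ℝ≥0 => (z.2 : ℝ)) (by fun_prop) (ha.comp measurable_fst)

theorem measurableSet_between {a b : ℝ≥0 → Ω → ℝ}
    (ha : Measurable fun z : Pred 𝓕 => a z.time z.outcome)
    (hb : Measurable fun z : Pred 𝓕 => b z.time z.outcome) : MeasurableSet (between 𝓕 a b) :=
  ((measurableSet_below ha).diff (measurableSet_below hb)).union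
    ((measurableSet_below hb).diff (measurableSet_below ha))

theorem density_below (Q : Measure Ω) (a : ℝ≥0 → Ω → ℝ) (s : ℝ≥0) :
    density Q (below 𝓕 a) s = ∫⁻ ω, ENNReal.ofReal (a s ω) ∂Q :=
  lintegral_congr fun ω => lebesgueNN_coe_le (a s ω)

theorem density_between_le (Q : Measure Ω) (a b : ℝ≥0 → Ω → ℝ) (s : ℝ≥0) :
    density Q (between 𝓕 a b) s ≤ ∫⁻ ω, ENNReal.ofReal |a s ω - b s ω| ∂Q :=
  lintegral_mono fun _ => lebesgueNN_xor_le _ _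

theorem Pred.measurable_history {f : Pred 𝓕 → ℝ≥0∞} (hf : Measurable f) :
    Measurable fun z : Pred 𝓕 × ℝ≥0 => if z.2 < z.1.time then f ⟨z.2, z.1.outcome⟩ else 0 := by
  intro s hs
  by_cases hd : (0 : ℝ≥0∞) ∈ s
  · have h1 := (Pred.measurableSet_history (hf hs.compl)).compl
    convert h1 using 1
    ext z
    simp only [mem_preimage, mem_compl_iff, mem_ofPred_eq]
    split_ifs <;> simp [*]
  · have h1 := Pred.measurableSet_history (hf hs)
    convert h1 using 1
    ext z
    simp only [mem_preimage, mem_ofPred_eq]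
    split_ifs <;> simp [*]

/-- The integral of a predictable process over the past. It is predictable, and continuous in time
as long as it is finite; this makes it suitable for localisation. -/
noncomputable def pastIntegral (f : Pred 𝓕 → ℝ≥0∞) (z : Pred 𝓕) : ℝ≥0∞ :=
  ∫⁻ u in Iio z.time, f ⟨u, z.outcome⟩ ∂lebesgueNN

theorem measurable_pastIntegral {f : Pred 𝓕 → ℝ≥0∞} (hf : Measurable f) :
    Measurable (pastIntegral f) := by
  have := (Pred.measurable_history hf).lintegral_prod_right' (ν := lebesgueNN)
  convert this using 2 with z
  rw [pastIntegral, ← lintegral_indicator measurableSet_Iio]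
  rfl

theorem pastIntegral_mono (f : Pred 𝓕 → ℝ≥0∞) {s t : ℝ≥0} (hst : s ≤ t) (ω : Ω) :
    pastIntegral f ⟨s, ω⟩ ≤ pastIntegral f ⟨t, ω⟩ :=
  lintegral_mono_set (Iio_subset_Iio hst)

/-- The times `t ≤ T` at which the integral of `f` over `[0,t)` is at most `n` contribute at most
`n` to the integral of `f`. -/
theorem lintegral_past_le (f : ℝ≥0 → ℝ≥0∞) (n : ℝ≥0∞) (T : ℝ≥0) :
    ∫⁻ t in {t | t ≤ T ∧ ∫⁻ u in Iio t, f u ∂lebesgueNN ≤ n}, f t ∂lebesgueNN ≤ n := by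
  set I := {t | t ≤ T ∧ ∫⁻ u in Iio t, f u ∂lebesgueNN ≤ n}
  -- `I` is an interval, which a sequence increasing to its supremum exhausts up to a null set
  rcases I.eq_empty_or_nonempty with h | h
  · simp [h]
  obtain ⟨u, hu, hlim, huI⟩ := exists_seq_tendsto_sSup h ⟨T, fun t ht => ht.1⟩
  have hsub : I ⊆ (⋃ j, Iio (u j)) ∪ {sSup I} := by
    intro t ht
    rcases (le_csSup ⟨T, fun t ht => ht.1⟩ ht).lt_or_eq with h1 | h1
    · left
      obtain ⟨j, hj⟩ := (hlim.eventually (lt_mem_nhds h1)).exists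
      exact mem_iUnion.2 ⟨j, hj⟩
    · exact Or.inr h1
  calc ∫⁻ t in I, f t ∂lebesgueNN ≤ ∫⁻ t in (⋃ j, Iio (u j)) ∪ {sSup I}, f t ∂lebesgueNN :=
        lintegral_mono_set hsub
    _ = ∫⁻ t in ⋃ j, Iio (u j), f t ∂lebesgueNN := by
        refine setLIntegral_congr ?_
        exact union_ae_eq_left_of_ae_eq_empty (by
          rw [ae_eq_empty]; exact measure_singleton _)
    _ = ⨆ j, ∫⁻ t in Iio (u j), f t ∂lebesgueNN :=
        setLIntegral_iUnion_of_directed _ (directed_of_isDirected_le fun i j hij =>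
          Iio_subset_Iio (hu hij))
    _ ≤ n := iSup_le fun j => (huI j).2

end Density

/-- The kernel `|h(t-s)| 1_{s < t}`. -/
noncomputable def absKernel (h : ℝ → ℝ) (t s : ℝ≥0) : ℝ≥0∞ :=
  if s < t then ENNReal.ofReal |h ((t : ℝ) - s)| else 0

theorem measurable_absKernel {h : ℝ → ℝ} (hh : Measurable h) :
    Measurable fun z : ℝ≥0 × ℝ≥0 => absKernel h z.1 z.2 :=
  Measurable.ite (measurableSet_lt measurable_snd measurable_fst) (by fun_prop) measurable_const

theorem measurable_absKernel_left {h : ℝ → ℝ} (hh : Measurable h) (s : ℝ≥0) :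
    Measurable fun t : ℝ≥0 => absKernel h t s :=
  (measurable_absKernel hh).comp (by fun_prop : Measurable fun t : ℝ≥0 => (t, s))

theorem lintegral_absKernel_le (h : ℝ → ℝ) (T s : ℝ≥0) :
    ∫⁻ t in Iic T, absKernel h t s ∂lebesgueNN ≤
      (Iic T).indicator 1 s * ∫⁻ t in Iic T, ENNReal.ofReal |h t| ∂lebesgueNN := by
  by_cases hsT : s ≤ T
  · rw [indicator_of_mem (show s ∈ Iic T from hsT), Pi.one_apply, one_mul]
    calc ∫⁻ t in Iic T, absKernel h t s ∂lebesgueNN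
        ≤ ∫⁻ t in Ici s, (Iic T).indicator (fun t => absKernel h t s) t ∂lebesgueNN := by
          rw [← lintegral_indicator measurableSet_Iic, ← lintegral_indicator measurableSet_Ici]
          refine lintegral_mono fun t => ?_
          simp only [indicator, absKernel, mem_Iic, mem_Ici]
          split_ifs with h1 h2 h3 <;> first | exact le_rfl | exact zero_le | exact absurd h2.le h3
      _ = ∫⁻ u, (Iic T).indicator (fun t => absKernel h t s) (u + s) ∂lebesgueNN :=
          setLIntegral_Ici_lebesgueNN _ _
      _ ≤ ∫⁻ t in Iic T, ENNReal.ofReal |h t| ∂lebesgueNN := by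
          rw [← lintegral_indicator measurableSet_Iic]
          refine lintegral_mono fun u => ?_
          simp only [indicator, absKernel, mem_Iic, NNReal.coe_add, add_sub_cancel_right]
          split_ifs with h1 h2 h3 h3 <;>
            first | exact le_rfl | exact zero_le | exact absurd (le_self_add.trans h1) h3
  · have : ∀ t ∈ Iic T, absKernel h t s = 0 := fun t ht =>
      if_neg (not_lt.2 (ht.trans (not_le.1 hsT).le))
    rw [setLIntegral_congr_fun measurableSet_Iic this]
    simp

section Stability

variable {Ω : Type*} [mΩ : MeasurableSpace Ω] {P : Ω → Measure Point} {ν : Measure ℝ}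
  {Q : Measure Ω} {ψ h b : ℝ → ℝ} {L : ℝ≥0} {c : ℝ} {T : ℝ≥0} {R lam : ℝ≥0 → Ω → ℝ}

theorem ofReal_le_of_lipschitz (hψL : LipschitzWith L ψ) (hψc : ψ 0 ≤ c) (x : ℝ) :
    ENNReal.ofReal (ψ x) ≤ ENNReal.ofReal c + L * ‖x‖ₑ := by
  have h1 : ψ x ≤ c + L * |x| := by
    have := hψL.dist_le_mul x 0
    rw [Real.dist_eq, Real.dist_eq, sub_zero] at this
    linarith [le_abs_self (ψ x - ψ 0)]
  calc ENNReal.ofReal (ψ x) ≤ ENNReal.ofReal (c + L * |x|) := ENNReal.ofReal_le_ofReal h1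
    _ ≤ ENNReal.ofReal c + ENNReal.ofReal (L * |x|) := ENNReal.ofReal_add_le
    _ = _ := by
      rw [ENNReal.ofReal_mul (NNReal.coe_nonneg L), ← Real.enorm_eq_ofReal_abs,
        ENNReal.ofReal_coe_nnreal]

theorem ae_intensity_le (hP : IsPoissonRandomMeasure P (intensityMeasure ν) Q)
    (hR : IsHawkesRisk Q P hP.measurable ψ h b T R lam)
    (hψL : LipschitzWith L ψ) (hψc : ψ 0 ≤ c) (hb0 : ∀ y, 0 ≤ b y) :
    ∀ᵐ ω ∂Q, ∀ t ≤ T, ENNReal.ofReal (lam t ω) ≤ ENNReal.ofReal c +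
      L * ∫⁻ x, absKernel h t x.1 * ((below (pointFiltration P hP.measurable) lam).indicator 1
        (⟨x.1, ω⟩, x.2.1) * ENNReal.ofReal (b x.2.2)) ∂(P ω) := by
  have hlam := IsStronglyPredictable.measurable_pred hR.predictable
  filter_upwards [hR.intensity_eq] with ω hω t ht
  rw [hω t ht]
  refine (ofReal_le_of_lipschitz hψL hψc _).trans ?_
  gcongr
  refine (enorm_integral_le_lintegral_enorm _).trans ?_
  have hm : MeasurableSet {x : Point | x.1 < t ∧ (x.2.1 : ℝ) ≤ lam x.1 ω} := by
    have h1 : Measurable fun x : Point => lam x.1 ω :=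
      hlam.comp (Pred.measurable_mk.comp (by fun_prop : Measurable fun x : Point => (x.1, ω)))
    exact (measurableSet_lt measurable_fst measurable_const).inter
      (measurableSet_le (f := fun x : Point => (x.2.1 : ℝ)) (by fun_prop) h1)
  rw [← lintegral_indicator hm]
  refine lintegral_mono fun x => ?_
  by_cases hx : x ∈ {x : Point | x.1 < t ∧ (x.2.1 : ℝ) ≤ lam x.1 ω}
  · have hx2 : ((⟨x.1, ω⟩, x.2.1) : Pred (pointFiltration P hP.measurable) × ℝ≥0) ∈
        below (pointFiltration P hP.measurable) lam := hx.2
    rw [indicator_of_mem hx, indicator_of_mem hx2, absKernel, if_pos hx.1, Pi.one_apply, one_mul,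
      enorm_mul, Real.enorm_eq_ofReal_abs, Real.enorm_of_nonneg (hb0 _)]
  · rw [indicator_of_notMem hx]
    exact zero_le

variable [IsProbabilityMeasure ν]

/-- The intensity is almost surely integrable: there are finitely many accepted points. -/
theorem ae_lintegral_intensity_lt_top (hP : IsPoissonRandomMeasure P (intensityMeasure ν) Q)
    (hR : IsHawkesRisk Q P hP.measurable ψ h b T R lam)
    (hψL : LipschitzWith L ψ) (hψc : ψ 0 ≤ c) (hb : Measurable b) (hb0 : ∀ y, 0 ≤ b y)
    (hh : Measurable h) (hhT : ∫⁻ t in Iic T, ENNReal.ofReal |h t| ∂lebesgueNN < ∞) :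
    ∀ᵐ ω ∂Q, ∫⁻ t in Iic T, ENNReal.ofReal (lam t ω) ∂lebesgueNN < ∞ := by
  have hlam := IsStronglyPredictable.measurable_pred hR.predictable
  have hD := measurableSet_below hlam
  filter_upwards [ae_intensity_le hP hR hψL hψc hb0, hR.finite, hP.ae_lintegral_lt_top,
    hP.ae_sfinite] with ω h1 h2 h3 h4
  set D := below (pointFiltration P hP.measurable) lam
  have hind := measurable_indicator_section hD ω
  set S : Set Point := {x | x.1 ≤ T ∧ (x.2.1 : ℝ) ≤ lam x.1 ω}
  have hm : MeasurableSet S := by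
    have h1 : Measurable fun x : Point => lam x.1 ω :=
      hlam.comp (Pred.measurable_mk.comp (by fun_prop : Measurable fun x : Point => (x.1, ω)))
    exact (measurableSet_le measurable_fst measurable_const).inter
      (measurableSet_le (f := fun x : Point => (x.2.1 : ℝ)) (by fun_prop) h1)
  have hfin := h3 S hm h2 (fun x => (b x.2.2).toNNReal) (by fun_prop)
  have hk : Measurable fun z : ℝ≥0 × Point => absKernel h z.1 z.2.1 :=
    (measurable_absKernel hh).comp (by fun_prop : Measurable fun z : ℝ≥0 × Point => (z.1, z.2.1))
  have hF : Measurable fun z : ℝ≥0 × Point => absKernel h z.1 z.2.1 *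
      (D.indicator 1 (⟨z.2.1, ω⟩, z.2.2.1) * ENNReal.ofReal (b z.2.2.2)) :=
    hk.mul ((hind.comp measurable_snd).mul (by fun_prop))
  calc ∫⁻ t in Iic T, ENNReal.ofReal (lam t ω) ∂lebesgueNN
      ≤ ∫⁻ t in Iic T, (ENNReal.ofReal c + L * ∫⁻ x, absKernel h t x.1 *
          (D.indicator 1 (⟨x.1, ω⟩, x.2.1) * ENNReal.ofReal (b x.2.2)) ∂(P ω)) ∂lebesgueNN :=
        setLIntegral_mono' measurableSet_Iic fun t ht => h1 t ht
    _ = ENNReal.ofReal c * T + L * ∫⁻ x, (∫⁻ t in Iic T, absKernel h t x.1 ∂lebesgueNN) *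
          (D.indicator 1 (⟨x.1, ω⟩, x.2.1) * ENNReal.ofReal (b x.2.2)) ∂(P ω) := by
        rw [lintegral_add_left measurable_const, lintegral_const, Measure.restrict_apply_univ,
          lebesgueNN_Iic, lintegral_const_mul _ hF.lintegral_prod_right',
          lintegral_lintegral_swap hF.aemeasurable]
        congr 2
        refine lintegral_congr fun x => ?_
        dsimp only
        rw [lintegral_mul_const _ (measurable_absKernel_left hh x.1)]
    _ ≤ ENNReal.ofReal c * T + L * ∫⁻ x, (∫⁻ t in Iic T, ENNReal.ofReal |h t| ∂lebesgueNN) *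
          S.indicator (fun x => ENNReal.ofReal (b x.2.2)) x ∂(P ω) := by
        refine add_le_add le_rfl (mul_le_mul' le_rfl (lintegral_mono fun x => ?_))
        refine (mul_le_mul_left (lintegral_absKernel_le h T x.1) _).trans ?_
        by_cases hx1 : x.1 ≤ T
        · by_cases hx2 : (x.2.1 : ℝ) ≤ lam x.1 ω
          · rw [indicator_of_mem (show x.1 ∈ Iic T from hx1),
                indicator_of_mem (show x ∈ S from ⟨hx1, hx2⟩),
              indicator_of_mem (show _ ∈ D from hx2)]
            simp
          · rw [indicator_of_notMem (show _ ∉ D from hx2)]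
            simp
        · rw [indicator_of_notMem (show x.1 ∉ Iic T from hx1)]
          simp
    _ = ENNReal.ofReal c * T + L * ((∫⁻ t in Iic T, ENNReal.ofReal |h t| ∂lebesgueNN) *
          ∫⁻ x in S, (b x.2.2).toNNReal ∂(P ω)) := by
        rw [lintegral_const_mul _ (Measurable.indicator (by fun_prop) hm), lintegral_indicator hm]
        rfl
    _ < ∞ := by
        refine ENNReal.add_lt_top.2 ⟨by finiteness, ?_⟩
        exact ENNReal.mul_lt_top ENNReal.coe_lt_top (ENNReal.mul_lt_top hhT hfin)

variable [IsProbabilityMeasure Q]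

/-- The mean intensity is integrable on `[0,T]`, with an explicit bound. The process is localised
by the predictable times at which the integrated intensity is at most `n`; the localised mean
intensity has a finite integral, so that the linear inequality that it satisfies may be solved. -/
theorem lintegral_intensity_le (hP : IsPoissonRandomMeasure P (intensityMeasure ν) Q)
    (hR : IsHawkesRisk Q P hP.measurable ψ h b T R lam)
    (hψL : LipschitzWith L ψ) (hψc : ψ 0 ≤ c) (hb : Measurable b) (hb0 : ∀ y, 0 ≤ b y)
    (hh : Measurable h) (hhT : ∫⁻ t in Iic T, ENNReal.ofReal |h t| ∂lebesgueNN < ∞)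
    {ρ : ℝ≥0∞} (hρ : ρ < 1) (hρh : L * ((∫⁻ y, ENNReal.ofReal (b y) ∂ν) *
      ∫⁻ t in Iic T, ENNReal.ofReal |h t| ∂lebesgueNN) ≤ ρ) :
    ∫⁻ s in Iic T, density Q (below (pointFiltration P hP.measurable) lam) s ∂lebesgueNN ≤
      ENNReal.ofReal c * T / (1 - ρ) := by
  set 𝓕 := pointFiltration P hP.measurable
  have hlam : Measurable fun z : Pred 𝓕 => lam z.time z.outcome :=
    IsStronglyPredictable.measurable_pred hR.predictable
  let f : Pred 𝓕 → ℝ≥0∞ := fun z => ENNReal.ofReal (lam z.time z.outcome)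
  have hf : Measurable f := hlam.ennreal_ofReal
  have hΛ := measurable_pastIntegral hf
  -- `V n` is the stochastic interval on which the integrated intensity is at most `n`
  let V : ℕ → Set (Pred 𝓕) := fun n => {z | pastIntegral f z ≤ n}
  have hV : ∀ n, MeasurableSet (V n) := fun n => hΛ measurableSet_Iic
  let D : ℕ → Set (Pred 𝓕 × ℝ≥0) := fun n => below 𝓕 lam ∩ {z | z.1 ∈ V n}
  have hD : ∀ n, MeasurableSet (D n) := fun n =>
    (measurableSet_below hlam).inter (measurable_fst (hV n))
  have hDd : ∀ n t ω, lebesgueNN {θ | ((⟨t, ω⟩, θ) : Pred 𝓕 × ℝ≥0) ∈ D n} =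
      (V n).indicator f ⟨t, ω⟩ := by
    intro n t ω
    by_cases hz : (⟨t, ω⟩ : Pred 𝓕) ∈ V n
    · rw [indicator_of_mem hz]
      refine Eq.trans ?_ (lebesgueNN_coe_le (lam t ω))
      congr 1
      ext θ
      exact ⟨fun h => h.1, fun h => ⟨h, hz⟩⟩
    · rw [indicator_of_notMem hz]
      convert measure_empty (μ := lebesgueNN)
      ext θ
      simp only [mem_ofPred_eq, mem_empty_iff_false, iff_false]
      exact fun h => hz h.2
  have hfn : ∀ n, Measurable fun z : ℝ≥0 × Ω => (V n).indicator f ⟨z.1, z.2⟩ := fun n =>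
    (hf.indicator (hV n)).comp Pred.measurable_mk
  let X : ℕ → ℝ≥0∞ := fun n => ∫⁻ s in Iic T, density Q (D n) s ∂lebesgueNN
  have hX : ∀ n, X n = ∫⁻ ω, ∫⁻ s in Iic T, (V n).indicator f ⟨s, ω⟩ ∂lebesgueNN ∂Q := by
    intro n
    simp only [X, density, hDd]
    exact lintegral_lintegral_swap (hfn n).aemeasurable
  have hXn : ∀ n, X n ≤ n := by
    intro n
    rw [hX]
    calc ∫⁻ ω, ∫⁻ s in Iic T, (V n).indicator f ⟨s, ω⟩ ∂lebesgueNN ∂Q ≤ ∫⁻ ω, n ∂Q := by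
          refine lintegral_mono fun ω => ?_
          have hVm : MeasurableSet {s : ℝ≥0 | (⟨s, ω⟩ : Pred 𝓕) ∈ V n} :=
            (Pred.measurable_mk.comp (by fun_prop : Measurable fun s : ℝ≥0 => (s, ω))) (hV n)
          have := lintegral_past_le (fun s => f ⟨s, ω⟩) n T
          refine le_trans (le_of_eq ?_) this
          rw [show {t | t ≤ T ∧ ∫⁻ u in Iio t, f ⟨u, ω⟩ ∂lebesgueNN ≤ n} =
            {s : ℝ≥0 | (⟨s, ω⟩ : Pred 𝓕) ∈ V n} ∩ Iic T by ext; simp [V, pastIntegral, and_comm],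
            ← Measure.restrict_restrict hVm, ← lintegral_indicator hVm]
          rfl
      _ = n := by simp
  have hstep : ∀ n, X n ≤ ENNReal.ofReal c * T + ρ * X n := by
    intro n
    have ht : ∀ t ∈ Iic T, density Q (D n) t ≤ ENNReal.ofReal c +
        L * ((∫⁻ y, ENNReal.ofReal (b y) ∂ν) *
        ∫⁻ s, absKernel h t s * density Q (D n) s ∂lebesgueNN) := by
      intro t ht
      have hw : Measurable (absKernel h t) := (measurable_absKernel hh).comp
        (by fun_prop : Measurable fun s : ℝ≥0 => (t, s))
      have := hP.campbell_prod (hD n) hw (β := fun y => ENNReal.ofReal (b y)) (by fun_prop)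
      change _ = _ * ∫⁻ s, absKernel h t s * density Q (D n) s ∂lebesgueNN at this
      rw [← this]
      calc density Q (D n) t = ∫⁻ ω, (V n).indicator f ⟨t, ω⟩ ∂Q :=
          lintegral_congr fun ω => hDd n t ω
        _ ≤ ∫⁻ ω, (ENNReal.ofReal c + L * ∫⁻ x, absKernel h t x.1 * ((D n).indicator 1
              (⟨x.1, ω⟩, x.2.1) * ENNReal.ofReal (b x.2.2)) ∂(P ω)) ∂Q := by
            refine lintegral_mono_ae ?_
            filter_upwards [ae_intensity_le hP hR hψL hψc hb0] with ω hω
            by_cases hz : (⟨t, ω⟩ : Pred 𝓕) ∈ V n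
            · rw [indicator_of_mem hz]
              refine (hω t ht).trans ?_
              refine add_le_add le_rfl (mul_le_mul' le_rfl (lintegral_mono fun x => ?_))
              by_cases hx : x.1 < t
              · have hxV : (⟨x.1, ω⟩ : Pred 𝓕) ∈ V n := (pastIntegral_mono f hx.le ω).trans hz
                refine mul_le_mul' le_rfl (mul_le_mul' ?_ le_rfl)
                by_cases hx2 : ((⟨x.1, ω⟩, x.2.1) : Pred 𝓕 × ℝ≥0) ∈ below 𝓕 lam
                · rw [indicator_of_mem hx2, indicator_of_mem (show _ ∈ D n from ⟨hx2, hxV⟩)]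
                · rw [indicator_of_notMem hx2]
                  exact zero_le
              · simp [absKernel, hx]
            · rw [indicator_of_notMem hz]
              exact zero_le
        _ ≤ _ := by
            rw [lintegral_add_left measurable_const, lintegral_const, measure_univ, mul_one,
              lintegral_const_mul' _ _ ENNReal.coe_ne_top]
    have hF : Measurable fun z : ℝ≥0 × ℝ≥0 => absKernel h z.1 z.2 * density Q (D n) z.2 :=
      (measurable_absKernel hh).mul ((measurable_density Q (hD n)).comp measurable_snd)
    calc X n ≤ ∫⁻ t in Iic T, (ENNReal.ofReal c + L * ((∫⁻ y, ENNReal.ofReal (b y) ∂ν) *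
          ∫⁻ s, absKernel h t s * density Q (D n) s ∂lebesgueNN)) ∂lebesgueNN :=
          setLIntegral_mono' measurableSet_Iic ht
      _ = ENNReal.ofReal c * T + L * ((∫⁻ y, ENNReal.ofReal (b y) ∂ν) *
          ∫⁻ s, (∫⁻ t in Iic T, absKernel h t s ∂lebesgueNN) * density Q (D n) s ∂lebesgueNN) := by
          rw [lintegral_add_left measurable_const, lintegral_const, Measure.restrict_apply_univ,
            lebesgueNN_Iic, lintegral_const_mul _ (hF.lintegral_prod_right'.const_mul _),
            lintegral_const_mul _ hF.lintegral_prod_right',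
                lintegral_lintegral_swap hF.aemeasurable]
          congr 3
          refine lintegral_congr fun s => ?_
          dsimp only
          rw [lintegral_mul_const _ (measurable_absKernel_left hh s)]
      _ ≤ ENNReal.ofReal c * T + L * ((∫⁻ y, ENNReal.ofReal (b y) ∂ν) *
          ∫⁻ s, (∫⁻ t in Iic T, ENNReal.ofReal |h t| ∂lebesgueNN) *
            (Iic T).indicator (density Q (D n)) s ∂lebesgueNN) := by
          refine add_le_add le_rfl (mul_le_mul' le_rfl (mul_le_mul' le_rfl
            (lintegral_mono fun s => ?_)))
          refine (mul_le_mul_left (lintegral_absKernel_le h T s) _).trans (le_of_eq ?_)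
          by_cases hs : s ∈ Iic T <;> simp [hs]
      _ = ENNReal.ofReal c * T + L * ((∫⁻ y, ENNReal.ofReal (b y) ∂ν) *
          ∫⁻ t in Iic T, ENNReal.ofReal |h t| ∂lebesgueNN) * X n := by
          rw [lintegral_const_mul _ ((measurable_density Q (hD n)).indicator measurableSet_Iic),
            lintegral_indicator measurableSet_Iic]
          ring
      _ ≤ _ := by gcongr
  have hXb : ∀ n, X n ≤ ENNReal.ofReal c * T / (1 - ρ) := fun n =>
    le_div_one_sub_of_le_add_mul ((hXn n).trans_lt (ENNReal.natCast_lt_top n)).ne hρ (hstep n)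
  calc ∫⁻ s in Iic T, density Q (below 𝓕 lam) s ∂lebesgueNN
      = ∫⁻ ω, ∫⁻ s in Iic T, f ⟨s, ω⟩ ∂lebesgueNN ∂Q := by
        simp only [density_below]
        exact lintegral_lintegral_swap (hf.comp Pred.measurable_mk).aemeasurable
    _ ≤ ∫⁻ ω, ⨆ n, ∫⁻ s in Iic T, (V n).indicator f ⟨s, ω⟩ ∂lebesgueNN ∂Q := by
        refine lintegral_mono_ae ?_
        filter_upwards [ae_lintegral_intensity_lt_top hP hR hψL hψc hb hb0 hh hhT] with ω hω
        obtain ⟨n, hn⟩ := ENNReal.exists_nat_gt hω.ne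
        refine le_trans (le_of_eq ?_) (le_iSup _ n)
        refine setLIntegral_congr_fun measurableSet_Iic fun s hs => ?_
        refine (indicator_of_mem (show (⟨s, ω⟩ : Pred 𝓕) ∈ V n from ?_) f).symm
        refine le_trans ?_ hn.le
        exact lintegral_mono_set fun u (hu : u < s) => hu.le.trans hs
    _ = ⨆ n, X n := by
        simp only [hX]
        refine lintegral_iSup (fun n => ?_) fun i j hij ω => ?_
        · have : Measurable fun z : Ω × ℝ≥0 => (V n).indicator f ⟨z.2, z.1⟩ :=
            (hfn n).comp measurable_swap
          exact this.lintegral_prod_right'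
        · refine lintegral_mono fun s => indicator_le_indicator_of_subset (fun z hz => ?_)
            (fun _ => zero_le) _
          exact le_trans (show pastIntegral f z ≤ i from hz) (by exact_mod_cast hij)
    _ ≤ _ := iSup_le hXb

end Stability

/-! ### Regularity of the kernel `h` -/

section Kernel

theorem lintegral_Iic_lebesgueNN (f : ℝ → ℝ≥0∞) (a : ℝ≥0) :
    ∫⁻ t in Iic a, f t ∂lebesgueNN = ∫⁻ t in Icc 0 (a : ℝ), f t := by
  have h := lintegral_lebesgueNN ((Iic (a : ℝ)).indicator f)
  rw [setLIntegral_indicator measurableSet_Iic, inter_comm, Ici_inter_Iic] at h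
  rw [← h, ← lintegral_indicator measurableSet_Iic]
  refine lintegral_congr fun t => ?_
  simp [indicator]

theorem lintegral_Iic_ofReal_abs {F : ℝ → ℝ} {a : ℝ≥0} (hF : IntegrableOn F (Icc 0 (a : ℝ))) :
    ∫⁻ t in Iic a, ENNReal.ofReal |F t| ∂lebesgueNN =
      ENNReal.ofReal (∫ t in (0 : ℝ)..a, |F t|) := by
  rw [lintegral_Iic_lebesgueNN fun t => ENNReal.ofReal |F t|,
    intervalIntegral.integral_of_le a.coe_nonneg, ← integral_Icc_eq_integral_Ioc,
    ofReal_integral_eq_lintegral_ofReal hF.abs (ae_of_all _ fun t => abs_nonneg _)]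

/-- The kernel of the discretisation, as a function of two times: `h((n-k)Δ)` for `t` in the bin
`n` and `s` in an earlier bin `k`. -/
noncomputable def stepKernel (h : ℝ → ℝ) (Δ t s : ℝ≥0) : ℝ :=
  if ⌈s / Δ⌉₊ < ⌈t / Δ⌉₊ then h (((⌈t / Δ⌉₊ : ℝ) - (⌈s / Δ⌉₊ : ℝ)) * Δ) else 0

/-- The error made by replacing the kernel of the Hawkes process by that of the discretisation. -/
noncomputable def kernelError (h : ℝ → ℝ) (Δ t s : ℝ≥0) : ℝ≥0∞ :=
  if s < t then ENNReal.ofReal |h ((t : ℝ) - s) - stepKernel h Δ t s| else 0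

theorem measurable_stepKernel {h : ℝ → ℝ} (hh : Measurable h) (Δ : ℝ≥0) :
    Measurable fun z : ℝ≥0 × ℝ≥0 => stepKernel h Δ z.1 z.2 := by
  have h1 : Measurable fun z : ℝ≥0 × ℝ≥0 => ⌈z.1 / Δ⌉₊ :=
    Nat.measurable_ceil.comp (measurable_fst.div_const Δ)
  have h2 : Measurable fun z : ℝ≥0 × ℝ≥0 => ⌈z.2 / Δ⌉₊ :=
    Nat.measurable_ceil.comp (measurable_snd.div_const Δ)
  have h3 : Measurable fun n : ℕ => (n : ℝ) := measurable_of_countable _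
  exact Measurable.ite (measurableSet_lt h2 h1)
    (hh.comp (((h3.comp h1).sub (h3.comp h2)).mul_const _)) measurable_const

theorem measurable_kernelError {h : ℝ → ℝ} (hh : Measurable h) (Δ : ℝ≥0) :
    Measurable fun z : ℝ≥0 × ℝ≥0 => kernelError h Δ z.1 z.2 := by
  refine Measurable.ite (measurableSet_lt measurable_snd measurable_fst) ?_ measurable_const
  have := measurable_stepKernel hh Δ
  fun_prop

theorem lebesgueNN_bin {Δ : ℝ≥0} (hΔ : 0 < Δ) {n : ℕ} (hn : n ≠ 0) :
    lebesgueNN {t | ⌈t / Δ⌉₊ = n} = Δ := by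
  have h1 : {t : ℝ≥0 | ⌈t / Δ⌉₊ = n} =
      (fun t : ℝ≥0 => (t : ℝ)) ⁻¹' (Ioc (((n - 1 : ℕ) : ℝ) * Δ) ((n : ℝ) * Δ)) := by
    ext t
    simp only [mem_ofPred_eq, Nat.ceil_eq_iff hn, lt_div_iff₀ hΔ, div_le_iff₀ hΔ, mem_preimage,
      mem_Ioc, ← NNReal.coe_lt_coe, ← NNReal.coe_le_coe, NNReal.coe_mul, NNReal.coe_natCast]
  rw [h1, lebesgueNN_preimage _ measurableSet_Ioc, inter_eq_left.2, Real.volume_Ioc]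
  · have : ((n - 1 : ℕ) : ℝ) = n - 1 := by
      rw [Nat.cast_sub (Nat.one_le_iff_ne_zero.2 hn), Nat.cast_one]
    rw [this, ← sub_mul, sub_sub_cancel, one_mul, ENNReal.ofReal_coe_nnreal]
  · exact fun x hx => (show (0 : ℝ) ≤ ((n - 1 : ℕ) : ℝ) * Δ by positivity).trans hx.1.le

theorem ceil_le_of_le {Δ T t : ℝ≥0} (hΔ : 0 < Δ) {M : ℕ} (hT : T = M * Δ) (ht : t ≤ T) :
    ⌈t / Δ⌉₊ ≤ M := by
  rw [Nat.ceil_le, div_le_iff₀ hΔ, ← hT]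
  exact ht

/-- The kernel of the discretisation is dominated, for a fixed past time, by the sum that defines
the discrete stability condition. -/
theorem lintegral_stepKernel_le (h : ℝ → ℝ) {Δ T : ℝ≥0} (hΔ : 0 < Δ) {M : ℕ}
    (hT : T = M * Δ) (s : ℝ≥0) :
    ∫⁻ t in Iic T, ENNReal.ofReal |stepKernel h Δ t s| ∂lebesgueNN ≤
      (Iic T).indicator 1 s *
        ∑ k ∈ Finset.Icc 1 M, ENNReal.ofReal |h ((k : ℝ) * Δ)| * Δ := by
  have hceil : Measurable fun t : ℝ≥0 => ⌈t / Δ⌉₊ :=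
    Nat.measurable_ceil.comp (measurable_id.div_const Δ)
  by_cases hsT : s ≤ T
  · rw [indicator_of_mem (show s ∈ Iic T from hsT), Pi.one_apply, one_mul]
    set m := ⌈s / Δ⌉₊
    calc ∫⁻ t in Iic T, ENNReal.ofReal |stepKernel h Δ t s| ∂lebesgueNN
        ≤ ∫⁻ t in Iic T, ∑ k ∈ Finset.Icc 1 M, ENNReal.ofReal |h ((k : ℝ) * Δ)| *
            {t : ℝ≥0 | ⌈t / Δ⌉₊ = m + k}.indicator 1 t ∂lebesgueNN := by
          refine setLIntegral_mono' measurableSet_Iic fun t ht => ?_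
          by_cases hlt : m < ⌈t / Δ⌉₊
          · have hM := ceil_le_of_le hΔ hT ht
            refine le_trans (le_of_eq ?_) (Finset.single_le_sum (fun _ _ => zero_le)
              (show ⌈t / Δ⌉₊ - m ∈ Finset.Icc 1 M from Finset.mem_Icc.2 ⟨by omega, by omega⟩))
            rw [indicator_of_mem (show _ ∈ {t : ℝ≥0 | ⌈t / Δ⌉₊ = m + (_ - m)} from
              show _ = _ by omega), Pi.one_apply, mul_one, stepKernel, if_pos hlt,
              Nat.cast_sub hlt.le]
          · have : stepKernel h Δ t s = 0 := if_neg hlt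
            simp [this]
      _ ≤ ∫⁻ t, ∑ k ∈ Finset.Icc 1 M, ENNReal.ofReal |h ((k : ℝ) * Δ)| *
            {t : ℝ≥0 | ⌈t / Δ⌉₊ = m + k}.indicator 1 t ∂lebesgueNN := setLIntegral_le_lintegral _ _
      _ = _ := by
          have hm : ∀ k, MeasurableSet {t : ℝ≥0 | ⌈t / Δ⌉₊ = m + k} := fun k =>
            hceil (measurableSet_singleton _)
          rw [lintegral_finsetSum _ fun k _ => (measurable_one.indicator (hm k)).const_mul _]
          refine Finset.sum_congr rfl fun k hk => ?_
          rw [lintegral_const_mul _ (measurable_one.indicator (hm k)),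
              lintegral_indicator_one (hm k),
            lebesgueNN_bin hΔ]
          have := (Finset.mem_Icc.1 hk).1
          omega
  · have : ∀ t ∈ Iic T, ENNReal.ofReal |stepKernel h Δ t s| = 0 := fun t ht => by
      have : ¬ ⌈s / Δ⌉₊ < ⌈t / Δ⌉₊ := not_lt.2 (Nat.ceil_mono (by
        gcongr; exact (show t ≤ T from ht).trans (not_le.1 hsT).le))
      simp [stepKernel, this]
    rw [setLIntegral_congr_fun measurableSet_Iic this]
    simp

theorem integrableOn_step {h : ℝ → ℝ} (hh : Measurable h) {Δ : ℝ} (hΔ : 0 < Δ) (a : ℝ) :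
    IntegrableOn (fun y => h ((⌊y / Δ⌋ : ℝ) * Δ + Δ)) (Icc 0 a) := by
  have hm : Measurable fun y : ℝ => h ((⌊y / Δ⌋ : ℝ) * Δ + Δ) := by
    have : Measurable fun y : ℝ => (⌊y / Δ⌋ : ℝ) :=
      (measurable_of_countable (fun n : ℤ => (n : ℝ))).comp
        (Int.measurable_floor.comp (by fun_prop))
    fun_prop
  refine Measure.integrableOn_of_bounded (M := ∑ k ∈ Finset.Icc 0 ⌊a / Δ⌋, |h ((k : ℝ) * Δ + Δ)|)
    (by simp) hm.aestronglyMeasurable ?_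
  rw [ae_restrict_iff' measurableSet_Icc]
  refine ae_of_all _ fun y hy => ?_
  refine Finset.single_le_sum (f := fun k : ℤ => |h ((k : ℝ) * Δ + Δ)|) (fun k _ => abs_nonneg _) ?_
  refine Finset.mem_Icc.2 ⟨Int.floor_nonneg.2 (div_nonneg hy.1 hΔ.le), Int.floor_mono ?_⟩
  gcongr
  exact hy.2

theorem integrableOn_shift {h : ℝ → ℝ} {T a ε : ℝ} (hT : IntegrableOn h (Icc 0 T)) (hε : 0 ≤ ε)
    (haε : a + ε ≤ T) : IntegrableOn (fun y => h (y + ε)) (Icc 0 a) := by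
  have h1 : IntegrableOn h (Icc (0 + ε) (a + ε)) :=
    hT.mono_set (Icc_subset_Icc (by linarith) haε)
  have := (measurePreserving_add_right volume ε).integrableOn_comp_preimage
    (measurableEmbedding_addRight ε) (f := h) (s := Icc (0 + ε) (a + ε))
  have h2 := this.2 h1
  rw [show (fun x => x + ε) ⁻¹' Icc (0 + ε) (a + ε) = Icc 0 a by ext; simp] at h2
  exact h2

theorem integral_shift_le_iSup {h : ℝ → ℝ} {T Δ : ℝ} (hΔ : 0 ≤ Δ) (hΔT : Δ ≤ T)
    (hT : IntegrableOn h (Icc 0 T)) {δ : ℝ} (hδ : δ ∈ Icc 0 Δ) :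
    ∫ y in (0 : ℝ)..(T - Δ), |h (y + δ) - h y| ≤
      ⨆ ε : Icc (0 : ℝ) Δ, ∫ y in (0 : ℝ)..(T - Δ), |h (y + (ε : ℝ)) - h y| := by
  have h0 : 0 ≤ T - Δ := by linarith
  have hi0 : IntegrableOn h (Icc 0 (T - Δ)) := hT.mono_set (Icc_subset_Icc le_rfl (by linarith))
  have hbdd : BddAbove (range fun ε : Icc (0 : ℝ) Δ =>
      ∫ y in (0 : ℝ)..(T - Δ), |h (y + (ε : ℝ)) - h y|) := by
    refine ⟨(∫ y in (0 : ℝ)..T, |h y|) + ∫ y in (0 : ℝ)..(T - Δ), |h y|, ?_⟩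
    rintro _ ⟨⟨ε, hε⟩, rfl⟩
    have hi1 : IntegrableOn (fun y => h (y + ε)) (Icc 0 (T - Δ)) :=
      integrableOn_shift hT hε.1 (by linarith [hε.2])
    have hI1 : IntervalIntegrable (fun y => |h (y + ε)|) volume 0 (T - Δ) :=
      ((intervalIntegrable_iff_integrableOn_Icc_of_le h0).2 hi1).abs
    have hI0 : IntervalIntegrable (fun y => |h y|) volume 0 (T - Δ) :=
      ((intervalIntegrable_iff_integrableOn_Icc_of_le h0).2 hi0).abs
    have hI : IntervalIntegrable (fun y => |h (y + ε) - h y|) volume 0 (T - Δ) :=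
      ((intervalIntegrable_iff_integrableOn_Icc_of_le h0).2 (hi1.sub hi0)).abs
    calc ∫ y in (0 : ℝ)..(T - Δ), |h (y + ε) - h y|
        ≤ ∫ y in (0 : ℝ)..(T - Δ), (|h (y + ε)| + |h y|) :=
          intervalIntegral.integral_mono_on h0 hI (hI1.add hI0) fun y _ => abs_sub _ _
      _ = (∫ y in (0 : ℝ)..(T - Δ), |h (y + ε)|) + ∫ y in (0 : ℝ)..(T - Δ), |h y| :=
          intervalIntegral.integral_add hI1 hI0
      _ ≤ _ := by
          gcongr
          rw [intervalIntegral.integral_comp_add_right (fun y => |h y|)]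
          refine intervalIntegral.integral_mono_interval (by linarith [hε.1]) (by linarith)
            (by linarith [hε.2]) (ae_of_all _ fun y => abs_nonneg _) ?_
          exact ((intervalIntegrable_iff_integrableOn_Icc_of_le (by linarith)).2 hT).abs
  exact le_ciSup hbdd ⟨δ, hδ⟩

/-- The total kernel error caused by a point at time `s`: at first, before the end of its bin, the
point does not contribute to the discrete intensity; afterwards the kernel is shifted to the end of
the bin and then discretised. -/
theorem lintegral_kernelError_le {h : ℝ → ℝ} (hh : Measurable h) {Δ T : ℝ≥0} (hΔ : 0 < Δ) {M : ℕ}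
    (hM : 1 ≤ M) (hT : T = M * Δ) (hhT : IntegrableOn h (Icc 0 (T : ℝ))) {s : ℝ≥0} (hs : s ≠ 0) :
    ∫⁻ t in Iic T, kernelError h Δ t s ∂lebesgueNN ≤
      (Iic T).indicator 1 s * ENNReal.ofReal (regularityConst h T Δ) := by
  by_cases hsT : s ≤ T
  swap
  · have : ∀ t ∈ Iic T, kernelError h Δ t s = 0 := fun t ht =>
      if_neg (not_lt.2 ((show t ≤ T from ht).trans (not_le.1 hsT).le))
    rw [setLIntegral_congr_fun measurableSet_Iic this]
    simp
  rw [indicator_of_mem (show s ∈ Iic T from hsT), Pi.one_apply, one_mul]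
  have hΔT : Δ ≤ T := by
    rw [hT]; exact le_mul_of_one_le_left zero_le (by exact_mod_cast hM)
  have hsub : ((T - Δ : ℝ≥0) : ℝ) = (T : ℝ) - Δ := NNReal.coe_sub hΔT
  set m := ⌈s / Δ⌉₊ with hm
  have hm1 : 1 ≤ m := Nat.ceil_pos.2 (div_pos (pos_iff_ne_zero.2 hs) hΔ)
  set E : ℝ≥0 := m * Δ with hE
  have hsE : s ≤ E := by rw [hE, ← div_le_iff₀ hΔ]; exact Nat.le_ceil _
  have hEs : E < s + Δ := by
    have h1 := Nat.ceil_lt_add_one (show 0 ≤ s / Δ from zero_le)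
    calc E = m * Δ := rfl
      _ < (s / Δ + 1) * Δ := by gcongr
      _ = s + Δ := by rw [add_mul, div_mul_cancel₀ _ hΔ.ne', one_mul]
  have hEΔ : Δ ≤ E := le_mul_of_one_le_left zero_le (by exact_mod_cast hm1)
  let δ : ℝ := (E : ℝ) - s
  have hδ : δ ∈ Icc (0 : ℝ) Δ := by
    have h1 : (s : ℝ) ≤ E := by exact_mod_cast hsE
    have h2 : (E : ℝ) < s + Δ := by exact_mod_cast hEs
    exact ⟨by simp only [δ]; linarith, by simp only [δ]; linarith⟩
  -- the three contributions
  have hI1 : ∫⁻ u in Iic Δ, ENNReal.ofReal |h u| ∂lebesgueNN =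
      ENNReal.ofReal (∫ y in (0 : ℝ)..Δ, |h y|) :=
    lintegral_Iic_ofReal_abs (hhT.mono_set (Icc_subset_Icc le_rfl (by exact_mod_cast hΔT)))
  have hi0 : IntegrableOn h (Icc 0 ((T - Δ : ℝ≥0) : ℝ)) :=
    hhT.mono_set (Icc_subset_Icc le_rfl (by rw [hsub]; linarith [Δ.2]))
  have hI2 : ∫⁻ u in Iic (T - Δ), ENNReal.ofReal |h (u + δ) - h u| ∂lebesgueNN =
      ENNReal.ofReal (∫ y in (0 : ℝ)..(T - Δ : ℝ), |h (y + δ) - h y|) := by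
    have hi := (integrableOn_shift (a := ((T - Δ : ℝ≥0) : ℝ)) hhT hδ.1
      (by rw [hsub]; linarith [hδ.2])).sub hi0
    rw [← hsub]
    exact lintegral_Iic_ofReal_abs (F := fun y => h (y + δ) - h y) hi
  have hI3 : ∫⁻ u in Iic (T - Δ), ENNReal.ofReal |h u - h ((⌈u / Δ⌉₊ : ℝ) * Δ)| ∂lebesgueNN =
      ENNReal.ofReal (∫ y in (0 : ℝ)..(T - Δ : ℝ), |h y - h ((⌊y / Δ⌋ : ℝ) * Δ + Δ)|) := by
    have hi := hi0.sub (integrableOn_step hh (show (0 : ℝ) < Δ from hΔ) ((T - Δ : ℝ≥0) : ℝ))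
    rw [← hsub, ← lintegral_Iic_ofReal_abs (F := fun y => h y - h ((⌊y / Δ⌋ : ℝ) * Δ + Δ)) hi]
    refine lintegral_congr_ae (ae_restrict_of_ae ?_)
    -- the two roundings differ only at the multiples of `Δ`
    have hcount : lebesgueNN (range fun n : ℕ => (n : ℝ≥0) * Δ) = 0 :=
      (countable_range _).measure_zero _
    filter_upwards [compl_mem_ae_iff.2 hcount] with u hu
    have hne : ∀ n : ℕ, u / Δ ≠ n := fun n hn => hu ⟨n, ((div_eq_iff hΔ.ne').1 hn).symm⟩
    have h1 : ⌈u / Δ⌉₊ = ⌊u / Δ⌋₊ + 1 := by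
      rw [Nat.ceil_eq_iff (by omega)]
      refine ⟨?_, by exact_mod_cast (Nat.lt_floor_add_one (u / Δ)).le⟩
      exact lt_of_le_of_ne (Nat.floor_le zero_le) (hne _).symm
    have h2 : (⌊(u : ℝ) / Δ⌋ : ℝ) = (⌊u / Δ⌋₊ : ℝ) := by
      rw [← NNReal.coe_div, ← natCast_floor_eq_intCast_floor (by positivity)]
      rfl
    rw [h1, h2]
    push_cast
    ring_nf
  calc ∫⁻ t in Iic T, kernelError h Δ t s ∂lebesgueNN
      ≤ ∫⁻ t, ((Ici s).indicator (fun t => (Iic E).indicator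
          (fun t => ENNReal.ofReal |h ((t : ℝ) - s)|) t) t +
          (Ici E).indicator (fun t => (Iic T).indicator (fun t => if E < t then
            ENNReal.ofReal |h ((t : ℝ) - s) - h (((⌈t / Δ⌉₊ : ℝ) - m) * Δ)| else 0) t) t)
              ∂lebesgueNN := by
        rw [← lintegral_indicator measurableSet_Iic]
        refine lintegral_mono fun t => ?_
        by_cases hst : s < t
        swap
        · rw [indicator_apply]
          simp [kernelError, hst]
        by_cases htT : t ≤ T
        swap
        · simp [htT]
        by_cases htE : t ≤ E
        · have : ¬ m < ⌈t / Δ⌉₊ := by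
            rw [not_lt, Nat.ceil_le, div_le_iff₀ hΔ]; exact htE
          refine le_trans (le_of_eq ?_) le_self_add
          simp [kernelError, stepKernel, hst, htT, htE, hst.le, ← hm, this]
        · have : m < ⌈t / Δ⌉₊ := by
            rw [Nat.lt_ceil, lt_div_iff₀ hΔ]; exact not_le.1 htE
          refine le_trans (le_of_eq ?_) le_add_self
          simp [kernelError, stepKernel, hst, htT, (not_le.1 htE).le, not_le.1 htE, ← hm, this]
    _ = ∫⁻ t in Ici s, (Iic E).indicator (fun t => ENNReal.ofReal |h ((t : ℝ) - s)|) t ∂lebesgueNN +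
        ∫⁻ t in Ici E, (Iic T).indicator (fun t => if E < t then
            ENNReal.ofReal |h ((t : ℝ) - s) - h (((⌈t / Δ⌉₊ : ℝ) - m) * Δ)| else 0) t
              ∂lebesgueNN := by
        rw [lintegral_add_left, lintegral_indicator measurableSet_Ici,
          lintegral_indicator measurableSet_Ici]
        exact Measurable.indicator (Measurable.indicator (by fun_prop) measurableSet_Iic)
          measurableSet_Ici
    _ ≤ ∫⁻ u in Iic Δ, ENNReal.ofReal |h u| ∂lebesgueNN +
        ∫⁻ u in Iic (T - Δ), (ENNReal.ofReal |h (u + δ) - h u| +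
          ENNReal.ofReal |h u - h ((⌈u / Δ⌉₊ : ℝ) * Δ)|) ∂lebesgueNN := by
        rw [setLIntegral_Ici_lebesgueNN, setLIntegral_Ici_lebesgueNN,
          ← lintegral_indicator measurableSet_Iic, ← lintegral_indicator measurableSet_Iic]
        refine add_le_add (lintegral_mono fun u => ?_) (lintegral_mono fun u => ?_)
        · by_cases hu : u + s ≤ E
          · have huΔ : u ≤ Δ := by
              have := hu.trans hEs.le
              rw [add_comm] at this
              exact le_of_add_le_add_left this
            rw [indicator_of_mem (show u + s ∈ Iic E from hu),
              indicator_of_mem (show u ∈ Iic Δ from huΔ)]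
            simp
          · rw [indicator_of_notMem (show u + s ∉ Iic E from hu)]
            exact zero_le
        · by_cases hu : u + E ≤ T
          · have huΔ : u ≤ T - Δ := le_tsub_of_add_le_right ((add_le_add le_rfl hEΔ).trans hu)
            rw [indicator_of_mem (show u + E ∈ Iic T from hu),
              indicator_of_mem (show u ∈ Iic (T - Δ) from huΔ)]
            split_ifs
            · have h1 : ⌈(u + E) / Δ⌉₊ = ⌈u / Δ⌉₊ + m := by
                rw [add_div, hE, mul_div_cancel_right₀ _ hΔ.ne', Nat.ceil_add_natCast zero_le]
              rw [h1, ← ENNReal.ofReal_add (abs_nonneg _) (abs_nonneg _)]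
              refine ENNReal.ofReal_le_ofReal ?_
              push_cast
              rw [add_sub_cancel_right, show (u : ℝ) + E - s = u + δ by simp only [δ]; ring]
              exact abs_sub_le _ _ _
            · exact zero_le
          · rw [indicator_of_notMem (show u + E ∉ Iic T from hu)]
            exact zero_le
    _ = ENNReal.ofReal (∫ y in (0 : ℝ)..Δ, |h y|) +
        (ENNReal.ofReal (∫ y in (0 : ℝ)..(T - Δ : ℝ), |h (y + δ) - h y|) +
          ENNReal.ofReal (∫ y in (0 : ℝ)..(T - Δ : ℝ), |h y - h ((⌊y / Δ⌋ : ℝ) * Δ + Δ)|)) := by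
        rw [lintegral_add_left (by fun_prop), hI1, hI2, hI3]
    _ ≤ ENNReal.ofReal (regularityConst h T Δ) := by
        have h0 : (0 : ℝ) ≤ (T : ℝ) - Δ := hsub ▸ NNReal.coe_nonneg _
        rw [← ENNReal.ofReal_add, ← ENNReal.ofReal_add]
        · refine ENNReal.ofReal_le_ofReal ?_
          rw [regularityConst, ← add_assoc]
          gcongr
          exact integral_shift_le_iSup Δ.2 (by exact_mod_cast hΔT) hhT hδ
        · exact intervalIntegral.integral_nonneg Δ.2 fun _ _ => abs_nonneg _
        · exact add_nonneg (intervalIntegral.integral_nonneg h0 fun _ _ => abs_nonneg _)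
            (intervalIntegral.integral_nonneg h0 fun _ _ => abs_nonneg _)
        · exact intervalIntegral.integral_nonneg h0 fun _ _ => abs_nonneg _
        · exact intervalIntegral.integral_nonneg h0 fun _ _ => abs_nonneg _

end Kernel

/-! ### Comparison of the two intensities -/

/-- No integrability is needed: if only one of the functions is integrable then the right-hand side
is infinite, and if none of them is then the left-hand side vanishes. -/
theorem enorm_integral_sub_integral_le {α : Type*} [MeasurableSpace α] {μ : Measure α} {f g : α → ℝ}
    (hf : AEStronglyMeasurable f μ) (hg : AEStronglyMeasurable g μ) :
    ‖∫ x, f x ∂μ - ∫ x, g x ∂μ‖ₑ ≤ ∫⁻ x, ‖f x - g x‖ₑ ∂μ := by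
  by_cases hi : ∫⁻ x, ‖f x - g x‖ₑ ∂μ = ∞
  · rw [hi]; exact le_top
  have hfg : Integrable (fun x => f x - g x) μ := ⟨hf.sub hg, lt_top_iff_ne_top.2 hi⟩
  by_cases hgi : Integrable g μ
  · have hfi : Integrable f μ := (hfg.add hgi).congr (ae_of_all _ fun x => by simp)
    rw [← integral_sub hfi hgi]
    exact enorm_integral_le_lintegral_enorm _
  · have hfi : ¬ Integrable f μ := fun hfi => hgi <|
      (hfi.sub hfg).congr (ae_of_all _ fun x => by simp)
    simp [integral_undef hgi, integral_undef hfi]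

section Comparison

variable {Ω : Type*} [mΩ : MeasurableSpace Ω] {P : Ω → Measure Point} {ν : Measure ℝ}
  [IsProbabilityMeasure ν] {Q : Measure Ω}
  {ψ h b : ℝ → ℝ} {L : ℝ≥0} {c : ℝ} {T Δ : ℝ≥0} {R lam : ℝ≥0 → Ω → ℝ}

theorem mem_binBelow_iff (hΔ : 0 < Δ) {k : ℕ} (hk : k ≠ 0) {l : ℝ} {x : Point} :
    x ∈ binBelow Δ k l ↔ ⌈x.1 / Δ⌉₊ = k ∧ (x.2.1 : ℝ) ≤ l := by
  rw [Nat.ceil_eq_iff hk, binBelow, mem_ofPred_eq, lt_div_iff₀ hΔ, div_le_iff₀ hΔ, and_assoc]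

theorem measurableSet_ceil_eq (Δ : ℝ≥0) (k : ℕ) : MeasurableSet {s : ℝ≥0 | ⌈s / Δ⌉₊ = k} :=
  (Nat.measurable_ceil.comp (measurable_id.div_const Δ)) (measurableSet_singleton k)

/-- A sum over the points accepted in the `k`-th bin is the integral of a predictable integrand. -/
theorem setLIntegral_binBelow {𝓕 : Filtration ℝ≥0 mΩ} (hΔ : 0 < Δ) {k : ℕ} (hk : k ≠ 0)
    (p : Measure Point) (f : ℝ → ℝ≥0∞) (ω : Ω) :
    ∫⁻ x in binBelow Δ k (discreteIntensity ψ h b Δ (tame Δ (P ω)) k), f x.2.2 ∂p =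
      ∫⁻ x, {s : ℝ≥0 | ⌈s / Δ⌉₊ = k}.indicator 1 x.1 *
        ((below 𝓕 (stepIntensity P ψ h b Δ)).indicator 1 (⟨x.1, ω⟩, x.2.1) * f x.2.2) ∂p := by
  rw [← lintegral_indicator (measurableSet_binBelow _ _ _)]
  refine lintegral_congr fun x => ?_
  by_cases hx : ⌈x.1 / Δ⌉₊ = k
  · by_cases hx2 : (x.2.1 : ℝ) ≤ discreteIntensity ψ h b Δ (tame Δ (P ω)) k
    · rw [indicator_of_mem ((mem_binBelow_iff hΔ hk).2 ⟨hx, hx2⟩),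
        indicator_of_mem (show x.1 ∈ {s : ℝ≥0 | ⌈s / Δ⌉₊ = k} from hx), indicator_of_mem]
      · simp
      · change (x.2.1 : ℝ) ≤ discreteIntensity ψ h b Δ (tame Δ (P ω)) ⌈x.1 / Δ⌉₊
        rwa [hx]
    · rw [indicator_of_notMem fun h => hx2 ((mem_binBelow_iff hΔ hk).1 h).2,
        indicator_of_notMem (s := below 𝓕 _)]
      · simp
      · change ¬ (x.2.1 : ℝ) ≤ discreteIntensity ψ h b Δ (tame Δ (P ω)) ⌈x.1 / Δ⌉₊
        rwa [hx]
  · rw [indicator_of_notMem fun h => hx ((mem_binBelow_iff hΔ hk).1 h).1,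
      indicator_of_notMem (show x.1 ∉ {s : ℝ≥0 | ⌈s / Δ⌉₊ = k} from hx), zero_mul]

theorem IsPoissonRandomMeasure.aemeasurable_lintegral
    (hP : IsPoissonRandomMeasure P (intensityMeasure ν) Q)
    {H : Ω × Point → ℝ≥0∞} (hH : Measurable H) :
    AEMeasurable (fun ω => ∫⁻ x, H (ω, x) ∂(P ω)) Q := by
  obtain ⟨κ, _, hκ⟩ := hP.exists_kernel
  refine ⟨fun ω => ∫⁻ x, H (ω, x) ∂(κ ω), hH.lintegral_kernel_prod_right', ?_⟩
  filter_upwards [hκ] with ω hω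
  rw [hω]

theorem measurable_integrand {𝓕 : Filtration ℝ≥0 mΩ}
    {D : Set (Pred 𝓕 × ℝ≥0)} (hD : MeasurableSet D) {w : ℝ≥0 → ℝ≥0∞} (hw : Measurable w)
    {β : ℝ → ℝ≥0∞} (hβ : Measurable β) :
    Measurable fun z : Ω × Point => w z.2.1 *
      (D.indicator 1 ((⟨z.2.1, z.1⟩, z.2.2.1) : Pred 𝓕 × ℝ≥0) * β z.2.2.2) := by
  have h1 : Measurable fun z : Ω × Point => D.indicator (1 : Pred 𝓕 × ℝ≥0 → ℝ≥0∞)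
      (⟨z.2.1, z.1⟩, z.2.2.1) :=
    (measurable_one.indicator hD).comp (Pred.measurable_mk_prod.comp
      (by fun_prop : Measurable fun z : Ω × Point => ((z.2.1, z.1), z.2.2.1)))
  exact (hw.comp (by fun_prop)).mul (h1.mul (by fun_prop))

theorem LipschitzWith.measurable_real (hψL : LipschitzWith L ψ) : Measurable ψ :=
  hψL.continuous.measurable

variable [IsProbabilityMeasure Q]

/-- The thinned sums with integrable marks are almost surely finite. -/
theorem ae_lintegral_accepted_lt_top (hP : IsPoissonRandomMeasure P (intensityMeasure ν) Q)
    {D : Set (Pred (pointFiltration P hP.measurable) × ℝ≥0)} (hD : MeasurableSet D)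
    (hfin : ∫⁻ s in Iic T, density Q D s ∂lebesgueNN < ∞) {β : ℝ → ℝ≥0∞} (hβ : Measurable β)
    (hβν : ∫⁻ y, β y ∂ν < ∞) :
    ∀ᵐ ω ∂Q, ∫⁻ x, (Iic T).indicator 1 x.1 *
      (D.indicator 1 (⟨x.1, ω⟩, x.2.1) * β x.2.2) ∂(P ω) < ∞ := by
  have hw : Measurable ((Iic T).indicator (1 : ℝ≥0 → ℝ≥0∞)) :=
    measurable_one.indicator measurableSet_Iic
  refine ae_lt_top' (hP.aemeasurable_lintegral (measurable_integrand hD hw hβ)) ?_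
  rw [hP.campbell_prod hD hw hβ]
  refine ENNReal.mul_ne_top hβν.ne ?_
  change ∫⁻ s, (Iic T).indicator 1 s * density Q D s ∂lebesgueNN ≠ ∞
  have : ∀ s, (Iic T).indicator 1 s * density Q D s = (Iic T).indicator (density Q D) s :=
      fun s => by
    by_cases hs : s ∈ Iic T <;> simp [hs]
  simp only [this]
  rw [lintegral_indicator measurableSet_Iic]
  exact hfin.ne

/-- By induction on the bins, without any stability condition; the bound is not uniform. -/
theorem lintegral_discreteIntensity_lt_top (hP : IsPoissonRandomMeasure P (intensityMeasure ν) Q)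
    (hψL : LipschitzWith L ψ) (hψc : ψ 0 ≤ c) (hb : Measurable b) (hb0 : ∀ y, 0 ≤ b y)
    (hbν : ∫⁻ y, ENNReal.ofReal (b y) ∂ν < ∞) (hΔ : 0 < Δ) (n : ℕ) :
    ∫⁻ ω, ENNReal.ofReal (discreteIntensity ψ h b Δ (tame Δ (P ω)) n) ∂Q < ∞ := by
  set 𝓕 := pointFiltration P hP.measurable
  have hstep := measurable_stepIntensity (h := h) hP.measurable
    (LipschitzWith.measurable_real hψL) hb hb0 hΔ
  have hD : MeasurableSet (below 𝓕 (stepIntensity P ψ h b Δ)) := measurableSet_below hstep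
  induction n using Nat.strong_induction_on with
  | _ n ih =>
  have hk : ∀ k ∈ Finset.Ico 1 n, ∫⁻ ω, ∫⁻ x in binBelow Δ k
      (discreteIntensity ψ h b Δ (tame Δ (P ω)) k), ENNReal.ofReal (b x.2.2) ∂(P ω) ∂Q < ∞ := by
    intro k hk
    have hk0 : k ≠ 0 := by have := (Finset.mem_Ico.1 hk).1; omega
    simp only [fun ω => setLIntegral_binBelow (P := P) (ψ := ψ) (h := h) (b := b) (𝓕 := 𝓕) hΔ hk0
      (P ω) (fun y => ENNReal.ofReal (b y)) ω]
    have hmk := measurableSet_ceil_eq Δ k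
    rw [hP.campbell_prod hD (measurable_one.indicator hmk) (β := fun y => ENNReal.ofReal (b y))
      (by fun_prop)]
    refine ENNReal.mul_lt_top hbν ?_
    calc ∫⁻ s, {s : ℝ≥0 | ⌈s / Δ⌉₊ = k}.indicator 1 s *
          density Q (below 𝓕 (stepIntensity P ψ h b Δ)) s ∂lebesgueNN
        = ∫⁻ s, {s : ℝ≥0 | ⌈s / Δ⌉₊ = k}.indicator 1 s *
          ∫⁻ ω, ENNReal.ofReal (discreteIntensity ψ h b Δ (tame Δ (P ω)) k) ∂Q ∂lebesgueNN := by
          refine lintegral_congr fun s => ?_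
          by_cases hs : ⌈s / Δ⌉₊ = k
          · rw [density_below]
            simp only [stepIntensity, hs]
          · rw [indicator_of_notMem (show s ∉ {s : ℝ≥0 | ⌈s / Δ⌉₊ = k} from hs), zero_mul, zero_mul]
      _ = Δ * ∫⁻ ω, ENNReal.ofReal (discreteIntensity ψ h b Δ (tame Δ (P ω)) k) ∂Q := by
          rw [lintegral_mul_const _ (measurable_one.indicator hmk), lintegral_indicator_one hmk,
            lebesgueNN_bin hΔ hk0]
      _ < ∞ := ENNReal.mul_lt_top ENNReal.coe_lt_top (ih k (Finset.mem_Ico.1 hk).2)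
  calc ∫⁻ ω, ENNReal.ofReal (discreteIntensity ψ h b Δ (tame Δ (P ω)) n) ∂Q
      ≤ ∫⁻ ω, (ENNReal.ofReal c + L * ∑ k ∈ Finset.Ico 1 n, ‖h (((n : ℝ) - (k : ℝ)) * (Δ : ℝ))‖ₑ *
          ∫⁻ x in binBelow Δ k (discreteIntensity ψ h b Δ (tame Δ (P ω)) k),
            ENNReal.ofReal (b x.2.2) ∂(P ω)) ∂Q := by
        refine lintegral_mono_ae ?_
        filter_upwards [hP.ae_tame hΔ] with ω hω
        rw [hω, discreteIntensity_eq]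
        refine (ofReal_le_of_lipschitz hψL hψc _).trans ?_
        gcongr
        refine (enorm_sum_le _ _).trans (Finset.sum_le_sum fun k _ => ?_)
        rw [enorm_mul]
        gcongr
        refine (enorm_integral_le_lintegral_enorm _).trans (lintegral_mono fun x => ?_)
        rw [Real.enorm_of_nonneg (hb0 _)]
    _ = ENNReal.ofReal c + L * ∑ k ∈ Finset.Ico 1 n, ‖h (((n : ℝ) - (k : ℝ)) * (Δ : ℝ))‖ₑ *
          ∫⁻ ω, ∫⁻ x in binBelow Δ k (discreteIntensity ψ h b Δ (tame Δ (P ω)) k),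
            ENNReal.ofReal (b x.2.2) ∂(P ω) ∂Q := by
        rw [lintegral_add_left measurable_const, lintegral_const, measure_univ, mul_one,
          lintegral_const_mul' _ _ ENNReal.coe_ne_top, lintegral_finsetSum']
        · congr 2
          exact Finset.sum_congr rfl fun k _ => lintegral_const_mul' _ _ enorm_ne_top
        · intro k hk
          have hk0 : k ≠ 0 := by have := (Finset.mem_Ico.1 hk).1; omega
          simp only [fun ω => setLIntegral_binBelow (P := P) (ψ := ψ) (h := h) (b := b)
              (𝓕 := 𝓕) hΔ hk0
            (P ω) (fun y => ENNReal.ofReal (b y)) ω]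
          exact (hP.aemeasurable_lintegral (measurable_integrand hD
            (measurable_one.indicator (measurableSet_ceil_eq Δ k))
            (β := fun y => ENNReal.ofReal (b y)) (by fun_prop))).const_mul _
    _ < ∞ := by
        refine ENNReal.add_lt_top.2 ⟨ENNReal.ofReal_lt_top,
          ENNReal.mul_lt_top ENNReal.coe_lt_top (ENNReal.sum_lt_top.2 fun k hk' => ?_)⟩
        exact ENNReal.mul_lt_top enorm_lt_top (hk k hk')

theorem lintegral_stepIntensity_lt_top (hP : IsPoissonRandomMeasure P (intensityMeasure ν) Q)
    (hψL : LipschitzWith L ψ) (hψc : ψ 0 ≤ c) (hb : Measurable b) (hb0 : ∀ y, 0 ≤ b y)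
    (hbν : ∫⁻ y, ENNReal.ofReal (b y) ∂ν < ∞) (hΔ : 0 < Δ) (T : ℝ≥0) :
    ∫⁻ s in Iic T, density Q (below (pointFiltration P hP.measurable) (stepIntensity P ψ h b Δ)) s
      ∂lebesgueNN < ∞ := by
  let e : ℕ → ℝ≥0∞ := fun k => ∫⁻ ω, ENNReal.ofReal (discreteIntensity ψ h b Δ (tame Δ (P ω)) k) ∂Q
  calc _ ≤ ∫⁻ s in Iic T, ∑ k ∈ Finset.range (⌈T / Δ⌉₊ + 1), e k ∂lebesgueNN := by
        refine setLIntegral_mono' measurableSet_Iic fun s hs => ?_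
        rw [density_below]
        refine Finset.single_le_sum (f := e) (fun _ _ => zero_le)
          (Finset.mem_range.2 (Nat.lt_succ_of_le (Nat.ceil_mono ?_)))
        gcongr
        exact hs
    _ = (∑ k ∈ Finset.range (⌈T / Δ⌉₊ + 1), e k) * T := by
        rw [lintegral_const, Measure.restrict_apply_univ, lebesgueNN_Iic]
    _ < ∞ := ENNReal.mul_lt_top (ENNReal.sum_lt_top.2 fun k _ =>
        lintegral_discreteIntensity_lt_top hP hψL hψc hb hb0 hbν hΔ k) ENNReal.coe_lt_top

/-- The two intensities differ through the kernel error at the accepted points of the Hawkes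
process, and through the points that are accepted by exactly one of the two processes. -/
theorem ae_intensity_sub_le (hP : IsPoissonRandomMeasure P (intensityMeasure ν) Q)
    (hR : IsHawkesRisk Q P hP.measurable ψ h b T R lam)
    (hψL : LipschitzWith L ψ) (hψc : ψ 0 ≤ c) (hb : Measurable b) (hb0 : ∀ y, 0 ≤ b y)
    (hbν : ∫⁻ y, ENNReal.ofReal (b y) ∂ν < ∞) (hh : Measurable h) (hΔ : 0 < Δ)
    {M : ℕ} (hT : T = M * Δ) :
    ∀ᵐ ω ∂Q, ∀ t ≤ T, ENNReal.ofReal |lam t ω - stepIntensity P ψ h b Δ t ω| ≤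
      L * (∫⁻ x, kernelError h Δ t x.1 *
          ((below (pointFiltration P hP.measurable) lam).indicator 1 (⟨x.1, ω⟩, x.2.1) *
            ENNReal.ofReal (b x.2.2)) ∂(P ω) +
        ∫⁻ x, ENNReal.ofReal |stepKernel h Δ t x.1| *
          ((between (pointFiltration P hP.measurable) lam (stepIntensity P ψ h b Δ)).indicator 1
            (⟨x.1, ω⟩, x.2.1) * ENNReal.ofReal (b x.2.2)) ∂(P ω)) := by
  set 𝓕 := pointFiltration P hP.measurable
  have hlam : Measurable fun z : Pred 𝓕 => lam z.time z.outcome :=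
    IsStronglyPredictable.measurable_pred hR.predictable
  have hstep : Measurable fun z : Pred 𝓕 => stepIntensity P ψ h b Δ z.time z.outcome :=
    measurable_stepIntensity hP.measurable (LipschitzWith.measurable_real hψL) hb hb0 hΔ
  have hD := measurableSet_below hstep
  filter_upwards [hR.intensity_eq, hP.ae_tame hΔ, hP.ae_time_zero,
    ae_lintegral_accepted_lt_top hP hD
      (lintegral_stepIntensity_lt_top (h := h) hP hψL hψc hb hb0 hbν hΔ T)
      (β := fun y => ENNReal.ofReal (b y)) (by fun_prop) hbν] with ω h1 htame h0 hfin t ht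
  have hmkω : Measurable fun x : Point => (⟨x.1, ω⟩ : Pred 𝓕) :=
    Pred.measurable_mk.comp (by fun_prop : Measurable fun x : Point => (x.1, ω))
  set n := ⌈t / Δ⌉₊ with hn
  have hnM : n ≤ M := ceil_le_of_le hΔ hT ht
  let lb : ℝ≥0 → ℝ := fun s => discreteIntensity ψ h b Δ (P ω) ⌈s / Δ⌉₊
  have hlb : ∀ s, stepIntensity P ψ h b Δ s ω = lb s := fun s => by
    simp only [stepIntensity, htame, lb]
  have hlamω : Measurable fun x : Point => lam x.1 ω := hlam.comp hmkω
  -- both intensities are values of `ψ` at integrals of functions `f` and `∑ g k` for `P ω`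
  let S₁ : Set Point := {x | x.1 < t ∧ (x.2.1 : ℝ) ≤ lam x.1 ω}
  have hS₁ : MeasurableSet S₁ := (measurableSet_lt measurable_fst measurable_const).inter
    (measurableSet_le (f := fun x : Point => (x.2.1 : ℝ)) (by fun_prop) hlamω)
  let f : Point → ℝ := S₁.indicator fun x => h ((t : ℝ) - (x.1 : ℝ)) * b x.2.2
  have hf : Measurable f := Measurable.indicator (by fun_prop) hS₁
  let g : ℕ → Point → ℝ := fun k => (binBelow Δ k (discreteIntensity ψ h b Δ (P ω) k)).indicator
    fun x => h (((n : ℝ) - (k : ℝ)) * (Δ : ℝ)) * b x.2.2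
  have hg : ∀ k, Measurable (g k) := fun k =>
    Measurable.indicator (by fun_prop) (measurableSet_binBelow _ _ _)
  have hgi : ∀ k ∈ Finset.Ico 1 n, Integrable (g k) (P ω) := by
    intro k hk
    obtain ⟨hk1, hkn⟩ := Finset.mem_Ico.1 hk
    refine (integrable_indicator_iff (measurableSet_binBelow _ _ _)).2 (Integrable.const_mul ?_ _)
    refine ⟨(by fun_prop : Measurable fun x : Point => b x.2.2).aestronglyMeasurable, ?_⟩
    rw [HasFiniteIntegral]
    simp only [Real.enorm_of_nonneg (hb0 _)]
    have h2 := setLIntegral_binBelow (P := P) (ψ := ψ) (h := h) (b := b) (𝓕 := 𝓕) hΔ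
      (show k ≠ 0 by omega) (P ω) (fun y => ENNReal.ofReal (b y)) ω
    rw [htame] at h2
    rw [h2]
    refine lt_of_le_of_lt (lintegral_mono fun x => mul_le_mul_left ?_ _) hfin
    refine indicator_le_indicator_of_subset (fun s hs => ?_) (fun _ => zero_le) _
    have hs : ⌈s / Δ⌉₊ = k := hs
    have : s / Δ ≤ M := (Nat.le_ceil _).trans (by rw [hs]; exact_mod_cast (hkn.le.trans hnM))
    rw [div_le_iff₀ hΔ, ← hT] at this
    exact this
  have e1 : lam t ω = ψ (∫ x, f x ∂(P ω)) := by
    rw [h1 t ht, integral_indicator hS₁]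
  have e2 : stepIntensity P ψ h b Δ t ω = ψ (∫ x, ∑ k ∈ Finset.Ico 1 n, g k x ∂(P ω)) := by
    rw [hlb, integral_finsetSum _ hgi]
    simp only [lb]
    rw [discreteIntensity_eq]
    congr 1
    refine Finset.sum_congr rfl fun k _ => ?_
    rw [integral_indicator (measurableSet_binBelow _ _ _), integral_const_mul]
  have e3 : ENNReal.ofReal |lam t ω - stepIntensity P ψ h b Δ t ω| ≤
      L * ‖∫ x, f x ∂(P ω) - ∫ x, ∑ k ∈ Finset.Ico 1 n, g k x ∂(P ω)‖ₑ := by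
    rw [e1, e2]
    have := hψL.edist_le_mul (∫ x, f x ∂(P ω)) (∫ x, ∑ k ∈ Finset.Ico 1 n, g k x ∂(P ω))
    rwa [edist_eq_enorm_sub, edist_eq_enorm_sub, Real.enorm_eq_ofReal_abs] at this
  have hm1 : Measurable fun x : Point => kernelError h Δ t x.1 *
      ((below 𝓕 lam).indicator 1 ((⟨x.1, ω⟩, x.2.1) : Pred 𝓕 × ℝ≥0) *
          ENNReal.ofReal (b x.2.2)) := by
    refine ((measurable_kernelError hh Δ).comp
      (by fun_prop : Measurable fun x : Point => (t, x.1))).mul ?_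
    exact (measurable_indicator_section (measurableSet_below hlam) ω).mul (by fun_prop)
  rw [← lintegral_add_left hm1]
  refine e3.trans (mul_le_mul' le_rfl ?_)
  refine (enorm_integral_sub_integral_le hf.aestronglyMeasurable
    (Finset.measurable_sum _ fun k _ => hg k).aestronglyMeasurable).trans ?_
  refine lintegral_mono_ae ?_
  have h0' : ∀ᵐ x ∂(P ω), x.1 ≠ 0 := by
    rw [ae_iff]; simpa using h0
  filter_upwards [h0'] with x hx0
  -- only the bin of `x` contributes to the sum
  have hsum : ∑ k ∈ Finset.Ico 1 n, g k x =
      stepKernel h Δ t x.1 * if (x.2.1 : ℝ) ≤ lb x.1 then b x.2.2 else 0 := by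
    have hx1 : 1 ≤ ⌈x.1 / Δ⌉₊ := Nat.ceil_pos.2 (div_pos (pos_iff_ne_zero.2 hx0) hΔ)
    have hgx : ∀ k ∈ Finset.Ico 1 n, g k x = if k = ⌈x.1 / Δ⌉₊ then
        h (((n : ℝ) - (⌈x.1 / Δ⌉₊ : ℝ)) * (Δ : ℝ)) *
          (if (x.2.1 : ℝ) ≤ lb x.1 then b x.2.2 else 0) else 0 := by
      intro k hk
      have hk0 : k ≠ 0 := by have := (Finset.mem_Ico.1 hk).1; omega
      by_cases hkx : k = ⌈x.1 / Δ⌉₊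
      · rw [if_pos hkx]
        by_cases hl : (x.2.1 : ℝ) ≤ lb x.1
        · rw [if_pos hl, ← hkx]
          exact indicator_of_mem ((mem_binBelow_iff hΔ hk0).2 ⟨hkx.symm, by rw [hkx]; exact hl⟩) _
        · rw [if_neg hl, mul_zero]
          exact indicator_of_notMem
            (fun hx => hl (by have := ((mem_binBelow_iff hΔ hk0).1 hx).2; rwa [hkx] at this)) _
      · rw [if_neg hkx]
        exact indicator_of_notMem (fun hx => hkx ((mem_binBelow_iff hΔ hk0).1 hx).1.symm) _
    rw [Finset.sum_congr rfl hgx, Finset.sum_ite_eq', stepKernel]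
    by_cases hlt : ⌈x.1 / Δ⌉₊ < ⌈t / Δ⌉₊
    · rw [if_pos hlt, if_pos (Finset.mem_Ico.2 ⟨hx1, hlt⟩)]
    · rw [if_neg hlt, if_neg (fun h => hlt (Finset.mem_Ico.1 h).2), zero_mul]
  rw [hsum]
  have hb' : ‖b x.2.2‖ₑ = ENNReal.ofReal (b x.2.2) := Real.enorm_of_nonneg (hb0 _)
  have hbet : ((⟨x.1, ω⟩, x.2.1) : Pred 𝓕 × ℝ≥0) ∈ between 𝓕 lam (stepIntensity P ψ h b Δ) ↔
      Xor ((x.2.1 : ℝ) ≤ lam x.1 ω) ((x.2.1 : ℝ) ≤ lb x.1) := by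
    rw [← hlb]; rfl
  have hbel : ((⟨x.1, ω⟩, x.2.1) : Pred 𝓕 × ℝ≥0) ∈ below 𝓕 lam ↔ (x.2.1 : ℝ) ≤ lam x.1 ω := Iff.rfl
  have hI₁ : (below 𝓕 lam).indicator (1 : Pred 𝓕 × ℝ≥0 → ℝ≥0∞) (⟨x.1, ω⟩, x.2.1) =
      if (x.2.1 : ℝ) ≤ lam x.1 ω then 1 else 0 := by
    split_ifs with ha
    · exact indicator_of_mem (hbel.2 ha) _
    · exact indicator_of_notMem (mt hbel.1 ha) _
  have hI₂ : (between 𝓕 lam (stepIntensity P ψ h b Δ)).indicator (1 : Pred 𝓕 × ℝ≥0 → ℝ≥0∞)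
      (⟨x.1, ω⟩, x.2.1) =
      if Xor ((x.2.1 : ℝ) ≤ lam x.1 ω) ((x.2.1 : ℝ) ≤ lb x.1) then 1 else 0 := by
    split_ifs with ha
    · exact indicator_of_mem (hbet.2 ha) _
    · exact indicator_of_notMem (mt hbet.1 ha) _
  have hfx : f x = if x.1 < t ∧ (x.2.1 : ℝ) ≤ lam x.1 ω then
      h ((t : ℝ) - x.1) * b x.2.2 else 0 := by
    split_ifs with ha
    · exact indicator_of_mem (s := S₁) ha _
    · exact indicator_of_notMem (s := S₁) ha _
  rw [hI₁, hI₂, hfx, kernelError, ← hb']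
  simp only [← Real.enorm_eq_ofReal_abs]
  by_cases hst : x.1 < t
  · by_cases ha : (x.2.1 : ℝ) ≤ lam x.1 ω <;> by_cases hl : (x.2.1 : ℝ) ≤ lb x.1
    · simp [hst, ha, hl, Xor, ← sub_mul, enorm_mul]
    · simp only [hst, ha, hl, Xor, and_self, not_true_eq_false, not_false_eq_true, or_false,
        if_true, if_false, mul_zero, sub_zero, one_mul, enorm_mul, ← add_mul]
      gcongr
      simpa using enorm_add_le (h ((t : ℝ) - x.1) - stepKernel h Δ t x.1) (stepKernel h Δ t x.1)
    · simp [hst, ha, hl, Xor, enorm_mul]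
    · simp [ha, hl]
  · have hnlt : ¬ ⌈x.1 / Δ⌉₊ < ⌈t / Δ⌉₊ := not_lt.2 (Nat.ceil_mono (by
      gcongr; exact not_lt.1 hst))
    simp [hst, stepKernel, hnlt]

theorem measurable_ofReal_abs_stepKernel (hh : Measurable h) (Δ : ℝ≥0) :
    Measurable fun z : ℝ≥0 × ℝ≥0 => ENNReal.ofReal |stepKernel h Δ z.1 z.2| :=
  (measurable_stepKernel hh Δ).abs.ennreal_ofReal

theorem measurable_lintegral_mul {F : ℝ≥0 → ℝ≥0 → ℝ≥0∞}
    (hF : Measurable fun z : ℝ≥0 × ℝ≥0 => F z.1 z.2)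
    {d : ℝ≥0 → ℝ≥0∞} (hd : Measurable d) :
    Measurable fun t => ∫⁻ s, F t s * d s ∂lebesgueNN :=
  (hF.mul (hd.comp measurable_snd)).lintegral_prod_right'

theorem lintegral_lintegral_mul_swap {F : ℝ≥0 → ℝ≥0 → ℝ≥0∞}
    (hF : Measurable fun z : ℝ≥0 × ℝ≥0 => F z.1 z.2) {d : ℝ≥0 → ℝ≥0∞} (hd : Measurable d)
    (T : ℝ≥0) :
    ∫⁻ t in Iic T, ∫⁻ s, F t s * d s ∂lebesgueNN ∂lebesgueNN =
      ∫⁻ s, (∫⁻ t in Iic T, F t s ∂lebesgueNN) * d s ∂lebesgueNN := by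
  have hm : Measurable (Function.uncurry fun t s => F t s * d s) := hF.mul (hd.comp measurable_snd)
  rw [lintegral_lintegral_swap hm.aemeasurable]
  refine lintegral_congr fun s => ?_
  have h1 : Measurable fun t => F t s := hF.comp measurable_prodMk_right
  rw [lintegral_mul_const _ h1]

theorem IsPoissonRandomMeasure.campbell_density
    (hP : IsPoissonRandomMeasure P (intensityMeasure ν) Q)
    {D : Set (Pred (pointFiltration P hP.measurable) × ℝ≥0)} (hD : MeasurableSet D)
    {w : ℝ≥0 → ℝ≥0∞} (hw : Measurable w) {β : ℝ → ℝ≥0∞} (hβ : Measurable β) :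
    ∫⁻ ω, ∫⁻ x, w x.1 * (D.indicator 1 (⟨x.1, ω⟩, x.2.1) * β x.2.2) ∂(P ω) ∂Q =
      (∫⁻ y, β y ∂ν) * ∫⁻ s, w s * density Q D s ∂lebesgueNN :=
  hP.campbell_prod hD hw hβ

/-- The pathwise comparison of the two intensities at one time, averaged by Campbell's formula. -/
theorem lintegral_intensity_sub_le_of_time (hP : IsPoissonRandomMeasure P (intensityMeasure ν) Q)
    (hR : IsHawkesRisk Q P hP.measurable ψ h b T R lam)
    (hψL : LipschitzWith L ψ) (hψc : ψ 0 ≤ c) (hb : Measurable b) (hb0 : ∀ y, 0 ≤ b y)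
    (hbν : ∫⁻ y, ENNReal.ofReal (b y) ∂ν < ∞) (hh : Measurable h) (hΔ : 0 < Δ)
    {M : ℕ} (hT : T = M * Δ) {t : ℝ≥0} (ht : t ≤ T) :
    ∫⁻ ω, ENNReal.ofReal |lam t ω - stepIntensity P ψ h b Δ t ω| ∂Q ≤
      L * ((∫⁻ y, ENNReal.ofReal (b y) ∂ν) * ∫⁻ s, kernelError h Δ t s *
          density Q (below (pointFiltration P hP.measurable) lam) s ∂lebesgueNN +
        (∫⁻ y, ENNReal.ofReal (b y) ∂ν) * ∫⁻ s, ENNReal.ofReal |stepKernel h Δ t s| *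
          density Q (between (pointFiltration P hP.measurable) lam (stepIntensity P ψ h b Δ)) s
            ∂lebesgueNN) := by
  have hlam : Measurable fun z : Pred (pointFiltration P hP.measurable) => lam z.time z.outcome :=
    IsStronglyPredictable.measurable_pred hR.predictable
  have hstep := measurable_stepIntensity (h := h) hP.measurable
    (LipschitzWith.measurable_real hψL) hb hb0 hΔ
  have hD₁ := measurableSet_below hlam
  have hD₂ := measurableSet_between hlam hstep
  have hβ : Measurable fun y => ENNReal.ofReal (b y) := hb.ennreal_ofReal
  have hp : Measurable fun s : ℝ≥0 => (t, s) := measurable_prodMk_left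
  have hE : Measurable (kernelError h Δ t) := (measurable_kernelError hh Δ).comp hp
  have hS : Measurable fun s => ENNReal.ofReal |stepKernel h Δ t s| :=
    ((measurable_stepKernel hh Δ).comp hp).abs.ennreal_ofReal
  rw [← hP.campbell_density hD₁ hE hβ, ← hP.campbell_density hD₂ hS hβ,
    ← lintegral_add_left' (hP.aemeasurable_lintegral (measurable_integrand hD₁ hE hβ)),
    ← lintegral_const_mul' _ _ ENNReal.coe_ne_top]
  refine lintegral_mono_ae ?_
  filter_upwards [ae_intensity_sub_le hP hR hψL hψc hb hb0 hbν hh hΔ hT] with ω hω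
  exact hω t ht

/-- The mean distance of the two intensities, integrated over time: the discrete stability condition
closes the estimate, once the distance is known to be finite. -/
theorem lintegral_intensity_sub_le (hP : IsPoissonRandomMeasure P (intensityMeasure ν) Q)
    (hR : IsHawkesRisk Q P hP.measurable ψ h b T R lam)
    (hψL : LipschitzWith L ψ) (hψ0 : ∀ x, 0 ≤ ψ x) (hψc : ψ 0 ≤ c)
    (hb : Measurable b) (hb0 : ∀ y, 0 ≤ b y)
    (hbν : ∫⁻ y, ENNReal.ofReal (b y) ∂ν < ∞) (hh : Measurable h)
    (hhT : IntegrableOn h (Icc 0 (T : ℝ))) (hΔ : 0 < Δ)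
    {M : ℕ} (hM : 1 ≤ M) (hT : T = M * Δ)
    (hfin : ∫⁻ s in Iic T,
        density Q (below (pointFiltration P hP.measurable) lam) s ∂lebesgueNN < ∞)
    {ρ : ℝ≥0∞} (hρ : ρ < 1) (hρh : L * ((∫⁻ y, ENNReal.ofReal (b y) ∂ν) *
      ∑ k ∈ Finset.Icc 1 M, ENNReal.ofReal |h ((k : ℝ) * Δ)| * Δ) ≤ ρ) :
    ∫⁻ s in Iic T, ∫⁻ ω, ENNReal.ofReal |lam s ω - stepIntensity P ψ h b Δ s ω| ∂Q ∂lebesgueNN ≤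
      L * ((∫⁻ y, ENNReal.ofReal (b y) ∂ν) * (ENNReal.ofReal (regularityConst h T Δ) *
        ∫⁻ s in Iic T, density Q (below (pointFiltration P hP.measurable) lam) s ∂lebesgueNN)) /
          (1 - ρ) := by
  set 𝓕 := pointFiltration P hP.measurable
  have hlam : Measurable fun z : Pred 𝓕 => lam z.time z.outcome :=
    IsStronglyPredictable.measurable_pred hR.predictable
  have hstep : Measurable fun z : Pred 𝓕 => stepIntensity P ψ h b Δ z.time z.outcome :=
    measurable_stepIntensity hP.measurable (LipschitzWith.measurable_real hψL) hb hb0 hΔ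
  set D₁ := below 𝓕 lam
  set D₂ := between 𝓕 lam (stepIntensity P ψ h b Δ)
  have hD₁ : MeasurableSet D₁ := measurableSet_below hlam
  have hD₂ : MeasurableSet D₂ := measurableSet_between hlam hstep
  set B := ∫⁻ y, ENNReal.ofReal (b y) ∂ν
  set A := ∫⁻ s in Iic T, ∫⁻ ω,
      ENNReal.ofReal |lam s ω - stepIntensity P ψ h b Δ s ω| ∂Q ∂lebesgueNN
  have hA : A ≠ ∞ := by
    refine ne_of_lt (lt_of_le_of_lt (b := ∫⁻ s in Iic T, (density Q D₁ s +
      density Q (below 𝓕 (stepIntensity P ψ h b Δ)) s) ∂lebesgueNN) ?_ ?_)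
    · refine setLIntegral_mono' measurableSet_Iic fun s hs => ?_
      have hl : Measurable fun ω => ENNReal.ofReal (lam s ω) :=
        (hlam.comp (Pred.measurable_mk.comp
          (by fun_prop : Measurable fun ω : Ω => (s, ω)))).ennreal_ofReal
      rw [density_below, density_below, ← lintegral_add_left hl]
      refine lintegral_mono_ae ?_
      filter_upwards [hR.intensity_eq] with ω hω
      have h1 : 0 ≤ lam s ω := by rw [hω s hs]; exact hψ0 _
      have h2 : 0 ≤ stepIntensity P ψ h b Δ s ω := by
        rw [stepIntensity, discreteIntensity_eq]; exact hψ0 _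
      rw [← ENNReal.ofReal_add h1 h2]
      refine ENNReal.ofReal_le_ofReal ?_
      rw [abs_le]
      constructor <;> linarith
    · rw [lintegral_add_left (measurable_density Q hD₁)]
      exact ENNReal.add_lt_top.2 ⟨hfin,
        lintegral_stepIntensity_lt_top hP hψL hψc hb hb0 hbν hΔ T⟩
  refine le_div_one_sub_of_le_add_mul hA hρ ?_
  have hEm := measurable_kernelError hh Δ
  have hSm := measurable_ofReal_abs_stepKernel hh Δ
  have ht : ∀ t ∈ Iic T, ∫⁻ ω, ENNReal.ofReal |lam t ω - stepIntensity P ψ h b Δ t ω| ∂Q ≤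
      L * (B * ∫⁻ s, kernelError h Δ t s * density Q D₁ s ∂lebesgueNN +
        B * ∫⁻ s, ENNReal.ofReal |stepKernel h Δ t s| * density Q D₂ s ∂lebesgueNN) := fun t ht =>
    lintegral_intensity_sub_le_of_time hP hR hψL hψc hb hb0 hbν hh hΔ hT ht
  have hd₁ := measurable_density Q hD₁
  have hd₂ := measurable_density Q hD₂
  calc A ≤ ∫⁻ t in Iic T, L * (B * ∫⁻ s, kernelError h Δ t s * density Q D₁ s ∂lebesgueNN +
        B * ∫⁻ s, ENNReal.ofReal |stepKernel h Δ t s| * density Q D₂ s ∂lebesgueNN) ∂lebesgueNN :=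
        setLIntegral_mono' measurableSet_Iic ht
    _ = L * (B * ∫⁻ s, (∫⁻ t in Iic T, kernelError h Δ t s ∂lebesgueNN) *
        density Q D₁ s ∂lebesgueNN +
        B * ∫⁻ s, (∫⁻ t in Iic T, ENNReal.ofReal |stepKernel h Δ t s| ∂lebesgueNN) *
          density Q D₂ s ∂lebesgueNN) := by
        have h1 := measurable_lintegral_mul hEm hd₁
        have h2 := measurable_lintegral_mul
            (F := fun t s => ENNReal.ofReal |stepKernel h Δ t s|) hSm hd₂
        rw [lintegral_const_mul' _ _ ENNReal.coe_ne_top, lintegral_add_left (h1.const_mul _),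
          lintegral_const_mul _ h1, lintegral_const_mul _ h2, lintegral_lintegral_mul_swap hEm hd₁,
          lintegral_lintegral_mul_swap
              (F := fun t s => ENNReal.ofReal |stepKernel h Δ t s|) hSm hd₂]
    _ ≤ L * (B * ∫⁻ s, ENNReal.ofReal (regularityConst h T Δ) *
          (Iic T).indicator (density Q D₁) s ∂lebesgueNN +
        B * ∫⁻ s, (∑ k ∈ Finset.Icc 1 M, ENNReal.ofReal |h ((k : ℝ) * Δ)| * Δ) *
          (Iic T).indicator (density Q D₂) s ∂lebesgueNN) := by
        refine mul_le_mul' le_rfl (add_le_add (mul_le_mul' le_rfl (lintegral_mono_ae ?_))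
          (mul_le_mul' le_rfl (lintegral_mono fun s => ?_)))
        · have hz : ∀ᵐ s ∂lebesgueNN, s ≠ 0 := by
            rw [ae_iff]; simp
          filter_upwards [hz] with s hs
          refine (mul_le_mul_left (lintegral_kernelError_le hh hΔ hM hT hhT hs) _).trans
            (le_of_eq ?_)
          by_cases hs : s ∈ Iic T <;> simp [hs]
        · refine (mul_le_mul_left (lintegral_stepKernel_le h hΔ hT s) _).trans (le_of_eq ?_)
          by_cases hs : s ∈ Iic T <;> simp [hs]
    _ = L * (B * (ENNReal.ofReal (regularityConst h T Δ) *
          ∫⁻ s in Iic T, density Q D₁ s ∂lebesgueNN)) +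
        L * (B * ∑ k ∈ Finset.Icc 1 M, ENNReal.ofReal |h ((k : ℝ) * Δ)| * Δ) *
          ∫⁻ s in Iic T, density Q D₂ s ∂lebesgueNN := by
        rw [lintegral_const_mul _ ((measurable_density Q hD₁).indicator measurableSet_Iic),
          lintegral_const_mul _ ((measurable_density Q hD₂).indicator measurableSet_Iic),
          lintegral_indicator measurableSet_Iic, lintegral_indicator measurableSet_Iic]
        ring
    _ ≤ _ := by
        gcongr
        exact lintegral_mono fun s => density_between_le _ _ _ _

end Comparison

/-! ### The fractional Sobolev norm -/

section Sobolev

variable {η : ℝ}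

/-- The kernel `|x|^{-(1+η)}` of the fractional Sobolev seminorm, with value `∞` at the origin. -/
noncomputable def gagliardoKernel (η x : ℝ) : ℝ≥0∞ := (ENNReal.ofReal (|x| ^ (1 + η)))⁻¹

theorem measurable_gagliardoKernel (η : ℝ) : Measurable (gagliardoKernel η) := by
  unfold gagliardoKernel
  fun_prop

theorem gagliardoKernel_neg (η x : ℝ) : gagliardoKernel η (-x) = gagliardoKernel η x := by
  simp [gagliardoKernel]

theorem setLIntegral_Ici_gagliardoKernel (hη : 0 < η) {a : ℝ} (ha : 0 < a) :
    ∫⁻ x in Ici a, gagliardoKernel η x = ENNReal.ofReal (a ^ (-η) / η) := by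
  rw [setLIntegral_congr Ioi_ae_eq_Ici.symm]
  have h1 : ∀ x ∈ Ioi a, gagliardoKernel η x = ENNReal.ofReal (x ^ (-(1 + η))) := fun x hx => by
    have hx0 : 0 < x := ha.trans hx
    rw [gagliardoKernel, abs_of_pos hx0, ← ENNReal.ofReal_inv_of_pos (Real.rpow_pos_of_pos hx0 _),
      Real.rpow_neg hx0.le]
  rw [setLIntegral_congr_fun measurableSet_Ioi h1, ← ofReal_integral_eq_lintegral_ofReal
    (integrableOn_Ioi_rpow_of_lt (by linarith) ha), integral_Ioi_rpow_of_lt (by linarith) ha]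
  · congr 1
    rw [show -(1 + η) + 1 = -η by ring]
    field_simp
  · refine (ae_restrict_iff' measurableSet_Ioi).2 (ae_of_all _ fun x hx => ?_)
    exact Real.rpow_nonneg (ha.trans hx).le _

theorem setLIntegral_Ioc_rpow (hη : 0 < η) (hη1 : η < 1) {a : ℝ} (ha : 0 ≤ a) :
    ∫⁻ x in Ioc 0 a, ENNReal.ofReal (x ^ (-η) / η) =
      ENNReal.ofReal (a ^ (1 - η) / (η * (1 - η))) := by
  have hi := (intervalIntegral.intervalIntegrable_rpow' (a := 0) (b := a)
    (show -1 < -η by linarith)).div_const η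
  rw [← ofReal_integral_eq_lintegral_ofReal
    ((intervalIntegrable_iff_integrableOn_Ioc_of_le ha).1 hi),
    ← intervalIntegral.integral_of_le ha, intervalIntegral.integral_div,
    integral_rpow (Or.inl (by linarith))]
  · congr 1
    rw [show -η + 1 = 1 - η by ring, Real.zero_rpow (by linarith), sub_zero]
    have : 1 - η ≠ 0 := by linarith
    field_simp
  · refine (ae_restrict_iff' measurableSet_Ioc).2 (ae_of_all _ fun x hx => ?_)
    exact div_nonneg (Real.rpow_nonneg hx.1.le _) hη.le

/-- The mass that the Gagliardo kernel gives to the pairs which an interval separates. -/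
theorem lintegral_gagliardoKernel_Ioo_compl_le (hη : 0 < η) (hη1 : η < 1) (a : ℝ) {l : ℝ}
    (hl : 0 ≤ l) :
    ∫⁻ t in Ioo a (a + l), ∫⁻ s in (Ico a (a + l))ᶜ, gagliardoKernel η (t - s) ≤
      ENNReal.ofReal (2 / (η * (1 - η)) * l ^ (1 - η)) := by
  have hin : ∀ t ∈ Ioo a (a + l), ∫⁻ s in (Ico a (a + l))ᶜ, gagliardoKernel η (t - s) ≤
      ENNReal.ofReal ((t - a) ^ (-η) / η) + ENNReal.ofReal ((a + l - t) ^ (-η) / η) := by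
    intro t ht
    have hsub : (Ico a (a + l))ᶜ ⊆ Iic a ∪ Ici (a + l) := by
      intro s hs
      by_contra hc
      simp only [mem_union, mem_Iic, mem_Ici, not_or, not_le] at hc
      exact hs ⟨hc.1.le, hc.2⟩
    refine (lintegral_mono_set hsub).trans ((lintegral_union_le _ _ _).trans (add_le_add ?_ ?_))
    · rw [← setLIntegral_Ici_gagliardoKernel hη (sub_pos.2 ht.1),
        ← lintegral_indicator measurableSet_Iic, ← lintegral_indicator measurableSet_Ici,
        ← lintegral_sub_left_eq_self ((Ici (t - a)).indicator (gagliardoKernel η)) t]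
      refine lintegral_mono fun s => le_of_eq ?_
      simp only [indicator_apply, mem_Iic, mem_Ici]
      exact if_congr (by constructor <;> intro <;> linarith) rfl rfl
    · rw [← setLIntegral_Ici_gagliardoKernel hη (sub_pos.2 ht.2),
        ← lintegral_indicator measurableSet_Ici, ← lintegral_indicator measurableSet_Ici,
        ← lintegral_sub_right_eq_self ((Ici (a + l - t)).indicator (gagliardoKernel η)) t]
      refine lintegral_mono fun s => le_of_eq ?_
      simp only [indicator_apply, mem_Ici]
      rw [← gagliardoKernel_neg, neg_sub]
      exact if_congr (by constructor <;> intro <;> linarith) rfl rfl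
  refine (setLIntegral_mono' measurableSet_Ioo hin).trans ?_
  rw [lintegral_add_left (by fun_prop)]
  have hval := setLIntegral_Ioc_rpow hη hη1 hl
  have e1 : ∫⁻ t in Ioo a (a + l), ENNReal.ofReal ((t - a) ^ (-η) / η) ≤
      ENNReal.ofReal (l ^ (1 - η) / (η * (1 - η))) := by
    rw [← hval, ← lintegral_indicator measurableSet_Ioo, ← lintegral_indicator measurableSet_Ioc,
      ← lintegral_sub_right_eq_self
        ((Ioc 0 l).indicator fun x => ENNReal.ofReal (x ^ (-η) / η)) a]
    refine lintegral_mono fun t => ?_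
    by_cases ht : t ∈ Ioo a (a + l)
    · rw [indicator_of_mem ht, indicator_of_mem (show t - a ∈ Ioc 0 l from
        ⟨by linarith [ht.1], by linarith [ht.2]⟩)]
    · rw [indicator_of_notMem ht]; exact zero_le
  have e2 : ∫⁻ t in Ioo a (a + l), ENNReal.ofReal ((a + l - t) ^ (-η) / η) ≤
      ENNReal.ofReal (l ^ (1 - η) / (η * (1 - η))) := by
    rw [← hval, ← lintegral_indicator measurableSet_Ioo, ← lintegral_indicator measurableSet_Ioc,
      ← lintegral_sub_left_eq_self
        ((Ioc 0 l).indicator fun x => ENNReal.ofReal (x ^ (-η) / η)) (a + l)]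
    refine lintegral_mono fun t => ?_
    by_cases ht : t ∈ Ioo a (a + l)
    · rw [indicator_of_mem ht, indicator_of_mem (show a + l - t ∈ Ioc 0 l from
        ⟨by linarith [ht.2], by linarith [ht.1]⟩)]
    · rw [indicator_of_notMem ht]; exact zero_le
  have h0 : 0 ≤ l ^ (1 - η) / (η * (1 - η)) :=
    div_nonneg (Real.rpow_nonneg hl _) (mul_pos hη (by linarith)).le
  refine (add_le_add e1 e2).trans (le_of_eq ?_)
  rw [← ENNReal.ofReal_add h0 h0]
  congr 1
  ring

/-- The norm of the indicator of an interval; the bound does not depend on `T`. -/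
theorem sobolevNorm_indicator_Ico_le (hη : 0 < η) (hη1 : η < 1) (T a : ℝ) {l : ℝ} (hl : 0 ≤ l) :
    sobolevNorm η T ((Ico a (a + l)).indicator 1) ≤
      ENNReal.ofReal (l + 4 / (η * (1 - η)) * l ^ (1 - η)) := by
  set I := Ico a (a + l)
  have hI : MeasurableSet I := measurableSet_Ico
  have h0 : 0 ≤ 4 / (η * (1 - η)) * l ^ (1 - η) :=
    mul_nonneg (div_nonneg (by norm_num) (mul_pos hη (by linarith)).le) (Real.rpow_nonneg hl _)
  rw [sobolevNorm, ENNReal.ofReal_add hl h0]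
  refine add_le_add ?_ ?_
  · calc _ ≤ ∫⁻ t, ‖I.indicator (1 : ℝ → ℝ) t‖ₑ := setLIntegral_le_lintegral _ _
      _ = ∫⁻ t, I.indicator 1 t := by
          refine lintegral_congr fun t => ?_
          by_cases ht : t ∈ I <;> simp [ht]
      _ = ENNReal.ofReal l := by
          rw [lintegral_indicator_one hI, Real.volume_Ico]; congr 1; ring
  · let J : Set ℝ := Ioo a (a + l)
    -- the pairs separated by the interval, up to the null set where one of them is its left end
    have hk : Measurable fun z : ℝ × ℝ => J.indicator (1 : ℝ → ℝ≥0∞) z.1 *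
        (Iᶜ.indicator 1 z.2 * gagliardoKernel η (z.1 - z.2)) :=
      ((measurable_one.indicator measurableSet_Ioo).comp measurable_fst).mul
        (((measurable_one.indicator hI.compl).comp measurable_snd).mul
          ((measurable_gagliardoKernel η).comp (by fun_prop)))
    have hae : ∀ᵐ t : ℝ, t ≠ a := by rw [ae_iff]; simp
    have hk2 : ∫⁻ t, ∫⁻ s, J.indicator (1 : ℝ → ℝ≥0∞) t *
        (Iᶜ.indicator 1 s * gagliardoKernel η (t - s)) ≤
        ENNReal.ofReal (2 / (η * (1 - η)) * l ^ (1 - η)) := by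
      refine le_trans (le_of_eq ?_) (lintegral_gagliardoKernel_Ioo_compl_le hη hη1 a hl)
      rw [← lintegral_indicator measurableSet_Ioo]
      refine lintegral_congr fun t => ?_
      by_cases ht : t ∈ J
      · rw [indicator_of_mem ht, indicator_of_mem ht, ← lintegral_indicator hI.compl]
        refine lintegral_congr fun s => ?_
        by_cases hs : s ∈ Iᶜ
        · rw [indicator_of_mem hs, indicator_of_mem hs]; simp
        · rw [indicator_of_notMem hs, indicator_of_notMem hs]; simp
      · rw [indicator_of_notMem ht, indicator_of_notMem ht]
        simp
    calc _ ≤ ∫⁻ s, ∫⁻ t, (J.indicator (1 : ℝ → ℝ≥0∞) t *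
              (Iᶜ.indicator 1 s * gagliardoKernel η (t - s)) +
            J.indicator (1 : ℝ → ℝ≥0∞) s * (Iᶜ.indicator 1 t * gagliardoKernel η (s - t))) := by
          refine (setLIntegral_le_lintegral _ _).trans (lintegral_mono_ae ?_)
          filter_upwards [hae] with s hsa
          refine (setLIntegral_le_lintegral _ _).trans (lintegral_mono_ae ?_)
          filter_upwards [hae] with t hta
          have hJ : ∀ x : ℝ, x ≠ a → x ∈ I → x ∈ J := fun x hx hxI =>
            ⟨lt_of_le_of_ne hxI.1 hx.symm, hxI.2⟩
          by_cases ht : t ∈ I <;> by_cases hs : s ∈ I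
          · simp [ht, hs]
          · rw [indicator_of_mem ht, indicator_of_notMem hs, indicator_of_mem (hJ t hta ht),
              indicator_of_mem (show s ∈ Iᶜ from hs)]
            simp [gagliardoKernel, div_eq_mul_inv]
          · rw [indicator_of_mem hs, indicator_of_notMem ht, indicator_of_mem (hJ s hsa hs),
              indicator_of_mem (show t ∈ Iᶜ from ht), ← gagliardoKernel_neg, neg_sub,
              ← gagliardoKernel_neg η (s - t), neg_sub]
            simp [gagliardoKernel, div_eq_mul_inv]
          · simp [ht, hs]
      _ = (∫⁻ t, ∫⁻ s, J.indicator (1 : ℝ → ℝ≥0∞) t *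
              (Iᶜ.indicator 1 s * gagliardoKernel η (t - s))) +
            ∫⁻ s, ∫⁻ t, J.indicator (1 : ℝ → ℝ≥0∞) s *
              (Iᶜ.indicator 1 t * gagliardoKernel η (s - t)) := by
          have hsw := lintegral_lintegral_swap (μ := volume) (ν := volume) (f := fun t s =>
            J.indicator (1 : ℝ → ℝ≥0∞) t * (Iᶜ.indicator 1 s * gagliardoKernel η (t - s)))
            hk.aemeasurable
          have hm : Measurable fun s => ∫⁻ t, J.indicator (1 : ℝ → ℝ≥0∞) t *
              (Iᶜ.indicator 1 s * gagliardoKernel η (t - s)) :=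
            (hk.comp measurable_swap).lintegral_prod_right'
          refine (lintegral_congr fun s => ?_).trans
            ((lintegral_add_left hm _).trans (congrArg (· + _) hsw.symm))
          exact lintegral_add_left (hk.comp measurable_prodMk_right) _
      _ ≤ ENNReal.ofReal (2 / (η * (1 - η)) * l ^ (1 - η)) +
            ENNReal.ofReal (2 / (η * (1 - η)) * l ^ (1 - η)) := add_le_add hk2 hk2
      _ = _ := by
          have h2 : 0 ≤ 2 / (η * (1 - η)) * l ^ (1 - η) := by
            linarith [show 2 / (η * (1 - η)) * l ^ (1 - η) =
              (4 / (η * (1 - η)) * l ^ (1 - η)) / 2 by ring]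
          rw [← ENNReal.ofReal_add h2 h2]
          congr 1
          ring

theorem sobolevNorm_congr {T : ℝ} {u v : ℝ → ℝ} (h : EqOn u v (Icc 0 T)) :
    sobolevNorm η T u = sobolevNorm η T v := by
  unfold sobolevNorm
  congr 1
  · exact setLIntegral_congr_fun measurableSet_Icc fun t ht => by rw [h ht]
  · refine setLIntegral_congr_fun measurableSet_Icc fun s hs => ?_
    exact setLIntegral_congr_fun measurableSet_Icc fun t ht => by rw [h ht, h hs]

theorem sobolevNorm_const_mul (T c : ℝ) (u : ℝ → ℝ) :
    sobolevNorm η T (fun t => c * u t) = ‖c‖ₑ * sobolevNorm η T u := by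
  simp only [sobolevNorm, enorm_mul, ← mul_sub, mul_div_assoc, mul_add,
    lintegral_const_mul' _ _ (enorm_ne_top (x := c))]

theorem sobolevNorm_add_le (T : ℝ) {u : ℝ → ℝ} (hu : Measurable u) (v : ℝ → ℝ) :
    sobolevNorm η T (fun t => u t + v t) ≤ sobolevNorm η T u + sobolevNorm η T v := by
  have hm : Measurable fun z : ℝ × ℝ =>
      ‖u z.2 - u z.1‖ₑ / ENNReal.ofReal (|z.2 - z.1| ^ (1 + η)) := by
    fun_prop
  unfold sobolevNorm
  rw [add_add_add_comm, ← lintegral_add_left hu.enorm,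
      ← lintegral_add_left hm.lintegral_prod_right']
  refine add_le_add (lintegral_mono fun t => enorm_add_le _ _) (lintegral_mono fun s => ?_)
  refine le_trans (lintegral_mono fun t => ?_)
    (le_of_eq (lintegral_add_left (hm.comp measurable_prodMk_left) _))
  dsimp only [Function.comp_apply]
  rw [← ENNReal.add_div, add_sub_add_comm]
  gcongr
  exact enorm_add_le _ _

/-- Minkowski's inequality for the fractional Sobolev norm. -/
theorem sobolevNorm_integral_le {α : Type*} [MeasurableSpace α] {μ : Measure α} [SFinite μ] (T : ℝ)
    {F : ℝ → α → ℝ} (hF : Measurable fun z : ℝ × α => F z.1 z.2)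
    (hi : ∀ t ∈ Icc 0 T, Integrable (F t) μ) :
    sobolevNorm η T (fun t => ∫ x, F t x ∂μ) ≤ ∫⁻ x, sobolevNorm η T (fun t => F t x) ∂μ := by
  have h1 : Measurable fun z : α × ℝ => ‖F z.2 z.1‖ₑ := (hF.comp measurable_swap).enorm
  have h2 : Measurable fun z : (α × ℝ) × ℝ =>
      ‖F z.2 z.1.1 - F z.1.2 z.1.1‖ₑ / ENNReal.ofReal (|z.2 - z.1.2| ^ (1 + η)) := by
    have e1 : Measurable fun z : (α × ℝ) × ℝ => F z.2 z.1.1 :=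
      hF.comp (by fun_prop : Measurable fun z : (α × ℝ) × ℝ => (z.2, z.1.1))
    have e2 : Measurable fun z : (α × ℝ) × ℝ => F z.1.2 z.1.1 :=
      hF.comp (by fun_prop : Measurable fun z : (α × ℝ) × ℝ => (z.1.2, z.1.1))
    fun_prop
  have h3 : Measurable fun z : α × ℝ => ∫⁻ t in Icc 0 T,
      ‖F t z.1 - F z.2 z.1‖ₑ / ENNReal.ofReal (|t - z.2| ^ (1 + η)) := h2.lintegral_prod_right'
  unfold sobolevNorm
  rw [lintegral_add_left h1.lintegral_prod_right', lintegral_lintegral_swap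
    (f := fun x t => ‖F t x‖ₑ) h1.aemeasurable,
    lintegral_lintegral_swap (f := fun x s => ∫⁻ t in Icc 0 T,
      ‖F t x - F s x‖ₑ / ENNReal.ofReal (|t - s| ^ (1 + η))) h3.aemeasurable]
  refine add_le_add (lintegral_mono fun t => enorm_integral_le_lintegral_enorm _)
    (setLIntegral_mono' measurableSet_Icc fun s hs => ?_)
  have h4 : Measurable fun z : α × ℝ =>
      ‖F z.2 z.1 - F s z.1‖ₑ / ENNReal.ofReal (|z.2 - s| ^ (1 + η)) :=
    h2.comp (by fun_prop : Measurable fun z : α × ℝ => ((z.1, s), z.2))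
  rw [lintegral_lintegral_swap
    (f := fun x t => ‖F t x - F s x‖ₑ / ENNReal.ofReal (|t - s| ^ (1 + η))) h4.aemeasurable]
  refine setLIntegral_mono' measurableSet_Icc fun t ht => ?_
  simp only [div_eq_mul_inv]
  have h5 : Measurable fun x => ‖F t x - F s x‖ₑ :=
    ((hF.comp (measurable_prodMk_left (x := t))).sub
      (hF.comp (measurable_prodMk_left (x := s)))).enorm
  rw [lintegral_mul_const _ h5]
  gcongr
  rw [← integral_sub (hi t ht) (hi s hs)]
  exact enorm_integral_le_lintegral_enorm _

end Sobolev

/-! ### The distance of the two risk processes along a path -/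

section Path

variable {Ω : Type*} [mΩ : MeasurableSpace Ω] {P : Ω → Measure Point} {ν : Measure ℝ}
  [IsProbabilityMeasure ν] {Q : Measure Ω}
  {ψ h b : ℝ → ℝ} {L : ℝ≥0} {c : ℝ} {T Δ : ℝ≥0} {R lam : ℝ≥0 → Ω → ℝ} {η : ℝ}

/-- An upper bound of the fractional Sobolev norm of the indicator of an interval of length `l`. -/
noncomputable def intervalNorm (η l : ℝ) : ℝ := l + 4 / (η * (1 - η)) * l ^ (1 - η)

theorem intervalNorm_mono (hη : 0 < η) (hη1 : η < 1) {l m : ℝ} (hl : 0 ≤ l) (hlm : l ≤ m) :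
    intervalNorm η l ≤ intervalNorm η m := by
  have h1 : 0 ≤ 4 / (η * (1 - η)) := div_nonneg (by norm_num) (mul_pos hη (by linarith)).le
  exact add_le_add hlm (mul_le_mul_of_nonneg_left
    (Real.rpow_le_rpow hl hlm (by linarith)) h1)

/-- The end of the time bin that contains `s`. -/
noncomputable def binEnd (Δ s : ℝ≥0) : ℝ := ⌈s / Δ⌉₊ * Δ

theorem le_binEnd (hΔ : 0 < Δ) (s : ℝ≥0) : (s : ℝ) ≤ binEnd Δ s := by
  have := (div_le_iff₀ hΔ).1 (Nat.le_ceil (s / Δ))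
  rw [binEnd]
  exact_mod_cast this

theorem binEnd_sub_le (hΔ : 0 < Δ) (s : ℝ≥0) : binEnd Δ s - s ≤ Δ := by
  have h1 : ((⌈s / Δ⌉₊ : ℝ≥0) : ℝ) ≤ ((s / Δ + 1 : ℝ≥0) : ℝ) :=
    NNReal.coe_le_coe.2 (Nat.ceil_lt_add_one zero_le).le
  have h2 : (0 : ℝ) < Δ := hΔ
  push_cast at h1
  have h3 := mul_le_mul_of_nonneg_right h1 h2.le
  rw [add_mul, div_mul_cancel₀ _ h2.ne', one_mul] at h3
  rw [binEnd]
  linarith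

theorem ceil_le_floor_iff (hΔ : 0 < Δ) (s : ℝ≥0) (t : ℝ≥0) :
    ⌈s / Δ⌉₊ ≤ ⌊t / Δ⌋₊ ↔ binEnd Δ s ≤ t := by
  rw [Nat.le_floor_iff zero_le, le_div_iff₀ hΔ, binEnd]
  exact_mod_cast Iff.rfl

theorem measurable_binEnd (Δ : ℝ≥0) : Measurable (binEnd Δ) := by
  have : Measurable fun s : ℝ≥0 => ⌈s / Δ⌉₊ := Nat.measurable_ceil.comp (measurable_id.div_const Δ)
  exact ((measurable_from_top (f := fun n : ℕ => (n : ℝ))).comp this).mul_const _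

/-- The contribution to `R_t - R^Δ_t` of a point at time `s`, of mark `y`, with `α` and `β` the
indicators that it is accepted by the Hawkes process and by its discretisation: the former counts it
from time `s` on, the latter from the end of the time bin on. -/
noncomputable def pathKernel (T Δ s : ℝ≥0) (α β y : ℝ) (t : ℝ) : ℝ :=
  (Iic T).indicator 1 s * (α * y) * (Ico (s : ℝ) (s + (binEnd Δ s - s))).indicator 1 t +
    (Iic T).indicator 1 s * ((α - β) * y) * (Ico (binEnd Δ s) (binEnd Δ s + T)).indicator 1 t

theorem sobolevNorm_pathKernel_le (hη : 0 < η) (hη1 : η < 1) (hΔ : 0 < Δ) (s : ℝ≥0) (α β y : ℝ) :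
    sobolevNorm η T (pathKernel T Δ s α β y) ≤
      ENNReal.ofReal (intervalNorm η Δ) * ((Iic T).indicator 1 s * (‖α‖ₑ * ‖y‖ₑ)) +
        ENNReal.ofReal (intervalNorm η T) * ((Iic T).indicator 1 s * (‖α - β‖ₑ * ‖y‖ₑ)) := by
  have hm : ∀ I : Set ℝ, MeasurableSet I → ∀ c : ℝ,
      Measurable fun t => c * I.indicator (1 : ℝ → ℝ) t :=
    fun I hI c => (measurable_one.indicator hI).const_mul c
  have h0 : (0 : ℝ) ≤ binEnd Δ s - s := sub_nonneg.2 (le_binEnd hΔ s)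
  have hind : ‖(Iic T).indicator (1 : ℝ≥0 → ℝ) s‖ₑ = (Iic T).indicator 1 s := by
    by_cases hs : s ∈ Iic T
    · rw [indicator_of_mem hs, indicator_of_mem hs]; simp
    · rw [indicator_of_notMem hs, indicator_of_notMem hs]; simp
  refine (sobolevNorm_add_le _ (hm _ measurableSet_Ico _) _).trans (add_le_add ?_ ?_)
  · rw [sobolevNorm_const_mul, enorm_mul, enorm_mul, hind, mul_comm]
    gcongr
    exact (sobolevNorm_indicator_Ico_le hη hη1 T s h0).trans (ENNReal.ofReal_le_ofReal
      (intervalNorm_mono hη hη1 h0 (binEnd_sub_le hΔ s)))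
  · rw [sobolevNorm_const_mul, enorm_mul, enorm_mul, hind, mul_comm]
    gcongr
    exact sobolevNorm_indicator_Ico_le hη hη1 T _ T.2

theorem pathKernel_eq (hΔ : 0 < Δ) {s t : ℝ≥0} (hs : s ≠ 0) (ht : t ≤ T) (α β y : ℝ) :
    pathKernel T Δ s α β y t =
      (if s ≤ t then α * y else 0) - if ⌈s / Δ⌉₊ ≤ ⌊t / Δ⌋₊ then β * y else 0 := by
  have hs0 : (0 : ℝ) < s := NNReal.coe_pos.2 (pos_iff_ne_zero.2 hs)
  have hse := le_binEnd hΔ s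
  have htT : (t : ℝ) ≤ T := NNReal.coe_le_coe.2 ht
  have hst : s ≤ t ↔ (s : ℝ) ≤ t := NNReal.coe_le_coe.symm
  rw [pathKernel]
  simp only [ceil_le_floor_iff hΔ, hst]
  by_cases h1 : (s : ℝ) ≤ t
  · have h2 : s ∈ Iic T := (hst.2 h1).trans ht
    by_cases h3 : binEnd Δ s ≤ t
    · rw [if_pos h1, if_pos h3, indicator_of_mem h2, indicator_of_notMem (fun h => by
        have := h.2; linarith),
        indicator_of_mem (show (t : ℝ) ∈ Ico (binEnd Δ s) (binEnd Δ s + T) from ⟨h3, by linarith⟩)]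
      simp only [Pi.one_apply]; ring
    · rw [if_pos h1, if_neg h3, indicator_of_mem h2, indicator_of_mem
        (show (t : ℝ) ∈ Ico (s : ℝ) (s + (binEnd Δ s - s)) from ⟨h1, by linarith⟩),
        indicator_of_notMem (fun h => h3 h.1)]
      simp
  · have h3 : ¬ binEnd Δ s ≤ t := fun h => h1 (hse.trans h)
    rw [if_neg h1, if_neg h3, indicator_of_notMem (s := Ico (s : ℝ) _) (fun h => h1 h.1),
        indicator_of_notMem (s := Ico (binEnd Δ s) _) (fun h => h3 h.1)]
    simp

theorem measurable_pathKernel (T Δ : ℝ≥0) {α β : Point → ℝ} (hα : Measurable α)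
    (hβ : Measurable β) :
    Measurable fun z : ℝ × Point => pathKernel T Δ z.2.1 (α z.2) (β z.2) z.2.2.2 z.1 := by
  have he : Measurable fun z : ℝ × Point => binEnd Δ z.2.1 :=
      (measurable_binEnd Δ).comp (by fun_prop)
  have hT : Measurable fun z : ℝ × Point => (Iic T).indicator (1 : ℝ≥0 → ℝ) z.2.1 :=
    (measurable_one.indicator measurableSet_Iic).comp (by fun_prop)
  have hI : ∀ {f g : ℝ × Point → ℝ}, Measurable f → Measurable g →
      Measurable fun z : ℝ × Point => (Ico (f z) (g z)).indicator (1 : ℝ → ℝ) z.1 := by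
    intro f g hf hg
    have : (fun z : ℝ × Point => (Ico (f z) (g z)).indicator (1 : ℝ → ℝ) z.1) =
        {z : ℝ × Point | f z ≤ z.1 ∧ z.1 < g z}.indicator 1 := rfl
    rw [this]
    exact measurable_one.indicator ((measurableSet_le hf measurable_fst).inter
      (measurableSet_lt measurable_fst hg))
  have h1 := hI (f := fun z => (z.2.1 : ℝ))
    (g := fun z => (z.2.1 : ℝ) + (binEnd Δ z.2.1 - (z.2.1 : ℝ)))
    (by fun_prop) (by fun_prop)
  have h2 := hI he (he.add_const (T : ℝ))
  unfold pathKernel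
  fun_prop

/-- The indicator of the points below the level `a`. -/
noncomputable def accept (a : ℝ≥0 → ℝ) : Point → ℝ := {x : Point | (x.2.1 : ℝ) ≤ a x.1}.indicator 1

theorem accept_of_le {a : ℝ≥0 → ℝ} {x : Point} (h : (x.2.1 : ℝ) ≤ a x.1) : accept a x = 1 :=
  indicator_of_mem (s := {x : Point | (x.2.1 : ℝ) ≤ a x.1}) h _

theorem accept_of_not_le {a : ℝ≥0 → ℝ} {x : Point} (h : ¬ (x.2.1 : ℝ) ≤ a x.1) : accept a x = 0 :=
  indicator_of_notMem (s := {x : Point | (x.2.1 : ℝ) ≤ a x.1}) h _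

theorem measurableSet_le_height {a : ℝ≥0 → ℝ} (ha : Measurable a) :
    MeasurableSet {x : Point | (x.2.1 : ℝ) ≤ a x.1} :=
  measurableSet_le (f := fun x : Point => (x.2.1 : ℝ)) (by fun_prop) (ha.comp measurable_fst)

theorem measurable_accept {a : ℝ≥0 → ℝ} (ha : Measurable a) : Measurable (accept a) :=
  measurable_one.indicator (measurableSet_le_height ha)

theorem enorm_accept {𝓕 : Filtration ℝ≥0 mΩ} (a : ℝ≥0 → Ω → ℝ) (ω : Ω) (x : Point) :
    ‖accept (fun s => a s ω) x‖ₑ = (below 𝓕 a).indicator 1 (⟨x.1, ω⟩, x.2.1) := by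
  by_cases hx : (x.2.1 : ℝ) ≤ a x.1 ω
  · rw [indicator_of_mem (s := below 𝓕 a) hx, accept_of_le hx]
    simp
  · rw [indicator_of_notMem (s := below 𝓕 a) hx, accept_of_not_le hx]
    simp

theorem enorm_accept_sub {𝓕 : Filtration ℝ≥0 mΩ} (a l : ℝ≥0 → Ω → ℝ) (ω : Ω) (x : Point) :
    ‖accept (fun s => a s ω) x - accept (fun s => l s ω) x‖ₑ =
      (between 𝓕 a l).indicator 1 (⟨x.1, ω⟩, x.2.1) := by
  have hiff : ((⟨x.1, ω⟩, x.2.1) : Pred 𝓕 × ℝ≥0) ∈ between 𝓕 a l ↔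
      Xor ((x.2.1 : ℝ) ≤ a x.1 ω) ((x.2.1 : ℝ) ≤ l x.1 ω) := Iff.rfl
  by_cases hx : (x.2.1 : ℝ) ≤ a x.1 ω <;> by_cases hy : (x.2.1 : ℝ) ≤ l x.1 ω
  · rw [indicator_of_notMem (by simp [hiff, hx, hy]), accept_of_le hx, accept_of_le hy]; simp
  · rw [indicator_of_mem (by simp [hiff, hx, hy, Xor]), accept_of_le hx, accept_of_not_le hy]; simp
  · rw [indicator_of_mem (by simp [hiff, hx, hy, Xor]), accept_of_not_le hx, accept_of_le hy]; simp
  · rw [indicator_of_notMem (by simp [hiff, hx, hy]), accept_of_not_le hx,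
        accept_of_not_le hy]; simp

theorem Pred.measurable_path {𝓕 : Filtration ℝ≥0 mΩ} {a : ℝ≥0 → Ω → ℝ}
    (ha : Measurable fun z : Pred 𝓕 => a z.time z.outcome) (ω : Ω) : Measurable fun s => a s ω :=
  ha.comp (Pred.measurable_mk.comp (by fun_prop : Measurable fun s : ℝ≥0 => (s, ω)))

theorem integrable_indicator_mul {p : Measure Point} {γ : Point → ℝ} (hγ : Measurable γ)
    (hf : ∫⁻ x, (Iic T).indicator 1 x.1 * (‖γ x‖ₑ * ‖x.2.2‖ₑ) ∂p < ∞) {S : Set ℝ≥0}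
    (hS : MeasurableSet S) (hST : S ⊆ Iic T) :
    Integrable (fun x : Point => S.indicator (1 : ℝ≥0 → ℝ) x.1 * (γ x * x.2.2)) p := by
  have hSm : Measurable (S.indicator (1 : ℝ≥0 → ℝ)) := measurable_one.indicator hS
  have hm : Measurable fun x : Point => S.indicator (1 : ℝ≥0 → ℝ) x.1 * (γ x * x.2.2) := by fun_prop
  refine ⟨hm.aestronglyMeasurable, lt_of_le_of_lt (lintegral_mono fun x => ?_) hf⟩
  rw [enorm_mul, enorm_mul]
  gcongr
  by_cases hx : x.1 ∈ S
  · rw [indicator_of_mem hx, indicator_of_mem (hST hx)]; simp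
  · rw [indicator_of_notMem hx]; simp

/-- The difference of the two risks, for one realisation `p` of the random measure, as a
superposition of the contributions of the points. The finiteness assumptions make the sums of the
marks integrable, so that they may be subtracted under the integral. -/
theorem integral_accepted_sub_eq {p : Measure Point} (h0 : ∀ᵐ x ∂p, x.1 ≠ 0) (hΔ : 0 < Δ)
    {a : ℝ≥0 → ℝ} (ha : Measurable a) {l : ℕ → ℝ}
    (hf₁ : ∫⁻ x, (Iic T).indicator 1 x.1 * (‖accept a x‖ₑ * ‖x.2.2‖ₑ) ∂p < ∞)
    (hf₂ : ∫⁻ x, (Iic T).indicator 1 x.1 *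
      (‖accept (fun s => l ⌈s / Δ⌉₊) x‖ₑ * ‖x.2.2‖ₑ) ∂p < ∞) {t : ℝ≥0} (ht : t ≤ T) :
    Integrable (fun x : Point =>
        pathKernel T Δ x.1 (accept a x) (accept (fun s => l ⌈s / Δ⌉₊) x) x.2.2 t) p ∧
      (∫ x in {x : Point | 0 < x.1 ∧ x.1 ≤ t ∧ (x.2.1 : ℝ) ≤ a x.1}, x.2.2 ∂p) -
          ∑ k ∈ Finset.Icc 1 ⌊t / Δ⌋₊, ∫ x in binBelow Δ k (l k), x.2.2 ∂p =
        ∫ x, pathKernel T Δ x.1 (accept a x) (accept (fun s => l ⌈s / Δ⌉₊) x) x.2.2 t ∂p := by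
  have hlm : Measurable fun s => l ⌈s / Δ⌉₊ :=
    measurable_from_top.comp (Nat.measurable_ceil.comp (measurable_id.div_const Δ))
  have i1 := integrable_indicator_mul (measurable_accept ha) hf₁ measurableSet_Iic
    (Iic_subset_Iic.2 ht)
  have hk : ∀ k ∈ Finset.Icc 1 ⌊t / Δ⌋₊, {s : ℝ≥0 | ⌈s / Δ⌉₊ = k} ⊆ Iic T := by
    intro k hk s hs
    have hs : ⌈s / Δ⌉₊ = k := hs
    have h1 : ((⌈s / Δ⌉₊ : ℕ) : ℝ≥0) ≤ t / Δ := by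
      rw [hs]; exact (Nat.le_floor_iff zero_le).1 (Finset.mem_Icc.1 hk).2
    have h2 := (Nat.le_ceil (s / Δ)).trans h1
    rw [div_le_div_iff_of_pos_right hΔ] at h2
    exact h2.trans ht
  have i2 := fun k (hk' : k ∈ Finset.Icc 1 ⌊t / Δ⌋₊) =>
    integrable_indicator_mul (measurable_accept hlm) hf₂ (measurableSet_ceil_eq Δ k) (hk k hk')
  have e1 : ∫ x in {x : Point | 0 < x.1 ∧ x.1 ≤ t ∧ (x.2.1 : ℝ) ≤ a x.1}, x.2.2 ∂p =
      ∫ x, (Iic t).indicator (1 : ℝ≥0 → ℝ) x.1 * (accept a x * x.2.2) ∂p := by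
    have hS : MeasurableSet {x : Point | 0 < x.1 ∧ x.1 ≤ t ∧ (x.2.1 : ℝ) ≤ a x.1} :=
      (measurableSet_lt measurable_const measurable_fst).inter
        ((measurableSet_le measurable_fst measurable_const).inter (measurableSet_le_height ha))
    rw [← integral_indicator hS]
    refine integral_congr_ae ?_
    filter_upwards [h0] with x hx
    have hx : 0 < x.1 := pos_iff_ne_zero.2 hx
    by_cases h1 : x.1 ≤ t <;> by_cases h2 : (x.2.1 : ℝ) ≤ a x.1 <;> simp [accept, hx, h1, h2]
  have e2 : ∑ k ∈ Finset.Icc 1 ⌊t / Δ⌋₊, ∫ x in binBelow Δ k (l k), x.2.2 ∂p =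
      ∫ x, ∑ k ∈ Finset.Icc 1 ⌊t / Δ⌋₊, {s : ℝ≥0 | ⌈s / Δ⌉₊ = k}.indicator (1 : ℝ≥0 → ℝ) x.1 *
        (accept (fun s => l ⌈s / Δ⌉₊) x * x.2.2) ∂p := by
    rw [integral_finsetSum _ i2]
    refine Finset.sum_congr rfl fun k hk => ?_
    have hk0 : k ≠ 0 := by have := (Finset.mem_Icc.1 hk).1; omega
    rw [← integral_indicator (measurableSet_binBelow _ _ _)]
    refine integral_congr_ae (ae_of_all _ fun x => ?_)
    have hiff := mem_binBelow_iff hΔ hk0 (l := l k) (x := x)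
    by_cases h1 : ⌈x.1 / Δ⌉₊ = k
    · by_cases h2 : (x.2.1 : ℝ) ≤ l k
      · simp [accept, hiff.2 ⟨h1, h2⟩, h1, h2]
      · have : x ∉ binBelow Δ k (l k) := fun h => h2 (hiff.1 h).2
        simp [accept, this, h1, h2]
    · have : x ∉ binBelow Δ k (l k) := fun h => h1 (hiff.1 h).1
      simp [this, h1]
  have e3 : (fun x : Point =>
        pathKernel T Δ x.1 (accept a x) (accept (fun s => l ⌈s / Δ⌉₊) x) x.2.2 t) =ᵐ[p]
      fun x => (Iic t).indicator (1 : ℝ≥0 → ℝ) x.1 * (accept a x * x.2.2) -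
        ∑ k ∈ Finset.Icc 1 ⌊t / Δ⌋₊, {s : ℝ≥0 | ⌈s / Δ⌉₊ = k}.indicator (1 : ℝ≥0 → ℝ) x.1 *
          (accept (fun s => l ⌈s / Δ⌉₊) x * x.2.2) := by
    filter_upwards [h0] with x hx
    have hx1 : 1 ≤ ⌈x.1 / Δ⌉₊ := Nat.ceil_pos.2 (div_pos (pos_iff_ne_zero.2 hx) hΔ)
    rw [pathKernel_eq hΔ hx ht]
    congr 1
    · by_cases h1 : x.1 ≤ t <;> simp [h1]
    · have : ∀ k ∈ Finset.Icc 1 ⌊t / Δ⌋₊, {s : ℝ≥0 | ⌈s / Δ⌉₊ = k}.indicator (1 : ℝ≥0 → ℝ) x.1 *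
          (accept (fun s => l ⌈s / Δ⌉₊) x * x.2.2) =
            if k = ⌈x.1 / Δ⌉₊ then accept (fun s => l ⌈s / Δ⌉₊) x * x.2.2 else 0 := by
        intro k _
        by_cases h1 : k = ⌈x.1 / Δ⌉₊
        · simp [h1]
        · simp [h1, Ne.symm h1]
      rw [Finset.sum_congr rfl this, Finset.sum_ite_eq']
      simp [hx1]
  have i3 := integrable_finsetSum _ i2
  exact ⟨(i1.sub i3).congr e3.symm, by rw [integral_congr_ae e3, e1, e2, integral_sub i1 i3]⟩

theorem lintegral_sobolevNorm_pathKernel_le {p : Measure Point} (hη : 0 < η) (hη1 : η < 1)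
    (hΔ : 0 < Δ)
    {α β : Point → ℝ} (hα : Measurable α) :
    ∫⁻ x, sobolevNorm η T (pathKernel T Δ x.1 (α x) (β x) x.2.2) ∂p ≤
      ENNReal.ofReal (intervalNorm η Δ) *
          ∫⁻ x, (Iic T).indicator 1 x.1 * (‖α x‖ₑ * ‖x.2.2‖ₑ) ∂p +
        ENNReal.ofReal (intervalNorm η T) *
          ∫⁻ x, (Iic T).indicator 1 x.1 * (‖α x - β x‖ₑ * ‖x.2.2‖ₑ) ∂p := by
  have hle : ∀ x : Point, _ := fun x =>
    sobolevNorm_pathKernel_le (T := T) hη hη1 hΔ x.1 (α x) (β x) x.2.2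
  refine (lintegral_mono hle).trans (le_of_eq ?_)
  have hw : Measurable ((Iic T).indicator (1 : ℝ≥0 → ℝ≥0∞)) :=
    measurable_one.indicator measurableSet_Iic
  have hm : Measurable fun x : Point => (Iic T).indicator (1 : ℝ≥0 → ℝ≥0∞) x.1 *
      (‖α x‖ₑ * ‖x.2.2‖ₑ) :=
    Measurable.mul (f := fun x : Point => (Iic T).indicator (1 : ℝ≥0 → ℝ≥0∞) x.1)
      (hw.comp measurable_fst) (hα.enorm.mul measurable_snd.snd.enorm)
  rw [lintegral_add_left (hm.const_mul _), lintegral_const_mul' _ _ ENNReal.ofReal_ne_top,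
    lintegral_const_mul' _ _ ENNReal.ofReal_ne_top]

variable [IsProbabilityMeasure Q]

/-- The risk processes differ by the contributions of the accepted points; each contribution is a
multiple of the indicator of an interval of length at most `Δ` for a point that the Hawkes process
accepts, and of length at most `T` for a point that is accepted by exactly one process. -/
theorem ae_sobolevNorm_risk_sub_le (hP : IsPoissonRandomMeasure P (intensityMeasure ν) Q)
    (hR : IsHawkesRisk Q P hP.measurable ψ h b T R lam)
    (hψL : LipschitzWith L ψ) (hψc : ψ 0 ≤ c) (hb : Measurable b) (hb0 : ∀ y, 0 ≤ b y)
    (hbν : ∫⁻ y, ENNReal.ofReal (b y) ∂ν < ∞) (hyν : ∫⁻ y, ‖y‖ₑ ∂ν < ∞)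
    (hη : 0 < η) (hη1 : η < 1) (hΔ : 0 < Δ)
    (hfin : ∫⁻ s in Iic T,
        density Q (below (pointFiltration P hP.measurable) lam) s ∂lebesgueNN < ∞) :
    ∀ᵐ ω ∂Q, sobolevNorm η T
        (fun t : ℝ => R t.toNNReal ω - discreteRisk P ψ h b Δ t.toNNReal ω) ≤
      ENNReal.ofReal (intervalNorm η Δ) * ∫⁻ x, (Iic T).indicator 1 x.1 *
          ((below (pointFiltration P hP.measurable) lam).indicator 1 (⟨x.1, ω⟩, x.2.1) *
            ‖x.2.2‖ₑ) ∂(P ω) +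
        ENNReal.ofReal (intervalNorm η T) * ∫⁻ x, (Iic T).indicator 1 x.1 *
          ((between (pointFiltration P hP.measurable) lam (stepIntensity P ψ h b Δ)).indicator 1
            (⟨x.1, ω⟩, x.2.1) * ‖x.2.2‖ₑ) ∂(P ω) := by
  have hlam : Measurable fun z : Pred (pointFiltration P hP.measurable) => lam z.time z.outcome :=
    IsStronglyPredictable.measurable_pred hR.predictable
  have hstep := measurable_stepIntensity (h := h) hP.measurable
    (LipschitzWith.measurable_real hψL) hb hb0 hΔ
  have hD₁ := measurableSet_below hlam
  have hD₂ := measurableSet_below hstep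
  filter_upwards [hR.risk_eq, hP.ae_tame hΔ, hP.ae_time_zero, hP.ae_sfinite,
    ae_lintegral_accepted_lt_top hP hD₁ hfin measurable_enorm hyν,
    ae_lintegral_accepted_lt_top hP hD₂
      (lintegral_stepIntensity_lt_top (h := h) hP hψL hψc hb hb0 hbν hΔ T) measurable_enorm hyν]
    with ω hrisk htame h0 hsf hf₁ hf₂
  have hlamω := Pred.measurable_path hlam ω
  have hstepω := Pred.measurable_path (a := stepIntensity P ψ h b Δ) hstep ω
  have h0' : ∀ᵐ x ∂(P ω), x.1 ≠ 0 := by rw [ae_iff]; simpa using h0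
  simp only [← enorm_accept, ← enorm_accept_sub] at hf₁ hf₂ ⊢
  have hl : (fun s => stepIntensity P ψ h b Δ s ω) =
      fun s => discreteIntensity ψ h b Δ (P ω) ⌈s / Δ⌉₊ := by
    funext s
    rw [stepIntensity, htame]
  have hpath := fun (t : ℝ≥0) (ht : t ≤ T) => integral_accepted_sub_eq (l := fun k =>
    discreteIntensity ψ h b Δ (P ω) k) h0' hΔ hlamω hf₁ (hl ▸ hf₂) ht
  rw [← hl] at hpath
  have hcongr : sobolevNorm η T (fun t : ℝ =>
      R t.toNNReal ω - discreteRisk P ψ h b Δ t.toNNReal ω) =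
      sobolevNorm η T (fun t => ∫ x, pathKernel T Δ x.1 (accept (fun s => lam s ω) x)
        (accept (fun s => stepIntensity P ψ h b Δ s ω) x) x.2.2 t ∂(P ω)) := by
    refine sobolevNorm_congr fun t ht => ?_
    have htT : t.toNNReal ≤ T := Real.toNNReal_le_iff_le_coe.2 ht.2
    have := (hpath t.toNNReal htT).2
    rw [Real.coe_toNNReal t ht.1] at this
    rw [← this, hrisk _ htT, discreteRisk]
  rw [hcongr]
  refine (sobolevNorm_integral_le _ (measurable_pathKernel T Δ (measurable_accept hlamω)
    (measurable_accept hstepω)) fun t ht => ?_).trans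
    (lintegral_sobolevNorm_pathKernel_le hη hη1 hΔ (measurable_accept hlamω))
  have := (hpath t.toNNReal (Real.toNNReal_le_iff_le_coe.2 ht.2)).1
  rwa [Real.coe_toNNReal t ht.1] at this

end Path

/-! ### The constants of the estimate -/

section Constants

variable {ν : Measure ℝ} {h b : ℝ → ℝ} {L T Δ : ℝ≥0} {η : ℝ}

theorem regularityConst_nonneg (h : ℝ → ℝ) {T Δ : ℝ} (hΔ : 0 ≤ Δ) (hΔT : Δ ≤ T) :
    0 ≤ regularityConst h T Δ :=
  add_nonneg (add_nonneg (intervalIntegral.integral_nonneg hΔ fun _ _ => abs_nonneg _)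
    (Real.iSup_nonneg fun _ => intervalIntegral.integral_nonneg (sub_nonneg.2 hΔT)
      fun _ _ => abs_nonneg _))
    (intervalIntegral.integral_nonneg (sub_nonneg.2 hΔT) fun _ _ => abs_nonneg _)

theorem ofReal_rho (hb0 : ∀ y, 0 ≤ b y) (hbi : Integrable b ν)
    (hhT : IntegrableOn h (Icc 0 (T : ℝ))) :
    L * ((∫⁻ y, ENNReal.ofReal (b y) ∂ν) * ∫⁻ t in Iic T, ENNReal.ofReal |h t| ∂lebesgueNN) =
      ENNReal.ofReal (rho L ν b h T) := by
  have h1 : 0 ≤ ∫ t in (0 : ℝ)..T, |h t| :=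
    intervalIntegral.integral_nonneg T.coe_nonneg fun _ _ => abs_nonneg _
  rw [lintegral_Iic_ofReal_abs hhT, ← ofReal_integral_eq_lintegral_ofReal hbi (ae_of_all _ hb0),
      rho,
    ENNReal.ofReal_mul (mul_nonneg L.coe_nonneg h1), ENNReal.ofReal_mul L.coe_nonneg,
        ENNReal.ofReal_coe_nnreal]
  ring

theorem ofReal_rhoDiscrete (hb0 : ∀ y, 0 ≤ b y) (hbi : Integrable b ν) {M : ℕ}
    (hΔM : Δ = T / (M : ℝ≥0)) :
    L * ((∫⁻ y, ENNReal.ofReal (b y) ∂ν) *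
        ∑ k ∈ Finset.Icc 1 M, ENNReal.ofReal |h ((k : ℝ) * Δ)| * Δ) =
      ENNReal.ofReal (rhoDiscrete L ν b h T M) := by
  have hc : (T : ℝ) / M = Δ := by rw [hΔM]; push_cast; rfl
  have h1 : ∀ k ∈ Finset.Icc 1 M, 0 ≤ |h ((k : ℝ) * Δ)| * (Δ : ℝ) :=
    fun k _ => mul_nonneg (abs_nonneg _) Δ.coe_nonneg
  rw [← ofReal_integral_eq_lintegral_ofReal hbi (ae_of_all _ hb0), rhoDiscrete, hc,
    ENNReal.ofReal_mul (mul_nonneg L.coe_nonneg (Finset.sum_nonneg h1)),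
        ENNReal.ofReal_mul L.coe_nonneg,
    ENNReal.ofReal_coe_nnreal, ENNReal.ofReal_sum_of_nonneg h1]
  simp only [ENNReal.ofReal_mul (abs_nonneg _), ENNReal.ofReal_coe_nnreal]
  ring

/-- For `l ≤ l₀` the power `l^(1-η)` dominates. -/
theorem intervalNorm_le_rpow (hη : 0 < η) {l l₀ : ℝ} (hl : 0 < l) (hl₀ : l ≤ l₀) :
    intervalNorm η l ≤ (l₀ ^ η + 4 / (η * (1 - η))) * l ^ (1 - η) := by
  have h1 : l ≤ l₀ ^ η * l ^ (1 - η) := by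
    calc l = l ^ η * l ^ (1 - η) := by
          rw [← Real.rpow_add hl, add_sub_cancel, Real.rpow_one]
      _ ≤ _ := mul_le_mul_of_nonneg_right (Real.rpow_le_rpow hl.le hl₀ hη.le)
          (Real.rpow_nonneg hl.le _)
  rw [intervalNorm, add_mul]
  linarith

/-- For `l ≥ l₀` the linear term dominates. -/
theorem intervalNorm_le_mul (hη : 0 < η) (hη1 : η < 1) {l l₀ : ℝ} (hl₀ : 0 < l₀) (hl : l₀ ≤ l) :
    intervalNorm η l ≤ (1 + 4 / (η * (1 - η)) * l₀ ^ (-η)) * l := by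
  have hlp := hl₀.trans_le hl
  have h1 : l ^ (1 - η) ≤ l₀ ^ (-η) * l := by
    calc l ^ (1 - η) = l ^ (-η) * l := by
          rw [sub_eq_neg_add, Real.rpow_add hlp, Real.rpow_one]
      _ ≤ _ := mul_le_mul_of_nonneg_right (Real.rpow_le_rpow_of_nonpos hl₀ hl (by linarith)) hlp.le
  have h2 : 0 ≤ 4 / (η * (1 - η)) := div_nonneg (by norm_num) (mul_pos hη (by linarith)).le
  rw [intervalNorm, add_mul, one_mul, mul_assoc]
  gcongr

theorem intervalNorm_nonneg (hη : 0 < η) (hη1 : η < 1) {l : ℝ} (hl : 0 ≤ l) :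
    0 ≤ intervalNorm η l :=
  add_nonneg hl (mul_nonneg (div_nonneg (by norm_num) (mul_pos hη (by linarith)).le)
    (Real.rpow_nonneg hl _))

end Constants

/-! ### The mean distance of the two risk processes -/

section Mean

variable {Ω : Type*} [mΩ : MeasurableSpace Ω] {P : Ω → Measure Point} {ν : Measure ℝ}
  [IsProbabilityMeasure ν] {Q : Measure Ω} [IsProbabilityMeasure Q]
  {ψ h b : ℝ → ℝ} {L : ℝ≥0} {c : ℝ} {T Δ : ℝ≥0} {R lam : ℝ≥0 → Ω → ℝ} {η : ℝ}

theorem lintegral_indicator_Iic_mul (f : ℝ≥0 → ℝ≥0∞) (T : ℝ≥0) :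
    ∫⁻ s, (Iic T).indicator 1 s * f s ∂lebesgueNN = ∫⁻ s in Iic T, f s ∂lebesgueNN := by
  rw [← lintegral_indicator measurableSet_Iic]
  refine lintegral_congr fun s => ?_
  by_cases hs : s ∈ Iic T <;> simp [hs]

theorem lintegral_sobolevNorm_risk_sub_le (hP : IsPoissonRandomMeasure P (intensityMeasure ν) Q)
    (hR : IsHawkesRisk Q P hP.measurable ψ h b T R lam)
    (hψL : LipschitzWith L ψ) (hψc : ψ 0 ≤ c) (hb : Measurable b) (hb0 : ∀ y, 0 ≤ b y)
    (hbν : ∫⁻ y, ENNReal.ofReal (b y) ∂ν < ∞) (hyν : ∫⁻ y, ‖y‖ₑ ∂ν < ∞)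
    (hη : 0 < η) (hη1 : η < 1) (hΔ : 0 < Δ)
    (hfin : ∫⁻ s in Iic T,
        density Q (below (pointFiltration P hP.measurable) lam) s ∂lebesgueNN < ∞) :
    ∫⁻ ω, sobolevNorm η T
        (fun t : ℝ => R t.toNNReal ω - discreteRisk P ψ h b Δ t.toNNReal ω) ∂Q ≤
      (∫⁻ y, ‖y‖ₑ ∂ν) * (ENNReal.ofReal (intervalNorm η Δ) *
          ∫⁻ s in Iic T, density Q (below (pointFiltration P hP.measurable) lam) s ∂lebesgueNN +
        ENNReal.ofReal (intervalNorm η T) * ∫⁻ s in Iic T,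
          ∫⁻ ω, ENNReal.ofReal |lam s ω - stepIntensity P ψ h b Δ s ω| ∂Q ∂lebesgueNN) := by
  have hlam : Measurable fun z : Pred (pointFiltration P hP.measurable) => lam z.time z.outcome :=
    IsStronglyPredictable.measurable_pred hR.predictable
  have hstep := measurable_stepIntensity (h := h) hP.measurable
    (LipschitzWith.measurable_real hψL) hb hb0 hΔ
  have hD₁ := measurableSet_below hlam
  have hD₂ := measurableSet_between hlam hstep
  have hw : Measurable ((Iic T).indicator (1 : ℝ≥0 → ℝ≥0∞)) :=
    measurable_one.indicator measurableSet_Iic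
  refine (lintegral_mono_ae (ae_sobolevNorm_risk_sub_le hP hR hψL hψc hb hb0 hbν hyν hη hη1 hΔ
    hfin)).trans ?_
  rw [lintegral_add_left' ((hP.aemeasurable_lintegral
      (measurable_integrand hD₁ hw measurable_enorm)).const_mul _),
    lintegral_const_mul' _ _ ENNReal.ofReal_ne_top, lintegral_const_mul' _ _ ENNReal.ofReal_ne_top,
    hP.campbell_density hD₁ hw measurable_enorm, hP.campbell_density hD₂ hw measurable_enorm,
    lintegral_indicator_Iic_mul, lintegral_indicator_Iic_mul, mul_add, mul_left_comm,
    mul_left_comm (ENNReal.ofReal (intervalNorm η T))]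
  gcongr
  exact density_between_le _ _ _ _

/-- The mean distance of the two risk processes, with an explicit constant. -/
theorem lintegral_sobolevNorm_risk_sub_le_ofReal
    (hP : IsPoissonRandomMeasure P (intensityMeasure ν) Q)
    (hR : IsHawkesRisk Q P hP.measurable ψ h b T R lam)
    (hψL : LipschitzWith L ψ) (hψ0 : ∀ x, 0 ≤ ψ x) (hψc : ψ 0 ≤ c)
    (hb : Measurable b) (hb0 : ∀ y, 0 ≤ b y) (hbi : Integrable b ν)
    (hν : Integrable (fun y : ℝ => y) ν) (hh : Measurable h) (hhT : IntegrableOn h (Icc 0 (T : ℝ)))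
    (hη : 0 < η) (hη1 : η < 1) (hΔ : 0 < Δ) {M : ℕ} (hM : 1 ≤ M) (hΔM : Δ = T / (M : ℝ≥0)) {r : ℝ}
    (hr : r < 1) (hρ : rho L ν b h T ≤ r) (hρΔ : rhoDiscrete L ν b h T M < 1) :
    ∫⁻ ω, sobolevNorm η T
        (fun t : ℝ => R t.toNNReal ω - discreteRisk P ψ h b Δ t.toNNReal ω) ∂Q ≤
      ENNReal.ofReal ((∫ y, |y| ∂ν) * (intervalNorm η Δ * (max c 0 * T / (1 - r)) +
        intervalNorm η T * (L * ((∫ y, b y ∂ν) * (regularityConst h T Δ *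
          (max c 0 * T / (1 - r)))) / (1 - rhoDiscrete L ν b h T M)))) := by
  have hM0 : (M : ℝ≥0) ≠ 0 := by exact_mod_cast (by omega : M ≠ 0)
  have hT : T = M * Δ := by rw [hΔM, mul_div_cancel₀ _ hM0]
  have hbν : ∫⁻ y, ENNReal.ofReal (b y) ∂ν < ∞ := by
    rw [← ofReal_integral_eq_lintegral_ofReal hbi (ae_of_all _ hb0)]; exact ENNReal.ofReal_lt_top
  have hyν : ∫⁻ y, ‖y‖ₑ ∂ν < ∞ := hν.2
  have hB0 : 0 ≤ ∫ y, b y ∂ν := integral_nonneg hb0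
  have hρ0 : 0 ≤ rho L ν b h T := mul_nonneg (mul_nonneg L.coe_nonneg
    (intervalIntegral.integral_nonneg T.coe_nonneg fun _ _ => abs_nonneg _)) hB0
  have hρΔ0 : 0 ≤ rhoDiscrete L ν b h T M := mul_nonneg (mul_nonneg L.coe_nonneg
    (Finset.sum_nonneg fun k _ => mul_nonneg (abs_nonneg _) (by positivity))) hB0
  have hr0 : 0 ≤ r := hρ0.trans hρ
  have hr1 : 0 < 1 - r := sub_pos.2 hr
  have hr2 : 0 < 1 - rhoDiscrete L ν b h T M := sub_pos.2 hρΔ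
  have hΔT : (Δ : ℝ) ≤ T := by
    rw [hT]
    exact_mod_cast le_mul_of_one_le_left zero_le (by exact_mod_cast hM)
  have hC0 : 0 ≤ regularityConst h T Δ := regularityConst_nonneg h Δ.coe_nonneg hΔT
  have hx0 : 0 ≤ max c 0 * T / (1 - r) :=
    div_nonneg (mul_nonneg (le_max_right _ _) T.coe_nonneg) hr1.le
  have hsub : ∀ {x : ℝ}, 0 ≤ x → 1 - ENNReal.ofReal x = ENNReal.ofReal (1 - x) := fun {x} hx => by
    rw [ENNReal.ofReal_sub _ hx, ENNReal.ofReal_one]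
  have hX := lintegral_intensity_le hP hR hψL hψc hb hb0 hh
    (by rw [lintegral_Iic_ofReal_abs hhT]; exact ENNReal.ofReal_lt_top)
    (ρ := ENNReal.ofReal r) (ENNReal.ofReal_lt_one.2 hr)
    ((ofReal_rho hb0 hbi hhT).le.trans (ENNReal.ofReal_le_ofReal hρ))
  have hX' : ENNReal.ofReal c * T / (1 - ENNReal.ofReal r) =
      ENNReal.ofReal (max c 0 * T / (1 - r)) := by
    rw [hsub hr0, ENNReal.ofReal_div_of_pos hr1, ENNReal.ofReal_mul (le_max_right _ _),
      ENNReal.ofReal_coe_nnreal, ENNReal.ofReal_max, ENNReal.ofReal_zero, max_eq_left zero_le]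
  rw [hX'] at hX
  have hfin := hX.trans_lt ENNReal.ofReal_lt_top
  have hA := lintegral_intensity_sub_le hP hR hψL hψ0 hψc hb hb0 hbν hh hhT hΔ hM hT hfin
    (ρ := ENNReal.ofReal (rhoDiscrete L ν b h T M)) (ENNReal.ofReal_lt_one.2 hρΔ)
    (ofReal_rhoDiscrete hb0 hbi hΔM).le
  refine (lintegral_sobolevNorm_risk_sub_le hP hR hψL hψc hb hb0 hbν hyν hη hη1 hΔ hfin).trans ?_
  have hY : ∫⁻ y, ‖y‖ₑ ∂ν = ENNReal.ofReal (∫ y, |y| ∂ν) := by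
    rw [ofReal_integral_eq_lintegral_ofReal hν.abs (ae_of_all _ fun _ => abs_nonneg _)]
    simp only [Real.enorm_eq_ofReal_abs]
  have hN1 := intervalNorm_nonneg hη hη1 Δ.coe_nonneg
  have hN2 := intervalNorm_nonneg hη hη1 T.coe_nonneg
  have hx1 : 0 ≤ regularityConst h T Δ * (max c 0 * T / (1 - r)) := mul_nonneg hC0 hx0
  have hx2 : 0 ≤ L * ((∫ y, b y ∂ν) * (regularityConst h T Δ * (max c 0 * T / (1 - r)))) :=
    mul_nonneg L.coe_nonneg (mul_nonneg hB0 hx1)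
  rw [hY, ENNReal.ofReal_mul (integral_nonneg fun _ => abs_nonneg _),
    ENNReal.ofReal_add (mul_nonneg hN1 hx0) (mul_nonneg hN2 (div_nonneg hx2 hr2.le)),
    ENNReal.ofReal_mul hN1, ENNReal.ofReal_mul hN2, ENNReal.ofReal_div_of_pos hr2,
    ENNReal.ofReal_mul L.coe_nonneg, ENNReal.ofReal_mul hB0, ENNReal.ofReal_mul hC0,
    ENNReal.ofReal_coe_nnreal, ofReal_integral_eq_lintegral_ofReal hbi (ae_of_all _ hb0),
    ← hsub hρΔ0]
  gcongr
  refine hA.trans ?_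
  gcongr

end Mean

end HawkesRisk

open HawkesRisk in
theorem mainTheorem1
    (η : ℝ) (hη₀ : 0 < η) (hη₁ : η < 1)
    (L : ℝ≥0) (c : ℝ)
    (ν : Measure ℝ) [IsProbabilityMeasure ν] (hν : Integrable (fun y : ℝ => y) ν)
    (b : ℝ → ℝ) (hb_meas : Measurable b) (hb_nonneg : ∀ y, 0 ≤ b y) (hb_int : Integrable b ν)
    (r : ℝ) (hr : r < 1) (T₀ Δ₀ : ℝ≥0) (hT₀ : 0 < T₀) (hΔ₀ : 0 < Δ₀) :
    ∃ K : ℝ, 0 < K ∧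
      ∀ (ψ : ℝ → ℝ), LipschitzWith L ψ → (∀ x, 0 ≤ ψ x) → ψ 0 ≤ c →
      ∀ (T : ℝ≥0) (M : ℕ), T₀ ≤ T → 1 ≤ M → T / (M : ℝ≥0) ≤ Δ₀ →
      ∀ (h : ℝ → ℝ), Measurable h → IntegrableOn h (Set.Icc 0 (T : ℝ)) →
        rho L ν b h T ≤ r → rhoDiscrete L ν b h T M < 1 →
      ∀ (Ω : Type*) [MeasurableSpace Ω] (Q : Measure Ω) [IsProbabilityMeasure Q]
        (P : Ω → Measure Point) (hP : IsPoissonRandomMeasure P (intensityMeasure ν) Q)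
        (R lam : ℝ≥0 → Ω → ℝ), IsHawkesRisk Q P hP.measurable ψ h b T R lam →
        ∫⁻ ω, sobolevNorm η (T : ℝ)
            (fun t : ℝ => R t.toNNReal ω -
              discreteRisk P ψ h b (T / (M : ℝ≥0)) t.toNNReal ω) ∂Q
          ≤ ENNReal.ofReal (K * stabilityConst L ν b h T M *
              ((T : ℝ) ^ 2 * regularityConst h (T : ℝ) ((T : ℝ) / M)
                + (T : ℝ) * ((T : ℝ) / M) ^ (1 - η))) := by
  set a₁ : ℝ := (Δ₀ : ℝ) ^ η + 4 / (η * (1 - η)) with ha₁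
  set a₂ : ℝ := 1 + 4 / (η * (1 - η)) * (T₀ : ℝ) ^ (-η) with ha₂
  set y : ℝ := ∫ y, |y| ∂ν
  set B : ℝ := ∫ y, b y ∂ν
  have hC : 0 ≤ 4 / (η * (1 - η)) := div_nonneg (by norm_num) (mul_pos hη₀ (by linarith)).le
  have ha₁0 : 0 ≤ a₁ := by positivity
  have ha₂0 : 0 ≤ a₂ := by positivity
  have hy0 : 0 ≤ y := integral_nonneg fun _ => abs_nonneg _
  have hB0 : 0 ≤ B := integral_nonneg hb_nonneg
  have hr1 : 0 < 1 - r := sub_pos.2 hr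
  have hc0 : 0 ≤ max c 0 := le_max_right _ _
  set κ : ℝ := y * (max c 0 / (1 - r)) with hκ
  have hκ0 : 0 ≤ κ := mul_nonneg hy0 (div_nonneg hc0 hr1.le)
  -- `κ * a₁` and `κ * a₂ * L * B` are the constants of the two terms; `κ` may vanish, and the
  -- summand `1` makes the constant positive in any case
  refine ⟨κ * (a₁ + a₂ * (L * B)) + 1, by positivity, ?_⟩
  intro ψ hψL hψ0 hψc T M hT₀T hM hΔ h hh hhT hρ hρΔ Ω _ Q _ P hP R lam hR
  have hT0 : 0 < T := hT₀.trans_le hT₀T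
  have hM0 : (0 : ℝ≥0) < M := by exact_mod_cast hM
  have hΔ0 : 0 < T / (M : ℝ≥0) := div_pos hT0 hM0
  refine (lintegral_sobolevNorm_risk_sub_le_ofReal hP hR hψL hψ0 hψc hb_meas hb_nonneg hb_int hν hh
    hhT hη₀ hη₁ hΔ0 hM rfl hr hρ hρΔ).trans (ENNReal.ofReal_le_ofReal ?_)
  have hcoe : ((T / (M : ℝ≥0) : ℝ≥0) : ℝ) = (T : ℝ) / M := by push_cast; rfl
  have hΔ' : (T : ℝ) / M ≤ Δ₀ := by rw [← hcoe]; exact hΔ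
  have hΔ0' : 0 < (T : ℝ) / M := by rw [← hcoe]; exact hΔ0
  have hN1 := intervalNorm_le_rpow hη₀ hΔ0' hΔ'
  have hN2 := intervalNorm_le_mul hη₀ hη₁ (l₀ := T₀) (l := T) hT₀ hT₀T
  have hT0' : (0 : ℝ) < T := hT0
  have hΔT : (T : ℝ) / M ≤ T := div_le_self hT0'.le (by exact_mod_cast hM)
  have hCR : 0 ≤ regularityConst h T ((T : ℝ) / M) := regularityConst_nonneg h hΔ0'.le hΔT
  rw [hcoe]
  set CR := regularityConst h T ((T : ℝ) / M)
  have hd : 0 < 1 - rhoDiscrete L ν b h T M := sub_pos.2 hρΔ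
  have hd' : 0 < 1 - rho L ν b h T := by linarith
  have hρ0 : 0 ≤ rho L ν b h T := mul_nonneg (mul_nonneg L.coe_nonneg
    (intervalIntegral.integral_nonneg T.coe_nonneg fun _ _ => abs_nonneg _)) hB0
  set s := 1 / (1 - rhoDiscrete L ν b h T M) with hs
  have hs0 : 0 ≤ s := by positivity
  -- the second summand of the stability constant bounds `s`, the first one bounds `1`
  have hS1 : 1 ≤ stabilityConst L ν b h T M := by
    have : 1 ≤ 1 / (1 - rho L ν b h T) := by rw [le_div_iff₀ hd']; linarith
    rw [stabilityConst]; linarith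
  have hS2 : s ≤ stabilityConst L ν b h T M := by
    have : 0 ≤ 1 / (1 - rho L ν b h T) := by positivity
    rw [stabilityConst]; linarith
  set S := stabilityConst L ν b h T M
  have hp : 0 ≤ ((T : ℝ) / M) ^ (1 - η) := Real.rpow_nonneg hΔ0'.le _
  set p := ((T : ℝ) / M) ^ (1 - η)
  have hS0 : 0 ≤ S := by linarith
  calc y * (intervalNorm η ((T : ℝ) / M) * (max c 0 * T / (1 - r)) + intervalNorm η T *
        (L * (B * (CR * (max c 0 * T / (1 - r)))) / (1 - rhoDiscrete L ν b h T M)))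
      ≤ y * (a₁ * p * (max c 0 * T / (1 - r)) + a₂ * T *
        (L * (B * (CR * (max c 0 * T / (1 - r)))) / (1 - rhoDiscrete L ν b h T M))) := by
        gcongr
    _ = κ * a₁ * (T * p) * 1 + κ * (a₂ * (L * B)) * (T ^ 2 * CR) * s := by
        rw [hκ, hs]; ring
    _ ≤ κ * a₁ * (T * p) * S + κ * (a₂ * (L * B)) * (T ^ 2 * CR) * S := by
        gcongr
    _ ≤ (κ * a₁ * (T * p) * S + κ * (a₂ * (L * B)) * (T ^ 2 * CR) * S) +
          (κ * a₁ * (T ^ 2 * CR) * S + κ * (a₂ * (L * B)) * (T * p) * S +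
            (T ^ 2 * CR + T * p) * S) := le_add_of_nonneg_right (by positivity)
    _ = (κ * (a₁ + a₂ * (L * B)) + 1) * S * (T ^ 2 * CR + T * p) := by ring
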